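/- Let $N\ge 1$, $\kappa_\infty\in\mathbb C\setminus\{0\}$, $\theta_1,\dots,\theta_N\in\mathbb C$, let $t_1,\dots,t_N$ be independent variables and $s_i=t_i^2$. Sums and products without range run over $1,\dots,N$. *Garnier system.* For parameters $\vec\kappa=(\kappa_0,\kappa_1,\kappa_\infty,\theta_1,\dots,\theta_N)$ put $\alpha=-\frac12(\kappa_0+\kappa_1+\kappa_\infty+\sum_i\theta_i-1)$, $R_{ij}=\frac{s_i(s_j-1)}{s_j-s_i}$, $S_{ij}=\frac{s_i(s_i-1)}{s_i-s_j}$. The Hamiltonians $H_i=H_i(q,p,s;\vec\kappa)$ are given by $$\begin{aligned}s_i(s_i-1)H_i={}&q_i\Bigl(\alpha+\sum_jq_jp_j\Bigr)\Bigl(\alpha+\kappa_\infty+\sum_jq_jp_j\Bigr)+s_ip_i(q_ip_i-\theta_i)\\&-\sum_{j\ne i}R_{ji}(q_jp_j-\theta_j)q_ip_j-\sum_{j\ne i}S_{ij}(q_ip_i-\theta_i)q_jp_i-\sum_{j\ne i}R_{ij}q_jp_j(q_ip_i-\theta_i)-\sum_{j\ne i}R_{ij}q_ip_i(q_jp_j-\theta_j)\\&-(s_i+1)(q_ip_i-\theta_i)q_ip_i+(\kappa_1s_i+\kappa_0-1)q_ip_i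 .\end{aligned}$$ A $\tau$-function of a solution $(q,p)$ is a function $\tau$, determined up to a multiplicative constant, with $d\log\tau=\sum_iH_i\,ds_i$. *Transformations.* Consider the following involutive birational maps of $(q,p,\vec\kappa)$; what is not mentioned stays unchanged. $R_{\kappa_\infty}$: $\kappa_\infty\mapsto-\kappa_\infty$. $R_{\kappa_1}$: $\kappa_1\mapsto-\kappa_1$, $p_i\mapsto p_i-\frac{\kappa_1}{\sum_jq_j-1}$. $R_{\kappa_0}$: $\kappa_0\mapsto-\kappa_0$, $p_i\mapsto p_i-\frac{\kappa_0}{s_i(\sum_jq_j/s_j-1)}$. $R_{\theta_j}$: $\theta_j\mapsto-\theta_j$, $p_j\mapsto p_j-\theta_j/q_j$. $R_\tau$: $\vec\kappa\mapsto(1-\kappa_0,1-\kappa_1,-\kappa_\infty,-\theta_1,\dots,-\theta_N)$, $q_i\mapsto Q_i=\frac{s_ip_i(q_ip_i-\theta_i)}{(\alpha+\sum_jq_jp_j)(\alpha+\kappa_\infty+\sum_jq_jp_j)}$, $p_i\mapsto P_i$ with $Q_iP_i=-q_ip_i$. Let $l=R_{\kappa_1}\circ R_\tau\circ R_{\theta_1}\circ\dots\circ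 R_{\theta_N}\circ R_{\kappa_\infty}\circ R_{\kappa_0}$ and $\tilde l=R_{\kappa_1}\circ l\circ R_{\kappa_1}$ (the right-most factor acts first), which shift $(\kappa_0,\kappa_1)$ by $(1,-1)$ and $(1,1)$. *Normalized $\tau$-functions.* For $\kappa_0=\kappa_1=\frac12$ the Garnier system has the algebraic solution $(q_i,p_i)=\bigl(\theta_it_i/\kappa_\infty,\ \kappa_\infty/(2t_i)\bigr)$. Assume that $l,\tilde l,l^{-1},\tilde l^{-1}$, as compositions of the maps above, are defined at all its images under $\tilde l^ml^n$, $m,n\in\mathbb Z$, that is, none of the denominators that occur (including the $Q_i$ in $P_i=-q_ip_i/Q_i$) is the zero rational function of $t$; this is the case for generic $(\kappa_\infty,\theta_1,\dots,\theta_N)$. Let $\tau_{m,n}$ be a $\tau$-function of the image under $\tilde l^ml^n$, and let $$T_{m,n}=\tau_{m,n}\prod_i\Bigl\{t_i^{(\theta_i+m+n)(\theta_i+m+n-1)/2}(t_i+1)^{-\theta_i(\sum_k\theta_k+\kappa_\infty+2m)/2}(t_i-1)^{-\theta_i(\sum_k\theta_k-\kappa_\infty+2m)/2}\Bigr\}\prod_{i\ne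 j}(t_i+t_j)^{\theta_i\theta_j/2},$$ the last product being over ordered pairs. **Proposition.** The $T_{m,n}$ are, up to constant factors, non-zero rational functions of $t$, and the multiplicative constants in the $\tau_{m,n}$ can be chosen in such a way that $$T_{0,0}=T_{0,1}=1,\qquad T_{1,0}=\sum_i\theta_it_i-\kappa_\infty,\qquad T_{1,1}=\prod_it_i\Bigl(\kappa_\infty-\sum_j\theta_jt_j^{-1}\Bigr),$$ and for all $m,n\in\mathbb Z$ $$T_{m+1,n}=\prod_it_i\,\bigl\{E(T_{m,n})+(2m)^2\bigr\}\frac{T_{m,n}^2}{T_{m-1,n}},\qquad T_{m,n+1}=\prod_it_i\,\bigl\{E(T_{m,n})+(2n-1)^2\bigr\}\frac{T_{m,n}^2}{T_{m,n-1}},$$ where $$E(T)=\Bigl(\sum_i\frac{t_i^2-1}{t_i}\frac{\partial}{\partial t_i}-2\Bigr)\sum_it_i(t_i^2-1)\frac{\partial}{\partial t_i}\log T+\kappa_\infty\sum_i\theta_i\frac{t_i^2+1}{t_i}-\frac12\sum_{i,j}\theta_i\theta_j\frac{t_i^2+t_j^2}{t_it_j}-\kappa_\infty^2 .$$ The family $(T_{m,n})_{m,n\in\mathbb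 Z}$ with these properties is unique. -/

import Mathlib

namespace Garnier

noncomputable section

/-- The field `ℂ(t₁, …, t_N)` of rational functions. -/
abbrev RatFun (N : ℕ) : Type := FractionRing (MvPolynomial (Fin N) ℂ)

/-- The variable `t_i`. -/
def tvar {N : ℕ} (i : Fin N) : RatFun N :=
  algebraMap (MvPolynomial (Fin N) ℂ) (RatFun N) (MvPolynomial.X i)

/-- The constant rational function `c`. -/
def cst {N : ℕ} (c : ℂ) : RatFun N :=
  algebraMap (MvPolynomial (Fin N) ℂ) (RatFun N) (MvPolynomial.C c)

/-- `∂f/∂t_i`, by the quotient rule. -/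
def pd {N : ℕ} (i : Fin N) (f : RatFun N) : RatFun N :=
  let a : MvPolynomial (Fin N) ℂ := IsFractionRing.num (MvPolynomial (Fin N) ℂ) f
  let b : MvPolynomial (Fin N) ℂ := IsFractionRing.den (MvPolynomial (Fin N) ℂ) f
  algebraMap (MvPolynomial (Fin N) ℂ) (RatFun N)
      (MvPolynomial.pderiv i a * b - a * MvPolynomial.pderiv i b) /
    algebraMap (MvPolynomial (Fin N) ℂ) (RatFun N) (b ^ 2)

/-- `∂/∂t_i log f`. -/
def dlog {N : ℕ} (i : Fin N) (f : RatFun N) : RatFun N := pd i f / f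

/-- The rational function `f` is regular at the point `t` and takes the value `v` there. -/
def HasValueAt {N : ℕ} (f : RatFun N) (t : Fin N → ℂ) (v : ℂ) : Prop :=
  ∃ a b : MvPolynomial (Fin N) ℂ, MvPolynomial.eval t b ≠ 0 ∧
    f = algebraMap (MvPolynomial (Fin N) ℂ) (RatFun N) a /
      algebraMap (MvPolynomial (Fin N) ℂ) (RatFun N) b ∧
    v = MvPolynomial.eval t a / MvPolynomial.eval t b

/-- Canonical variables `(q, p)` together with the parameters
`(κ₀, κ₁, κ_∞, θ₁, …, θ_N)` of the Garnier system. -/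
structure Datum (N : ℕ) (F : Type) where
  q : Fin N → F
  p : Fin N → F
  k0 : F
  k1 : F
  kinf : F
  th : Fin N → F

/-- `α = -(κ₀ + κ₁ + κ_∞ + ∑ θ_i - 1) / 2`. -/
def Datum.alpha {N : ℕ} {F : Type} [Field F] (x : Datum N F) : F :=
  -(x.k0 + x.k1 + x.kinf + ∑ i, x.th i - 1) / 2

/-- `∑ q_j p_j`. -/
def Datum.qp {N : ℕ} {F : Type} [Field F] (x : Datum N F) : F := ∑ j, x.q j * x.p j

/-- `R_{ij} = s_i (s_j - 1) / (s_j - s_i)`. -/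
def Rcoef {N : ℕ} {F : Type} [Field F] (s : Fin N → F) (i j : Fin N) : F :=
  s i * (s j - 1) / (s j - s i)

/-- `S_{ij} = s_i (s_i - 1) / (s_i - s_j)`. -/
def Scoef {N : ℕ} {F : Type} [Field F] (s : Fin N → F) (i j : Fin N) : F :=
  s i * (s i - 1) / (s i - s j)

/-- The Hamiltonian `H_i` of the Garnier system in `N` variables. -/
def ham {N : ℕ} {F : Type} [Field F] (s : Fin N → F) (x : Datum N F) (i : Fin N) : F :=
  (x.q i * (x.alpha + x.qp) * (x.alpha + x.kinf + x.qp)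
    + s i * x.p i * (x.q i * x.p i - x.th i)
    - ∑ j ∈ Finset.univ.erase i,
        Rcoef s j i * (x.q j * x.p j - x.th j) * x.q i * x.p j
    - ∑ j ∈ Finset.univ.erase i,
        Scoef s i j * (x.q i * x.p i - x.th i) * x.q j * x.p i
    - ∑ j ∈ Finset.univ.erase i,
        Rcoef s i j * x.q j * x.p j * (x.q i * x.p i - x.th i)
    - ∑ j ∈ Finset.univ.erase i,
        Rcoef s i j * x.q i * x.p i * (x.q j * x.p j - x.th j)
    - (s i + 1) * (x.q i * x.p i - x.th i) * x.q i * x.p i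
    + (x.k1 * s i + x.k0 - 1) * x.q i * x.p i) / (s i * (s i - 1))

/-- A partially defined self-map: `map` is meaningful on `dom` only. -/
structure PMap (A : Type) where
  dom : A → Prop
  map : A → A

/-- `g ∘ f`, defined where `f` is defined and `g` is defined at the image. -/
def PMap.comp {A : Type} (g f : PMap A) : PMap A where
  dom x := f.dom x ∧ g.dom (f.map x)
  map x := g.map (f.map x)

/-- `R_{κ_∞}` : `κ_∞ ↦ -κ_∞`. -/
def Rkinf {N : ℕ} {F : Type} [Field F] : PMap (Datum N F) where
  dom _ := True
  map x := { x with kinf := -x.kinf }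

/-- `R_{κ₁}` : `κ₁ ↦ -κ₁`, `p_i ↦ p_i - κ₁ / (g₁ - 1)` with `g₁ = ∑ q_j`. -/
def Rk1 {N : ℕ} {F : Type} [Field F] : PMap (Datum N F) where
  dom x := ∑ j, x.q j - 1 ≠ 0
  map x := { x with k1 := -x.k1, p := fun i => x.p i - x.k1 / (∑ j, x.q j - 1) }

/-- `R_{κ₀}` : `κ₀ ↦ -κ₀`, `p_i ↦ p_i - κ₀ / (s_i (g_s - 1))` with `g_s = ∑ q_j / s_j`. -/
def Rk0 {N : ℕ} {F : Type} [Field F] (s : Fin N → F) : PMap (Datum N F) where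
  dom x := ∑ j, x.q j / s j - 1 ≠ 0
  map x := { x with
    k0 := -x.k0, p := fun i => x.p i - x.k0 / (s i * (∑ j, x.q j / s j - 1)) }

/-- `R_{θ₁} ∘ ⋯ ∘ R_{θ_N}`, where `R_{θ_j}` is `θ_j ↦ -θ_j`, `p_j ↦ p_j - θ_j / q_j` and
changes nothing else, so that the factors act independently of each other. -/
def Rth {N : ℕ} {F : Type} [Field F] : PMap (Datum N F) where
  dom x := ∀ j, x.q j ≠ 0
  map x := { x with th := fun j => -x.th j, p := fun j => x.p j - x.th j / x.q j }

/-- The new `q_i` of `R_τ`. -/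
def RtauQ {N : ℕ} {F : Type} [Field F] (s : Fin N → F) (x : Datum N F) (i : Fin N) : F :=
  s i * x.p i * (x.q i * x.p i - x.th i) /
    ((x.alpha + x.qp) * (x.alpha + x.kinf + x.qp))

/-- `R_τ` : `(κ₀, κ₁, κ_∞, θ) ↦ (1 - κ₀, 1 - κ₁, -κ_∞, -θ)`, `q_i ↦ Q_i` as above and
`p_i ↦ P_i` with `Q_i P_i = -q_i p_i`. -/
def Rtau {N : ℕ} {F : Type} [Field F] (s : Fin N → F) : PMap (Datum N F) where
  dom x := (x.alpha + x.qp) * (x.alpha + x.kinf + x.qp) ≠ 0 ∧ ∀ i, RtauQ s x i ≠ 0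
  map x :=
    { q := RtauQ s x
      p := fun i => -(x.q i * x.p i) / RtauQ s x i
      k0 := 1 - x.k0
      k1 := 1 - x.k1
      kinf := -x.kinf
      th := fun i => -x.th i }

/-- `l = R_{κ₁} ∘ R_τ ∘ R_{θ₁} ∘ ⋯ ∘ R_{θ_N} ∘ R_{κ_∞} ∘ R_{κ₀}`; it shifts
`(κ₀, κ₁)` by `(1, -1)`. -/
def transL {N : ℕ} {F : Type} [Field F] (s : Fin N → F) : PMap (Datum N F) :=
  Rk1.comp ((Rtau s).comp (Rth.comp (Rkinf.comp (Rk0 s))))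

/-- `l⁻¹` (every factor of `l` is an involution). -/
def transLInv {N : ℕ} {F : Type} [Field F] (s : Fin N → F) : PMap (Datum N F) :=
  (Rk0 s).comp (Rkinf.comp (Rth.comp ((Rtau s).comp Rk1)))

/-- `l̃ = R_{κ₁} ∘ l ∘ R_{κ₁}`; it shifts `(κ₀, κ₁)` by `(1, 1)`. -/
def transLt {N : ℕ} {F : Type} [Field F] (s : Fin N → F) : PMap (Datum N F) :=
  Rk1.comp ((transL s).comp Rk1)

/-- `l̃⁻¹`. -/
def transLtInv {N : ℕ} {F : Type} [Field F] (s : Fin N → F) : PMap (Datum N F) :=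
  Rk1.comp ((transLInv s).comp Rk1)

/-- The `n`-th power, `n ∈ ℤ`, of a map `f` with inverse `g`. -/
def zpowMap {A : Type} (f g : A → A) : ℤ → A → A
  | Int.ofNat n => f^[n]
  | Int.negSucc n => g^[n + 1]

/-- `s_i = t_i²`. -/
def svar {N : ℕ} (i : Fin N) : RatFun N := tvar i ^ 2

/-- The algebraic solution `q_i = θ_i √s_i / κ_∞`, `p_i = κ_∞ / (2 √s_i)` of the Garnier
system with `κ₀ = κ₁ = 1/2`, in terms of `t_i = √s_i`. -/
def seed {N : ℕ} (κ : ℂ) (θ : Fin N → ℂ) : Datum N (RatFun N) where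
  q i := cst (θ i) * tvar i / cst κ
  p i := cst κ / (2 * tvar i)
  k0 := 1 / 2
  k1 := 1 / 2
  kinf := cst κ
  th i := cst (θ i)

/-- The algebraic solution `l̃ᵐ lⁿ (seed)`. -/
def sol {N : ℕ} (κ : ℂ) (θ : Fin N → ℂ) (m n : ℤ) : Datum N (RatFun N) :=
  zpowMap (transLt svar).map (transLtInv svar).map m
    (zpowMap (transL svar).map (transLInv svar).map n (seed κ θ))

/-- The birational transformations `l`, `l̃` and their inverses are defined at each of the
solutions `l̃ᵐ lⁿ (seed)`: no denominator vanishes identically. -/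
def OrbitDefined {N : ℕ} (κ : ℂ) (θ : Fin N → ℂ) : Prop :=
  ∀ m n : ℤ,
    (transL svar).dom (sol κ θ m n) ∧ (transLInv svar).dom (sol κ θ m n) ∧
    (transLt svar).dom (sol κ θ m n) ∧ (transLtInv svar).dom (sol κ θ m n)

/-- `τ` is a τ-function of the solution `x` on the open set `U` of the `t`-space:
`τ` is holomorphic without zeros and `d log τ = ∑ H_i ds_i`, where `s_i = t_i²`,
so that `ds_i = 2 t_i dt_i`. -/
def IsTauFunction {N : ℕ} (U : Set (Fin N → ℂ)) (x : Datum N (RatFun N))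
    (τ : (Fin N → ℂ) → ℂ) : Prop :=
  DifferentiableOn ℂ τ U ∧ ∀ t ∈ U, τ t ≠ 0 ∧ ∀ i, ∃ h : ℂ,
    HasValueAt (ham svar x i) t h ∧
    HasDerivAt (fun z => τ (Function.update t i z)) (2 * t i * h * τ t) (t i)

/-- Holomorphic branches on `U` of the logarithms of `t_i`, `t_i + 1`, `t_i - 1` and
`t_i + t_j` (`i ≠ j`). -/
structure LogBranches {N : ℕ} (U : Set (Fin N → ℂ)) where
  log0 : Fin N → (Fin N → ℂ) → ℂ
  logPlus : Fin N → (Fin N → ℂ) → ℂ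
  logMinus : Fin N → (Fin N → ℂ) → ℂ
  logSum : Fin N → Fin N → (Fin N → ℂ) → ℂ
  holo0 : ∀ i, DifferentiableOn ℂ (log0 i) U
  holoPlus : ∀ i, DifferentiableOn ℂ (logPlus i) U
  holoMinus : ∀ i, DifferentiableOn ℂ (logMinus i) U
  holoSum : ∀ i j, i ≠ j → DifferentiableOn ℂ (logSum i j) U
  exp_log0 : ∀ i, ∀ t ∈ U, Complex.exp (log0 i t) = t i
  exp_logPlus : ∀ i, ∀ t ∈ U, Complex.exp (logPlus i t) = t i + 1
  exp_logMinus : ∀ i, ∀ t ∈ U, Complex.exp (logMinus i t) = t i - 1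
  exp_logSum : ∀ i j, i ≠ j → ∀ t ∈ U, Complex.exp (logSum i j t) = t i + t j

/-- The factor
`∏_i t_i^{(θ_i+m+n)(θ_i+m+n-1)/2} (t_i+1)^{-θ_i(∑θ_k+κ_∞+2m)/2} (t_i-1)^{-θ_i(∑θ_k-κ_∞+2m)/2}`
`× ∏_{i≠j} (t_i+t_j)^{θ_iθ_j/2}`, the last product being over ordered pairs. -/
def normFactor {N : ℕ} {U : Set (Fin N → ℂ)} (B : LogBranches U) (κ : ℂ) (θ : Fin N → ℂ)
    (m n : ℤ) (t : Fin N → ℂ) : ℂ :=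
  (∏ i, Complex.exp ((θ i + m + n) * (θ i + m + n - 1) / 2 * B.log0 i t) *
      Complex.exp (-(θ i * (∑ k, θ k + κ + 2 * m)) / 2 * B.logPlus i t) *
      Complex.exp (-(θ i * (∑ k, θ k - κ + 2 * m)) / 2 * B.logMinus i t)) *
    ∏ i, ∏ j ∈ Finset.univ.erase i, Complex.exp (θ i * θ j / 2 * B.logSum i j t)

/-- `T` is, up to the free multiplicative constant of a τ-function, the normalized τ-function
`T_{m,n}`: wherever `T` is regular and does not vanish and branches of the powers are chosen,
`T = τ · normFactor` with `τ` a τ-function of the solution `l̃ᵐ lⁿ (seed)`. -/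
def IsNormalizedTau {N : ℕ} (κ : ℂ) (θ : Fin N → ℂ) (m n : ℤ) (T : RatFun N) : Prop :=
  T ≠ 0 ∧ ∀ U : Set (Fin N → ℂ), IsOpen U → ∀ B : LogBranches U,
    (∀ t ∈ U, ∃ v : ℂ, v ≠ 0 ∧ HasValueAt T t v) →
    ∃ τ : (Fin N → ℂ) → ℂ, IsTauFunction U (sol κ θ m n) τ ∧
      ∀ t ∈ U, HasValueAt T t (τ t * normFactor B κ θ m n t)

/-- `∑_i t_i (t_i² - 1) ∂/∂t_i log T`. -/
def innerOp {N : ℕ} (T : RatFun N) : RatFun N :=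
  ∑ i, tvar i * (tvar i ^ 2 - 1) * dlog i T

/-- The common part of the braces in the two recurrence relations:
`(∑_i ((t_i² - 1)/t_i) ∂/∂t_i - 2) ∑_i t_i (t_i² - 1) ∂/∂t_i log T`
`+ κ_∞ ∑_i θ_i (t_i² + 1)/t_i - (1/2) ∑_{i,j} θ_i θ_j (t_i² + t_j²)/(t_i t_j) - κ_∞²`. -/
def todaBrace {N : ℕ} (κ : ℂ) (θ : Fin N → ℂ) (T : RatFun N) : RatFun N :=
  (∑ i, (tvar i ^ 2 - 1) / tvar i * pd i (innerOp T) - 2 * innerOp T)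
    + cst κ * ∑ i, cst (θ i) * ((tvar i ^ 2 + 1) / tvar i)
    - 1 / 2 * ∑ i, ∑ j,
        cst (θ i) * cst (θ j) * ((tvar i ^ 2 + tvar j ^ 2) / (tvar i * tvar j))
    - cst κ ^ 2

end

end Garnier

/-! The proof works over any field of characteristic zero with commuting-variable derivations, where
the claim becomes a set of rational identities in a few functions of a solution: `e`, `c`, `Y`, `h`,
`B` and the sums `a`, `b`, `g`, `u`. In these functions the reflections are simple. `Rk1` translates
the variable of the quadratic polynomials q_i X² + c_i X + Y_i and X² + B X + h by a common amount;
`Rk0` does the same with amounts scaled by 1/s_i for the first ones. `signFlip` fixes all of them.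
`Rtau` replaces q_i by s_i Y_i / h and Y_i by q_i h / s_i, so it sends a to u/h and b to g/h.

Three facts carry the theorem.

The braces are explicit. The inner operator sees the Hamiltonians only through ∑ s_i(s_i-1)H_i,
which equals -a u plus simple terms (`sum_hamNum`). Applying ∑(s_j-1)∂/∂s_j and subtracting the sum
itself turns this into a g (`IsSolution.sum_D_sum_hamNum`). Hence the brace of the first Toda
equation is 4 a g = `gam` (`brace_eq`), and that of the second is `gam` after `Rk1` (`brace_eq'`).

The logarithmic derivatives of these two functions are the second differences of the H_i along l̃
and along l (`logder_gam_transLt`, `logder_gam_transL`). The second differences of the normalizing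
exponents contribute exactly ∏ t_i (`normDlog_second_diff`). So both Toda equations hold up to
constants.

The constants can be chosen consistently. The translations commute because ρ² commutes with `Rk1`
(`rho_rho_Rk1`), and the two right-hand sides satisfy `orbit_gam_compat`. An array satisfying both
recursions therefore exists for any four non-zero initial values (`exists_toda_array`). Its
logarithmic derivatives are correct at the four initial places, hence everywhere
(`exists_normalized_tau`).

A rational function with these logarithmic derivatives, divided by the normalizing factor, is a
τ-function (`isNormalizedTau_of_isTauDlog`). Uniqueness holds because non-vanishing terms let both
recursions be run in either direction from the four initial values. -/

namespace Garnier

noncomputable section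

set_option linter.unusedSectionVars false

/-! ### Algebra of the elementary reflections. -/

variable {N : ℕ} {F : Type} [Field F]

/-- `e_i = q_i p_i`. -/
def Datum.e (x : Datum N F) (i : Fin N) : F := x.q i * x.p i

/-- `c_i = 2 q_i p_i - θ_i`. -/
def Datum.c (x : Datum N F) (i : Fin N) : F := 2 * x.e i - x.th i

/-- `Y_i = p_i (q_i p_i - θ_i)`. -/
def Datum.Y (x : Datum N F) (i : Fin N) : F := x.p i * (x.e i - x.th i)

/-- `h = (α + ∑ e_j) (α + κ_∞ + ∑ e_j)`. -/
def Datum.h (x : Datum N F) : F := (x.alpha + x.qp) * (x.alpha + x.kinf + x.qp)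

/-- `B = 2 (α + ∑ e_j) + κ_∞`. -/
def Datum.B (x : Datum N F) : F := 2 * (x.alpha + x.qp) + x.kinf

/-- `a = ∑ q_j - 1`. -/
def Datum.a (x : Datum N F) : F := ∑ j, x.q j - 1

/-- `b = ∑ q_j / s_j - 1`. -/
def Datum.b (s : Fin N → F) (x : Datum N F) : F := ∑ j, x.q j / s j - 1

/-- `g = ∑ Y_j - h`. -/
def Datum.g (x : Datum N F) : F := ∑ j, x.Y j - x.h

/-- `u = ∑ s_j Y_j - h`. -/
def Datum.u (s : Fin N → F) (x : Datum N F) : F := ∑ j, s j * x.Y j - x.h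

/-- `4 a g`, which is shown to be the brace in the Toda equation of `l̃`. -/
def Datum.gam (x : Datum N F) : F := 4 * (x.a * x.g)

lemma Datum.ext_of {x y : Datum N F} (hq : ∀ i, x.q i = y.q i) (hp : ∀ i, x.p i = y.p i)
    (h0 : x.k0 = y.k0) (h1 : x.k1 = y.k1) (hi : x.kinf = y.kinf)
    (ht : ∀ i, x.th i = y.th i) : x = y := by
  cases x; cases y
  simp only [Datum.mk.injEq] at *
  exact ⟨funext hq, funext hp, h0, h1, hi, funext ht⟩

/-- Suited to `Rtau`, which prescribes the new p_i only through the product q_i p_i. -/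
lemma Datum.ext_of_e {x y : Datum N F} (hq0 : ∀ i, x.q i ≠ 0) (hq : ∀ i, x.q i = y.q i)
    (he : ∀ i, x.e i = y.e i)
    (h0 : x.k0 = y.k0) (h1 : x.k1 = y.k1) (hi : x.kinf = y.kinf)
    (ht : ∀ i, x.th i = y.th i) : x = y := by
  refine Datum.ext_of hq (fun i => ?_) h0 h1 hi ht
  have := he i
  simp only [Datum.e, ← hq i] at this
  exact mul_left_cancel₀ (hq0 i) this

lemma Datum.qp_eq (x : Datum N F) : x.qp = ∑ i, x.e i := rfl

lemma Datum.q_mul_Y (x : Datum N F) (i : Fin N) : x.q i * x.Y i = x.e i * (x.e i - x.th i) := by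
  simp only [Datum.Y, Datum.e]; ring

/-- κ_∞ cancels and the θ_i combine with the e_i. The use is to express ∑ c_i by `B` whenever a
formula linear in c_k is summed. -/
lemma Datum.B_eq [CharZero F] (x : Datum N F) :
    x.B = 1 - x.k0 - x.k1 + ∑ i, x.c i := by
  simp only [Datum.B, Datum.alpha, Datum.qp_eq, Datum.c, Finset.sum_sub_distrib, ← Finset.mul_sum]
  ring

/-! ### Effect of the elementary transformations -/

section Rk1

variable (x : Datum N F)

@[simp] lemma Rk1_q (i : Fin N) : (Rk1.map x).q i = x.q i := rfl
@[simp] lemma Rk1_k0 : (Rk1.map x).k0 = x.k0 := rfl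
@[simp] lemma Rk1_k1 : (Rk1.map x).k1 = -x.k1 := rfl
@[simp] lemma Rk1_kinf : (Rk1.map x).kinf = x.kinf := rfl
@[simp] lemma Rk1_th (i : Fin N) : (Rk1.map x).th i = x.th i := rfl
@[simp] lemma Rk1_a : (Rk1.map x).a = x.a := rfl
@[simp] lemma Rk1_b (s : Fin N → F) : (Rk1.map x).b s = x.b s := rfl

lemma Rk1_p (i : Fin N) : (Rk1.map x).p i = x.p i - x.k1 / x.a := rfl

lemma Rk1_e (i : Fin N) : (Rk1.map x).e i = x.e i - x.k1 / x.a * x.q i := by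
  simp only [Datum.e, Rk1_p, Rk1_q]; ring

lemma Rk1_c (i : Fin N) : (Rk1.map x).c i = x.c i - 2 * (x.k1 / x.a) * x.q i := by
  simp only [Datum.c, Rk1_e, Rk1_th]; ring

lemma Rk1_Y (i : Fin N) :
    (Rk1.map x).Y i = x.Y i - x.k1 / x.a * x.c i + (x.k1 / x.a) ^ 2 * x.q i := by
  simp only [Datum.Y, Datum.c, Rk1_th, Rk1_p, Rk1_q, Datum.e]; ring

lemma Rk1_alpha [CharZero F] : (Rk1.map x).alpha = x.alpha + x.k1 := by
  simp only [Datum.alpha, Rk1_k0, Rk1_k1, Rk1_kinf, Rk1_th]; ring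

variable {x} (ha : x.a ≠ 0)
include ha

lemma Rk1_qp : (Rk1.map x).qp = x.qp - x.k1 / x.a - x.k1 := by
  have : x.k1 / x.a * ∑ i, x.q i = x.k1 / x.a + x.k1 := by
    have : ∑ i, x.q i = x.a + 1 := by simp [Datum.a]
    rw [this]; field_simp
    ring
  simp only [Datum.qp_eq, Rk1_e, Finset.sum_sub_distrib, ← Finset.mul_sum, this]; ring

variable [CharZero F]

lemma Rk1_h : (Rk1.map x).h = x.h - x.k1 / x.a * x.B + (x.k1 / x.a) ^ 2 := by
  simp only [Datum.h, Datum.B, Rk1_alpha, Rk1_qp ha, Rk1_kinf]; ring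

lemma Rk1_B : (Rk1.map x).B = x.B - 2 * (x.k1 / x.a) := by
  simp only [Datum.B, Rk1_alpha, Rk1_qp ha, Rk1_kinf]; ring

/-- With λ = κ₁/a the change is λ(B - ∑ c_j) + λ² a. Since λ a = κ₁ this is linear in λ, which later
makes `U`, `V` and `W` invariant. -/
lemma Rk1_g : (Rk1.map x).g = x.g + x.k1 / x.a * (1 - x.k0) := by
  have h1 : ∑ i, x.q i = x.a + 1 := by simp [Datum.a]
  have h2 := x.B_eq
  simp only [Datum.g, Rk1_Y, Rk1_h ha, Finset.sum_sub_distrib, Finset.sum_add_distrib,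
    ← Finset.mul_sum, h1, h2]
  field_simp
  ring

end Rk1

section Rk0

variable (s : Fin N → F) (x : Datum N F)

@[simp] lemma Rk0_q (i : Fin N) : ((Rk0 s).map x).q i = x.q i := rfl
@[simp] lemma Rk0_k0 : ((Rk0 s).map x).k0 = -x.k0 := rfl
@[simp] lemma Rk0_k1 : ((Rk0 s).map x).k1 = x.k1 := rfl
@[simp] lemma Rk0_kinf : ((Rk0 s).map x).kinf = x.kinf := rfl
@[simp] lemma Rk0_th (i : Fin N) : ((Rk0 s).map x).th i = x.th i := rfl
@[simp] lemma Rk0_a : ((Rk0 s).map x).a = x.a := rfl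
@[simp] lemma Rk0_b : ((Rk0 s).map x).b s = x.b s := rfl

lemma Rk0_p (i : Fin N) : ((Rk0 s).map x).p i = x.p i - x.k0 / x.b s / s i := by
  rw [div_div, mul_comm]; rfl

lemma Rk0_e (i : Fin N) :
    ((Rk0 s).map x).e i = x.e i - x.k0 / x.b s * (x.q i / s i) := by
  simp only [Datum.e, Rk0_p, Rk0_q]; ring

lemma Rk0_c (i : Fin N) :
    ((Rk0 s).map x).c i = x.c i - 2 * (x.k0 / x.b s) * (x.q i / s i) := by
  simp only [Datum.c, Rk0_e, Rk0_th]; ring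

lemma Rk0_Y (i : Fin N) :
    ((Rk0 s).map x).Y i =
      x.Y i - x.k0 / x.b s * (x.c i / s i) + (x.k0 / x.b s) ^ 2 * (x.q i / s i ^ 2) := by
  simp only [Datum.Y, Datum.c, Rk0_th, Rk0_p, Rk0_q, Datum.e]; ring

lemma Rk0_alpha [CharZero F] : ((Rk0 s).map x).alpha = x.alpha + x.k0 := by
  simp only [Datum.alpha, Rk0_k0, Rk0_k1, Rk0_kinf, Rk0_th]; ring

variable {s x} (hb : x.b s ≠ 0)
include hb

lemma Rk0_qp : ((Rk0 s).map x).qp = x.qp - x.k0 / x.b s - x.k0 := by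
  have : x.k0 / x.b s * ∑ i, x.q i / s i = x.k0 / x.b s + x.k0 := by
    have : ∑ i, x.q i / s i = x.b s + 1 := by simp [Datum.b]
    rw [this]; field_simp
    ring
  simp only [Datum.qp_eq, Rk0_e, Finset.sum_sub_distrib, ← Finset.mul_sum, this]; ring

variable [CharZero F]

lemma Rk0_h :
    ((Rk0 s).map x).h = x.h - x.k0 / x.b s * x.B + (x.k0 / x.b s) ^ 2 := by
  simp only [Datum.h, Datum.B, Rk0_alpha, Rk0_qp hb, Rk0_kinf]; ring

lemma Rk0_B : ((Rk0 s).map x).B = x.B - 2 * (x.k0 / x.b s) := by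
  simp only [Datum.B, Rk0_alpha, Rk0_qp hb, Rk0_kinf]; ring

lemma Rk0_u (hs : ∀ i, s i ≠ 0) :
    ((Rk0 s).map x).u s = x.u s + x.k0 / x.b s * (1 - x.k1) := by
  have h1 : ∑ i, x.q i / s i = x.b s + 1 := by simp [Datum.b]
  have h2 := x.B_eq
  have h3 : ∀ i, s i * ((Rk0 s).map x).Y i = s i * x.Y i - x.k0 / x.b s * x.c i +
      (x.k0 / x.b s) ^ 2 * (x.q i / s i) := by
    intro i
    have := hs i
    rw [Rk0_Y]
    field_simp
  simp only [Datum.u, h3, Rk0_h hb, Finset.sum_sub_distrib, Finset.sum_add_distrib,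
    ← Finset.mul_sum, h1, h2]
  field_simp
  ring

end Rk0

section RthRkinf

variable (x : Datum N F)

@[simp] lemma Rkinf_Y (i : Fin N) : (Rkinf.map x).Y i = x.Y i := rfl
@[simp] lemma Rkinf_k0 : (Rkinf.map x).k0 = x.k0 := rfl
@[simp] lemma Rkinf_k1 : (Rkinf.map x).k1 = x.k1 := rfl
@[simp] lemma Rkinf_kinf : (Rkinf.map x).kinf = -x.kinf := rfl
@[simp] lemma Rkinf_th (i : Fin N) : (Rkinf.map x).th i = x.th i := rfl
@[simp] lemma Rkinf_qp : (Rkinf.map x).qp = x.qp := rfl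

lemma Rkinf_alpha [CharZero F] : (Rkinf.map x).alpha = x.alpha + x.kinf := by
  simp only [Datum.alpha, Rkinf_k0, Rkinf_k1, Rkinf_kinf, Rkinf_th]; ring

@[simp] lemma Rkinf_h [CharZero F] : (Rkinf.map x).h = x.h := by
  simp only [Datum.h, Rkinf_alpha, Rkinf_kinf, Rkinf_qp]; ring

@[simp] lemma Rkinf_B [CharZero F] : (Rkinf.map x).B = x.B := by
  simp only [Datum.B, Rkinf_alpha, Rkinf_kinf, Rkinf_qp]; ring

@[simp] lemma Rkinf_u [CharZero F] (s : Fin N → F) : (Rkinf.map x).u s = x.u s := by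
  simp [Datum.u]

@[simp] lemma Rth_q (i : Fin N) : (Rth.map x).q i = x.q i := rfl
@[simp] lemma Rth_k0 : (Rth.map x).k0 = x.k0 := rfl
@[simp] lemma Rth_k1 : (Rth.map x).k1 = x.k1 := rfl
@[simp] lemma Rth_kinf : (Rth.map x).kinf = x.kinf := rfl
@[simp] lemma Rth_th (i : Fin N) : (Rth.map x).th i = -x.th i := rfl
lemma Rth_p (i : Fin N) : (Rth.map x).p i = x.p i - x.th i / x.q i := rfl

lemma Rth_alpha [CharZero F] : (Rth.map x).alpha = x.alpha + ∑ i, x.th i := by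
  simp only [Datum.alpha, Rth_k0, Rth_k1, Rth_kinf, Rth_th, Finset.sum_neg_distrib]; ring

variable {x} (hq : ∀ i, x.q i ≠ 0)
include hq

lemma Rth_e (i : Fin N) : (Rth.map x).e i = x.e i - x.th i := by
  have := hq i
  simp only [Datum.e, Rth_p, Rth_q]; field_simp

lemma Rth_c (i : Fin N) : (Rth.map x).c i = x.c i := by
  simp only [Datum.c, Rth_e hq, Rth_th]; ring

lemma Rth_Y (i : Fin N) : (Rth.map x).Y i = x.Y i := by
  have := hq i
  simp only [Datum.Y, Rth_p, Rth_q, Rth_th, Datum.e]; field_simp; ring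

lemma Rth_qp : (Rth.map x).qp = x.qp - ∑ i, x.th i := by
  simp only [Datum.qp_eq, Rth_e hq, Finset.sum_sub_distrib]

variable [CharZero F]

lemma Rth_h : (Rth.map x).h = x.h := by
  simp only [Datum.h, Rth_alpha, Rth_kinf, Rth_qp hq]; ring

lemma Rth_B : (Rth.map x).B = x.B := by
  simp only [Datum.B, Rth_alpha, Rth_kinf, Rth_qp hq]; ring

lemma Rth_u (s : Fin N → F) : (Rth.map x).u s = x.u s := by simp [Datum.u, Rth_Y hq, Rth_h hq]

end RthRkinf

section Rtau

variable (s : Fin N → F) (x : Datum N F)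

@[simp] lemma Rtau_k0 : ((Rtau s).map x).k0 = 1 - x.k0 := rfl
@[simp] lemma Rtau_k1 : ((Rtau s).map x).k1 = 1 - x.k1 := rfl
@[simp] lemma Rtau_kinf : ((Rtau s).map x).kinf = -x.kinf := rfl
@[simp] lemma Rtau_th (i : Fin N) : ((Rtau s).map x).th i = -x.th i := rfl

lemma RtauQ_eq (i : Fin N) : RtauQ s x i = s i * x.Y i / x.h := by
  simp only [RtauQ, Datum.Y, Datum.h, Datum.e]; ring

lemma Rtau_q (i : Fin N) : ((Rtau s).map x).q i = s i * x.Y i / x.h := RtauQ_eq s x i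

lemma Rtau_alpha [CharZero F] : ((Rtau s).map x).alpha = -x.alpha := by
  simp only [Datum.alpha, Rtau_k0, Rtau_k1, Rtau_kinf, Rtau_th, Finset.sum_neg_distrib]; ring

variable {s x}

lemma Rtau_dom_iff (hs : ∀ i, s i ≠ 0) : (Rtau s).dom x ↔ x.h ≠ 0 ∧ ∀ i, x.Y i ≠ 0 := by
  change (x.h ≠ 0 ∧ ∀ i, RtauQ s x i ≠ 0) ↔ _
  refine and_congr_right fun hh => forall_congr' fun i => ?_
  simp [RtauQ_eq, hh, hs i]

variable (hs : ∀ i, s i ≠ 0) (hh : x.h ≠ 0) (hY : ∀ i, x.Y i ≠ 0)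

include hs hh hY

lemma Rtau_q_ne (i : Fin N) : ((Rtau s).map x).q i ≠ 0 := by
  rw [Rtau_q]
  exact div_ne_zero (mul_ne_zero (hs i) (hY i)) hh

lemma Rtau_e (i : Fin N) : ((Rtau s).map x).e i = -x.e i := by
  have h1 := Rtau_q_ne hs hh hY i
  change RtauQ s x i * (-(x.q i * x.p i) / RtauQ s x i) = -(x.q i * x.p i)
  exact mul_div_cancel₀ _ h1

lemma Rtau_c (i : Fin N) : ((Rtau s).map x).c i = -x.c i := by
  simp only [Datum.c, Rtau_e hs hh hY, Rtau_th]; ring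

/-- The product q_i Y_i = e_i(e_i - θ_i) does not change when e_i and θ_i change sign together, so
the new Y_i is the old product divided by the new q_i. -/
lemma Rtau_Y (i : Fin N) : ((Rtau s).map x).Y i = x.q i * x.h / s i := by
  have h1 := Rtau_q_ne hs hh hY i
  have h2 := ((Rtau s).map x).q_mul_Y i
  rw [Rtau_e hs hh hY, Rtau_th] at h2
  refine mul_left_cancel₀ h1 (h2.trans ?_)
  rw [Rtau_q]
  have := hs i
  have h3 := x.q_mul_Y i
  field_simp
  linear_combination -h3

lemma Rtau_qp : ((Rtau s).map x).qp = -x.qp := by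
  simp only [Datum.qp_eq, Rtau_e hs hh hY, Finset.sum_neg_distrib]

lemma Rtau_a : ((Rtau s).map x).a = x.u s / x.h := by
  simp only [Datum.a, Datum.u, Rtau_q, ← Finset.sum_div]
  field_simp

lemma Rtau_b : ((Rtau s).map x).b s = x.g / x.h := by
  have : ∀ i, ((Rtau s).map x).q i / s i = x.Y i / x.h := by
    intro i
    have := hs i
    rw [Rtau_q]; field_simp
  simp only [Datum.b, Datum.g, this, ← Finset.sum_div]
  field_simp

variable [CharZero F]

lemma Rtau_h : ((Rtau s).map x).h = x.h := by
  simp only [Datum.h, Rtau_alpha, Rtau_kinf, Rtau_qp hs hh hY]; ring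

lemma Rtau_B : ((Rtau s).map x).B = -x.B := by
  simp only [Datum.B, Rtau_alpha, Rtau_kinf, Rtau_qp hs hh hY]; ring

lemma Rtau_g : ((Rtau s).map x).g = x.h * x.b s := by
  have : ∀ i, ((Rtau s).map x).Y i = x.h * (x.q i / s i) := by
    intro i
    rw [Rtau_Y hs hh hY]; ring
  simp only [Datum.g, Datum.b, this, Rtau_h hs hh hY, ← Finset.mul_sum]
  ring

end Rtau

/-! ### Involutivity -/

lemma Rk1_Rk1 (x : Datum N F) : Rk1.map (Rk1.map x) = x := by
  refine Datum.ext_of (fun _ => rfl) (fun i => ?_) rfl (neg_neg _) rfl (fun _ => rfl)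
  simp only [Rk1_p, Rk1_k1, Rk1_a]; ring

lemma Rk0_Rk0 (s : Fin N → F) (x : Datum N F) : (Rk0 s).map ((Rk0 s).map x) = x := by
  refine Datum.ext_of (fun _ => rfl) (fun i => ?_) (neg_neg _) rfl rfl (fun _ => rfl)
  simp only [Rk0_p, Rk0_k0, Rk0_b]; ring

lemma Rk0_Rk1 (s : Fin N → F) (x : Datum N F) :
    (Rk0 s).map (Rk1.map x) = Rk1.map ((Rk0 s).map x) := by
  refine Datum.ext_of (fun _ => rfl) (fun i => ?_) rfl rfl rfl (fun _ => rfl)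
  simp only [Rk0_p, Rk1_p, Rk1_k0, Rk0_k1, Rk0_a, Rk1_b]; ring

/-- `R_{θ₁} ∘ ⋯ ∘ R_{θ_N} ∘ R_{κ_∞}`. -/
def signFlip : PMap (Datum N F) := Rth.comp Rkinf

section signFlip

variable (x : Datum N F)

@[simp] lemma signFlip_q (i : Fin N) : (signFlip.map x).q i = x.q i := rfl
@[simp] lemma signFlip_k0 : (signFlip.map x).k0 = x.k0 := rfl
@[simp] lemma signFlip_k1 : (signFlip.map x).k1 = x.k1 := rfl
@[simp] lemma signFlip_kinf : (signFlip.map x).kinf = -x.kinf := rfl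
@[simp] lemma signFlip_th (i : Fin N) : (signFlip.map x).th i = -x.th i := rfl
@[simp] lemma signFlip_a : (signFlip.map x).a = x.a := rfl
@[simp] lemma signFlip_b (s : Fin N → F) : (signFlip.map x).b s = x.b s := rfl

lemma signFlip_signFlip : signFlip.map (signFlip.map x) = x := by
  refine Datum.ext_of (fun _ => rfl) (fun i => ?_) rfl rfl (neg_neg _) (fun _ => neg_neg _)
  change x.p i - x.th i / x.q i - -x.th i / x.q i = x.p i
  ring

lemma signFlip_Rk0 (s : Fin N → F) :
    signFlip.map ((Rk0 s).map x) = (Rk0 s).map (signFlip.map x) := by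
  refine Datum.ext_of (fun _ => rfl) (fun i => ?_) rfl rfl rfl (fun _ => rfl)
  change x.p i - _ - x.th i / x.q i = x.p i - x.th i / x.q i - _
  exact sub_right_comm _ _ _

variable {x} (hq : ∀ i, x.q i ≠ 0)
include hq

lemma signFlip_e (i : Fin N) : (signFlip.map x).e i = x.e i - x.th i :=
  Rth_e (x := Rkinf.map x) hq i

lemma signFlip_c (i : Fin N) : (signFlip.map x).c i = x.c i := Rth_c (x := Rkinf.map x) hq i

lemma signFlip_Y (i : Fin N) : (signFlip.map x).Y i = x.Y i := Rth_Y (x := Rkinf.map x) hq i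

variable [CharZero F]

lemma signFlip_h : (signFlip.map x).h = x.h := (Rth_h (x := Rkinf.map x) hq).trans (Rkinf_h x)
lemma signFlip_B : (signFlip.map x).B = x.B := (Rth_B (x := Rkinf.map x) hq).trans (Rkinf_B x)
lemma signFlip_u (s : Fin N → F) : (signFlip.map x).u s = x.u s :=
  (Rth_u (x := Rkinf.map x) hq s).trans (Rkinf_u x s)

lemma signFlip_Rtau {s : Fin N → F} (hs : ∀ i, s i ≠ 0) (hh : x.h ≠ 0) (hY : ∀ i, x.Y i ≠ 0) :
    signFlip.map ((Rtau s).map x) = (Rtau s).map (signFlip.map x) := by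
  have hh' : (signFlip.map x).h ≠ 0 := by rwa [signFlip_h hq]
  have hY' : ∀ i, (signFlip.map x).Y i ≠ 0 := fun i => by rw [signFlip_Y hq]; exact hY i
  have hQ := Rtau_q_ne hs hh hY
  refine Datum.ext_of_e hQ (fun i => ?_) (fun i => ?_) rfl rfl rfl (fun _ => rfl)
  · rw [signFlip_q, Rtau_q, Rtau_q, signFlip_Y hq, signFlip_h hq]
  · rw [signFlip_e hQ, Rtau_e hs hh hY, Rtau_th, Rtau_e hs hh' hY', signFlip_e hq]; ring

end signFlip

lemma Rtau_Rtau [CharZero F] {s : Fin N → F} {x : Datum N F} (hs : ∀ i, s i ≠ 0) (hh : x.h ≠ 0)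
    (hY : ∀ i, x.Y i ≠ 0) (hq : ∀ i, x.q i ≠ 0) : (Rtau s).map ((Rtau s).map x) = x := by
  have hh' : ((Rtau s).map x).h ≠ 0 := by rwa [Rtau_h hs hh hY]
  have hY' : ∀ i, ((Rtau s).map x).Y i ≠ 0 := fun i => by
    rw [Rtau_Y hs hh hY]
    exact div_ne_zero (mul_ne_zero (hq i) hh) (hs i)
  refine Datum.ext_of_e (Rtau_q_ne hs hh' hY') (fun i => ?_) (fun i => ?_) ?_ ?_ ?_ (fun _ => ?_)
  · have := hs i
    rw [Rtau_q, Rtau_h hs hh hY, Rtau_Y hs hh hY]; field_simp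
  · rw [Rtau_e hs hh' hY', Rtau_e hs hh hY, neg_neg]
  · simp
  · simp
  · simp
  · simp

end

end Garnier

/-! ### Solutions of the Garnier system and their invariance under the reflections. -/

namespace Garnier

noncomputable section

set_option linter.unusedSectionVars false

variable {N : ℕ} {F : Type} [Field F]

/-- `s_1, …, s_N` are independent variables with partial derivatives `D_1, …, D_N`, different from
each other and from `0`, `1`. -/
structure TimeVars (s : Fin N → F) (D : Fin N → Derivation ℤ F F) : Prop where
  ne_zero : ∀ i, s i ≠ 0
  sub_one_ne : ∀ i, s i - 1 ≠ 0
  sub_ne : ∀ i j, i ≠ j → s j - s i ≠ 0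
  D_self : ∀ i, D i (s i) = 1
  D_other : ∀ i j, i ≠ j → D j (s i) = 0

/-- `x` solves the Garnier system. The canonical equations are written for `e_i = q_i p_i` and
`q_i`, and the diagonal ones are replaced by those for `∑ e_i` and `∑ q_i`. -/
structure IsSolution (s : Fin N → F) (D : Fin N → Derivation ℤ F F) (x : Datum N F) : Prop where
  D_k0 : ∀ j, D j x.k0 = 0
  D_k1 : ∀ j, D j x.k1 = 0
  D_kinf : ∀ j, D j x.kinf = 0
  D_th : ∀ j i, D j (x.th i) = 0
  D_e_mul : ∀ j i, s j * (s j - s i) * D j (x.e i) = s j * x.q i * x.Y j - s i * x.q j * x.Y i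
  D_qp_mul : ∀ j, s j * (s j - 1) * D j x.qp = s j * x.Y j - x.q j * x.h
  D_q_mul : ∀ j i, s j * (s j - 1) * (s j - s i) * D j (x.q i) =
    (s j - s i) * x.q i * x.q j * x.B - s i * (s j - 1) * x.c i * x.q j
      + s j * (s i - 1) * x.c j * x.q i
  D_a_mul : ∀ j, s j * (s j - 1) * D j x.a =
    x.a * (x.q j * x.B - s j * x.c j) + x.k1 * (s j - 1) * x.q j

variable {s : Fin N → F} {D : Fin N → Derivation ℤ F F} {x : Datum N F}

lemma TimeVars.D_s (ht : TimeVars s D) (j i : Fin N) :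
    D j (s i) = if i = j then 1 else 0 := by
  split_ifs with h
  · subst h; exact ht.D_self i
  · exact ht.D_other i j h

namespace IsSolution

variable (ht : TimeVars s D) (hx : IsSolution s D x)
include ht hx

lemma D_e {i j : Fin N} (hij : i ≠ j) :
    D j (x.e i) = (s j * x.q i * x.Y j - s i * x.q j * x.Y i) / (s j * (s j - s i)) := by
  rw [eq_div_iff (mul_ne_zero (ht.ne_zero j) (ht.sub_ne i j hij)), ← hx.D_e_mul]; ring

lemma D_qp (j : Fin N) : D j x.qp = (s j * x.Y j - x.q j * x.h) / (s j * (s j - 1)) := by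
  rw [eq_div_iff (mul_ne_zero (ht.ne_zero j) (ht.sub_one_ne j)), ← hx.D_qp_mul]; ring

lemma D_q {i j : Fin N} (hij : i ≠ j) :
    D j (x.q i) = ((s j - s i) * x.q i * x.q j * x.B - s i * (s j - 1) * x.c i * x.q j
      + s j * (s i - 1) * x.c j * x.q i) / (s j * (s j - 1) * (s j - s i)) := by
  rw [eq_div_iff (mul_ne_zero (mul_ne_zero (ht.ne_zero j) (ht.sub_one_ne j)) (ht.sub_ne i j hij)),
    ← hx.D_q_mul]; ring

lemma D_a (j : Fin N) : D j x.a =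
    (x.a * (x.q j * x.B - s j * x.c j) + x.k1 * (s j - 1) * x.q j) / (s j * (s j - 1)) := by
  rw [eq_div_iff (mul_ne_zero (ht.ne_zero j) (ht.sub_one_ne j)), ← hx.D_a_mul]; ring

omit ht in
lemma D_alpha [CharZero F] (j : Fin N) : D j x.alpha = 0 := by
  have h2 : D j (2 : F) = 0 := by simpa using (D j).map_natCast 2
  have h : 2 * x.alpha = -(x.k0 + x.k1 + x.kinf + ∑ i, x.th i - 1) := by
    rw [Datum.alpha]; ring
  have h3 := congrArg (D j) h
  rw [Derivation.leibniz, h2] at h3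
  simpa [hx.D_k0, hx.D_k1, hx.D_kinf, hx.D_th] using h3

omit ht in
lemma D_h [CharZero F] (j : Fin N) : D j x.h = x.B * D j x.qp := by
  rw [Datum.h, Derivation.leibniz]
  simp only [map_add, hx.D_alpha, hx.D_kinf, smul_eq_mul, Datum.B]
  ring

lemma D_b [CharZero F] (j : Fin N) : D j (x.b s) =
    (x.b s * (x.q j * x.B - x.c j) - x.k0 * (s j - 1) * x.q j / s j) / (s j * (s j - 1)) := by
  have h0 := ht.ne_zero
  have h1 := ht.sub_one_ne
  -- One formula covers both i = j and i ≠ j. It contains D_j q_i only with a coefficient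
  -- independent of i, so the sum over i needs just the derivative of `a`.
  have key : ∀ i, D j (x.q i / s i) = D j (x.q i) / s j - (if i = j then x.q j / s j ^ 2 else 0)
      + ((s j * (x.q i / s i) - x.q i) * (x.q j * x.B) - x.c i * ((s j - 1) * x.q j)
        + (x.q i - x.q i / s i) * (s j * x.c j)) / (s j ^ 2 * (s j - 1)) := by
    intro i
    have hi := h0 i
    have hj := h0 j
    have hj1 := h1 j
    rw [Derivation.leibniz_div, ht.D_s]
    simp only [smul_eq_mul]
    split_ifs with hij
    · subst hij
      field_simp
      ring
    · have hji := ht.sub_ne i j hij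
      rw [hx.D_q ht hij]
      field_simp
      ring
  have hb : x.b s + 1 = ∑ i, x.q i / s i := by simp [Datum.b]
  have ha : ∑ i, x.q i = x.a + 1 := by simp [Datum.a]
  have hc : ∑ i, x.c i = x.B - (1 - x.k0 - x.k1) := by rw [x.B_eq]; ring
  have e1 : D j (x.b s) = D j (x.b s + 1) := by simp
  have e2 : ∑ i, D j (x.q i) = D j x.a := by simp [Datum.a]
  rw [e1, hb, map_sum]
  simp only [key, Finset.sum_add_distrib, Finset.sum_sub_distrib, ← Finset.sum_div,
    ← Finset.sum_mul, ← Finset.mul_sum, ← hb, ha, hc, Finset.sum_ite_eq', Finset.mem_univ, if_true,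
    e2, hx.D_a ht]
  have hj := h0 j
  have hj1 := h1 j
  field_simp
  ring

/-- The derivatives of `Y_i`. -/
lemma D_Y {i j : Fin N} (hij : i ≠ j) (hq : x.q i ≠ 0) : D j (x.Y i) =
    (s j * (s j - 1) * x.c i * x.Y j - (s j - s i) * x.q j * x.Y i * x.B
      - s j * (s i - 1) * x.c j * x.Y i) / (s j * (s j - 1) * (s j - s i)) := by
  -- D_j Y_i is obtained by differentiating q_i Y_i = e_i(e_i - θ_i) and dividing by q_i.
  have h1 := congrArg (D j) (x.q_mul_Y i)
  have h2 := x.q_mul_Y i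
  rw [Derivation.leibniz, Derivation.leibniz, map_sub, hx.D_th, hx.D_q ht hij,
    hx.D_e ht hij] at h1
  simp only [smul_eq_mul] at h1
  have hj := ht.ne_zero j
  have hj1 := ht.sub_one_ne j
  have hji := ht.sub_ne i j hij
  refine mul_left_cancel₀ hq ?_
  rw [eq_sub_of_add_eq h1]
  simp only [Datum.c] at *
  field_simp
  ring

lemma D_u [CharZero F] (hq : ∀ i, x.q i ≠ 0) (j : Fin N) : D j (x.u s) =
    (x.u s * (s j * x.c j - x.q j * x.B) + (1 - x.k1) * s j * (s j - 1) * x.Y j) /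
      (s j * (s j - 1)) := by
  have hj := ht.ne_zero j
  have hj1 := ht.sub_one_ne j
  have hqj := hq j
  -- For i = j, differentiating q_j Y_j = e_j(e_j - θ_j) leaves D_j e_j and D_j q_j, for which there
  -- is no separate equation. The formula is arranged to hold for every i with the same coefficients
  -- of D_j e_i and D_j q_i, so the sum involves only D_j ∑ e_i and D_j ∑ q_i.
  have key : ∀ i, D j (s i * x.Y i) = (if i = j then x.Y j else 0)
      + s j / x.q j * (x.c j * D j (x.e i) - x.Y j * D j (x.q i))
      + ((s j * x.Y j * x.q i - s i * x.Y i * x.q j) * x.B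
        + s j * x.c j * (s i * x.Y i - s j * x.Y j * x.q i / x.q j)) / (s j * (s j - 1)) := by
    intro i
    have hi := ht.ne_zero i
    rw [Derivation.leibniz, ht.D_s]
    simp only [smul_eq_mul]
    split_ifs with hij
    · subst hij
      have h1 := congrArg (D i) (x.q_mul_Y i)
      rw [Derivation.leibniz, Derivation.leibniz, map_sub, hx.D_th] at h1
      simp only [smul_eq_mul] at h1
      have h2 : D i (x.Y i) = (x.c i * D i (x.e i) - x.Y i * D i (x.q i)) / x.q i := by
        rw [eq_div_iff hqj, Datum.c]
        linear_combination h1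
      rw [h2]
      field_simp
      ring
    · have hji := ht.sub_ne i j hij
      rw [hx.D_Y ht hij (hq i), hx.D_q ht hij, hx.D_e ht hij]
      field_simp
      ring
  have ha : ∑ i, x.q i = x.a + 1 := by simp [Datum.a]
  have hu : ∑ i, s i * x.Y i = x.u s + x.h := by simp [Datum.u]
  have e2 : ∑ i, D j (x.q i) = D j x.a := by simp [Datum.a]
  have e3 : ∑ i, D j (x.e i) = D j x.qp := by simp [Datum.qp_eq]
  have e1 : D j (x.u s) = ∑ i, D j (s i * x.Y i) - x.B * D j x.qp := by
    simp [Datum.u, hx.D_h]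
  rw [e1]
  simp only [key, Finset.sum_add_distrib, Finset.sum_sub_distrib, ← Finset.sum_div,
    ← Finset.sum_mul, ← Finset.mul_sum, ha, hu, Finset.sum_ite_eq', Finset.mem_univ, if_true,
    e2, e3, hx.D_a ht, hx.D_qp ht]
  field_simp
  ring

omit ht in
/-- Leibniz rule for `c / a` with `c` constant. -/
lemma D_const_div {c a : F} (j : Fin N) (hc : D j c = 0) : D j (c / a) = -(c / a ^ 2 * D j a) := by
  rw [Derivation.leibniz_div, hc]
  simp only [smul_eq_mul]
  ring

variable [CharZero F]

lemma map_Rk1 (ha : x.a ≠ 0) : IsSolution s D (Rk1.map x) where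
  D_k0 := hx.D_k0
  D_k1 j := by simp [hx.D_k1]
  D_kinf := hx.D_kinf
  D_th := hx.D_th
  D_e_mul j i := by
    rcases eq_or_ne i j with rfl | hij
    · simp
    · have hj := ht.ne_zero j
      have hj1 := ht.sub_one_ne j
      have hji := ht.sub_ne i j hij
      simp only [Rk1_e, Rk1_Y, Rk1_q, map_sub, Derivation.leibniz, smul_eq_mul]
      rw [hx.D_e ht hij, hx.D_q ht hij, D_const_div hx j (hx.D_k1 j), hx.D_a ht]
      field_simp
      ring
  D_qp_mul j := by
    have hj := ht.ne_zero j
    have hj1 := ht.sub_one_ne j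
    rw [Rk1_qp ha, Rk1_h ha, Rk1_Y, map_sub, map_sub, D_const_div hx j (hx.D_k1 j), hx.D_k1,
      hx.D_a ht, hx.D_qp ht, Rk1_q]
    field_simp
    ring
  D_q_mul j i := by
    simp only [Rk1_q, Rk1_c, Rk1_B ha, hx.D_q_mul]
    ring
  D_a_mul j := by
    simp only [Rk1_a, Rk1_q, Rk1_c, Rk1_B ha, Rk1_k1, hx.D_a_mul]
    field_simp
    ring

lemma map_Rk0 (hb : x.b s ≠ 0) : IsSolution s D ((Rk0 s).map x) where
  D_k0 j := by simp [hx.D_k0]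
  D_k1 := hx.D_k1
  D_kinf := hx.D_kinf
  D_th := hx.D_th
  D_e_mul j i := by
    rcases eq_or_ne i j with rfl | hij
    · simp
    · have hj := ht.ne_zero j
      have hi := ht.ne_zero i
      have hj1 := ht.sub_one_ne j
      have hji := ht.sub_ne i j hij
      simp only [Rk0_e, Rk0_Y, Rk0_q, map_sub, Derivation.leibniz, Derivation.leibniz_div,
        smul_eq_mul]
      rw [hx.D_e ht hij, hx.D_q ht hij, ht.D_other i j hij, hx.D_k0, hx.D_b ht]
      field_simp
      ring
  D_qp_mul j := by
    have hj := ht.ne_zero j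
    have hj1 := ht.sub_one_ne j
    rw [Rk0_qp hb, Rk0_h hb, Rk0_Y, map_sub, map_sub, D_const_div hx j (hx.D_k0 j), hx.D_k0,
      hx.D_b ht, hx.D_qp ht, Rk0_q]
    field_simp
    ring
  D_q_mul j i := by
    have hj := ht.ne_zero j
    have hi := ht.ne_zero i
    simp only [Rk0_q, Rk0_c, Rk0_B hb, hx.D_q_mul]
    field_simp
    ring
  D_a_mul j := by
    have hj := ht.ne_zero j
    simp only [Rk0_a, Rk0_q, Rk0_c, Rk0_B hb, Rk0_k1, hx.D_a_mul]
    field_simp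
    ring

omit ht in
lemma map_signFlip (hq : ∀ i, x.q i ≠ 0) : IsSolution s D (signFlip.map x) where
  D_k0 := hx.D_k0
  D_k1 := hx.D_k1
  D_kinf j := by simp [hx.D_kinf]
  D_th j i := by simp [hx.D_th]
  D_e_mul j i := by
    simp only [signFlip_e hq, signFlip_Y hq, signFlip_q, map_sub, hx.D_th, sub_zero, hx.D_e_mul]
  D_qp_mul j := by
    have : D j (signFlip.map x).qp = D j x.qp := by
      simp [Datum.qp_eq, signFlip_e hq, hx.D_th]
    rw [this, signFlip_Y hq, signFlip_h hq, signFlip_q, hx.D_qp_mul]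
  D_q_mul j i := by
    simp only [signFlip_c hq, signFlip_B hq, signFlip_q, hx.D_q_mul]
  D_a_mul j := by
    simp only [signFlip_c hq, signFlip_B hq, signFlip_q, signFlip_a, signFlip_k1, hx.D_a_mul]

/-- Since q and Y essentially trade places, the equation for the new q_i is that for Y_i and h, and
the equation for the new `a` = u/h is `D_u`. -/
lemma map_Rtau (hq : ∀ i, x.q i ≠ 0) (hh : x.h ≠ 0) (hY : ∀ i, x.Y i ≠ 0) :
    IsSolution s D ((Rtau s).map x) where
  D_k0 j := by simp [hx.D_k0]
  D_k1 j := by simp [hx.D_k1]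
  D_kinf j := by simp [hx.D_kinf]
  D_th j i := by simp [hx.D_th]
  D_e_mul j i := by
    have hj := ht.ne_zero j
    have hi := ht.ne_zero i
    rw [Rtau_e ht.ne_zero hh hY, Rtau_Y ht.ne_zero hh hY, Rtau_Y ht.ne_zero hh hY, Rtau_q,
      Rtau_q, map_neg, mul_neg, hx.D_e_mul]
    field_simp
    ring
  D_qp_mul j := by
    have hj := ht.ne_zero j
    rw [Rtau_qp ht.ne_zero hh hY, Rtau_Y ht.ne_zero hh hY, Rtau_q, Rtau_h ht.ne_zero hh hY,
      map_neg, mul_neg, hx.D_qp_mul]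
    field_simp
    ring
  D_q_mul j i := by
    rcases eq_or_ne i j with rfl | hij
    · simp only [sub_self]; ring
    · have hj := ht.ne_zero j
      have hi := ht.ne_zero i
      have hj1 := ht.sub_one_ne j
      have hji := ht.sub_ne i j hij
      rw [Rtau_q, Rtau_q, Rtau_B ht.ne_zero hh hY, Rtau_c ht.ne_zero hh hY,
        Rtau_c ht.ne_zero hh hY, Derivation.leibniz_div, Derivation.leibniz, hx.D_h, hx.D_qp ht,
        hx.D_Y ht hij (hq i), ht.D_other i j hij]
      simp only [smul_eq_mul]
      field_simp
      ring
  D_a_mul j := by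
    have hj := ht.ne_zero j
    have hj1 := ht.sub_one_ne j
    rw [Rtau_a ht.ne_zero hh hY, Rtau_q, Rtau_B ht.ne_zero hh hY, Rtau_c ht.ne_zero hh hY,
      Rtau_k1, Derivation.leibniz_div, hx.D_h, hx.D_qp ht, hx.D_u ht hq]
    simp only [smul_eq_mul]
    field_simp
    ring

/-- `Rtau` sends b to g/h, so this is `D_b` read at the transformed solution. -/
lemma D_g (hq : ∀ i, x.q i ≠ 0) (hh : x.h ≠ 0) (hY : ∀ i, x.Y i ≠ 0) (j : Fin N) : D j x.g =
    (x.g * (x.c j - x.q j * x.B) - (1 - x.k0) * (s j - 1) * x.Y j) / (s j * (s j - 1)) := by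
  have hj := ht.ne_zero j
  have hj1 := ht.sub_one_ne j
  have h1 := (hx.map_Rtau ht hq hh hY).D_b ht j
  have h2 : x.g = x.h * ((Rtau s).map x).b s := by
    rw [Rtau_b ht.ne_zero hh hY]; field_simp
  rw [congrArg (D j) h2, Derivation.leibniz, h1, hx.D_h, hx.D_qp ht, Rtau_b ht.ne_zero hh hY,
    Rtau_q, Rtau_B ht.ne_zero hh hY, Rtau_c ht.ne_zero hh hY, Rtau_k0]
  simp only [smul_eq_mul]
  field_simp
  ring

end IsSolution
end
end Garnier

/-! ### Effect of the reflections on the Hamiltonians, and their weighted sum. -/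

namespace Garnier

noncomputable section

set_option linter.unusedSectionVars false

variable {N : ℕ} {F : Type} [Field F]

/-- The interaction of `i` and `k` in `s_i (s_i - 1) H_i`. -/
def hamPair (s : Fin N → F) (x : Datum N F) (i k : Fin N) : F :=
  Rcoef s k i * x.Y k * x.q i + Scoef s i k * x.Y i * x.q k
    + Rcoef s i k * (x.c k * x.c i - x.th k * x.th i) / 2

/-- `s_i (s_i - 1) H_i`. -/
def hamNum (s : Fin N → F) (x : Datum N F) (i : Fin N) : F :=
  x.q i * x.h + s i * x.Y i - ∑ k ∈ Finset.univ.erase i, hamPair s x i k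
    - (s i + 1) * (x.q i * x.Y i) + (x.k1 * s i + x.k0 - 1) * x.e i

variable [CharZero F]

lemma ham_eq (s : Fin N → F) (x : Datum N F) (i : Fin N) :
    ham s x i = hamNum s x i / (s i * (s i - 1)) := by
  rw [ham]
  congr 1
  have h : ∑ k ∈ Finset.univ.erase i, hamPair s x i k =
      ∑ j ∈ Finset.univ.erase i, Rcoef s j i * (x.q j * x.p j - x.th j) * x.q i * x.p j
      + ∑ j ∈ Finset.univ.erase i, Scoef s i j * (x.q i * x.p i - x.th i) * x.q j * x.p i
      + ∑ j ∈ Finset.univ.erase i, Rcoef s i j * x.q j * x.p j * (x.q i * x.p i - x.th i)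
      + ∑ j ∈ Finset.univ.erase i, Rcoef s i j * x.q i * x.p i * (x.q j * x.p j - x.th j) := by
    simp only [← Finset.sum_add_distrib]
    refine Finset.sum_congr rfl fun k _ => ?_
    simp only [hamPair, Datum.Y, Datum.c, Datum.e]
    ring
  rw [hamNum, h]
  simp only [Datum.Y, Datum.h, Datum.e]
  ring

variable {s : Fin N → F} {D : Fin N → Derivation ℤ F F} (ht : TimeVars s D) {x : Datum N F}
include ht

omit ht in
lemma sum_erase_eq (f : Fin N → F) (i : Fin N) :
    ∑ k ∈ Finset.univ.erase i, f k = ∑ k, f k - f i := by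
  rw [← Finset.add_sum_erase _ _ (Finset.mem_univ i)]; ring

lemma hamNum_Rk1 (ha : x.a ≠ 0) (i : Fin N) :
    hamNum s (Rk1.map x) i = hamNum s x i - x.k1 * x.th i * s i := by
  -- The poles at s_k = s_i cancel in the change of the pair term, and what remains is linear in q_k
  -- and c_k. Summing over k then needs only ∑ q_k and ∑ c_k.
  have key : ∀ k ∈ Finset.univ.erase i, hamPair s (Rk1.map x) i k = hamPair s x i k
      + (x.k1 / x.a * (x.k1 / x.a * (1 + s i) * x.q i - s i * x.c i) * x.q k
        - x.k1 / x.a * x.q i * x.c k) := by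
    intro k hk
    have h1 := ht.sub_ne i k (Finset.ne_of_mem_erase hk).symm
    have h2 := ht.sub_ne k i (Finset.ne_of_mem_erase hk)
    simp only [hamPair, Rk1_Y, Rk1_c, Rk1_q, Rk1_th, Rcoef, Scoef]
    have h3 : s i - s k = -(s k - s i) := by ring
    rw [h3]
    field_simp
    ring
  have e1 : ∑ i, x.q i = x.a + 1 := by simp [Datum.a]
  have e2 : ∑ i, x.c i = x.B - (1 - x.k0 - x.k1) := by rw [x.B_eq]; ring
  rw [hamNum, Finset.sum_congr rfl key, Finset.sum_add_distrib, Finset.sum_sub_distrib,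
    ← Finset.mul_sum, ← Finset.mul_sum, sum_erase_eq x.q, sum_erase_eq x.c, e1, e2, hamNum,
    Rk1_h ha, Rk1_Y, Rk1_e, Rk1_q, Rk1_k1, Rk1_k0]
  generalize ∑ k ∈ Finset.univ.erase i, hamPair s x i k = S
  have : x.e i = (x.c i + x.th i) / 2 := by rw [Datum.c]; ring
  rw [this]
  field_simp
  ring

lemma hamNum_Rk0 (hb : x.b s ≠ 0) (i : Fin N) :
    hamNum s ((Rk0 s).map x) i =
      hamNum s x i - (s i - 1) * (x.k0 / x.b s * (x.q i / s i)) - x.k0 * x.th i := by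
  have h0 := ht.ne_zero
  have key : ∀ k ∈ Finset.univ.erase i, hamPair s ((Rk0 s).map x) i k = hamPair s x i k
      + (x.k0 / x.b s * (x.k0 / x.b s * (1 + 1 / s i) * x.q i - x.c i) * (x.q k / s k)
        - x.k0 / x.b s * x.q i * x.c k) := by
    intro k hk
    have h1 := ht.sub_ne i k (Finset.ne_of_mem_erase hk).symm
    have h2 := ht.sub_ne k i (Finset.ne_of_mem_erase hk)
    simp only [hamPair, Rk0_Y, Rk0_c, Rk0_q, Rk0_th, Rcoef, Scoef]
    have h3 : s i - s k = -(s k - s i) := by ring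
    have hi := h0 i
    have hk := h0 k
    rw [h3]
    field_simp
    ring
  have hi := h0 i
  have e1 : ∑ i, x.q i / s i = x.b s + 1 := by simp [Datum.b]
  have e2 : ∑ i, x.c i = x.B - (1 - x.k0 - x.k1) := by rw [x.B_eq]; ring
  rw [hamNum, Finset.sum_congr rfl key, Finset.sum_add_distrib, Finset.sum_sub_distrib,
    ← Finset.mul_sum, ← Finset.mul_sum, sum_erase_eq (fun k => x.q k / s k),
    sum_erase_eq x.c, e1, e2, hamNum,
    Rk0_h hb, Rk0_Y, Rk0_e, Rk0_q, Rk0_k1, Rk0_k0]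
  generalize ∑ k ∈ Finset.univ.erase i, hamPair s x i k = S
  have : x.e i = (x.c i + x.th i) / 2 := by rw [Datum.c]; ring
  rw [this]
  field_simp
  ring

omit ht in
lemma hamNum_signFlip (hq : ∀ i, x.q i ≠ 0) (i : Fin N) :
    hamNum s (signFlip.map x) i = hamNum s x i - (x.k1 * s i + x.k0 - 1) * x.th i := by
  have key : ∀ k, hamPair s (signFlip.map x) i k = hamPair s x i k := by
    intro k
    simp only [hamPair, signFlip_Y hq, signFlip_c hq, signFlip_q, signFlip_th]
    ring
  simp only [hamNum, key, signFlip_h hq, signFlip_Y hq, signFlip_e hq, signFlip_q, signFlip_k0,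
    signFlip_k1]
  ring

lemma hamNum_Rtau (hh : x.h ≠ 0) (hY : ∀ i, x.Y i ≠ 0) (i : Fin N) :
    hamNum s ((Rtau s).map x) i = hamNum s x i - (s i - 1) * x.e i := by
  have h0 := ht.ne_zero
  -- The terms with R_{ki} Y_k q_i and S_{ik} Y_i q_k are exchanged, because R_{ki} s_i / s_k =
  -- S_{ik}.
  have key : ∀ k ∈ Finset.univ.erase i, hamPair s ((Rtau s).map x) i k = hamPair s x i k := by
    intro k hk
    have h1 := ht.sub_ne i k (Finset.ne_of_mem_erase hk).symm
    have h3 : s i - s k = -(s k - s i) := by ring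
    have hi := h0 i
    have hk := h0 k
    simp only [hamPair, Rtau_Y h0 hh hY, Rtau_c h0 hh hY, Rtau_q, Rtau_th, Rcoef, Scoef, h3]
    field_simp
    ring
  have hi := h0 i
  rw [hamNum, Finset.sum_congr rfl key, hamNum, Rtau_h h0 hh hY, Rtau_Y h0 hh hY,
    Rtau_e h0 hh hY, Rtau_q, Rtau_k0, Rtau_k1]
  generalize ∑ k ∈ Finset.univ.erase i, hamPair s x i k = S
  field_simp
  ring

/-- The sum of the `s_i (s_i - 1) H_i`. -/
lemma sum_hamNum : ∑ i, hamNum s x i =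
    -(x.a * x.u s) + x.k1 * ∑ i, (s i - 1) * x.e i + x.alpha * (x.alpha + x.kinf) := by
  have hswap : ∀ f : Fin N → Fin N → F, ∑ i, ∑ k ∈ Finset.univ.erase i, f i k =
      ∑ i, ∑ k ∈ Finset.univ.erase i, f k i := by
    intro f
    refine Finset.sum_comm' fun i k => ?_
    simp [eq_comm]
  -- Exchanging i and k in part of the double sum removes all denominators, through R_{ik} + S_{ik}
  -- = s_i and R_{ik} + R_{ki} = 1.
  have hpair : ∑ i, ∑ k ∈ Finset.univ.erase i, hamPair s x i k =
      ∑ i, ∑ k ∈ Finset.univ.erase i, (s i * x.Y i * x.q k + (x.c i * x.c k - x.th i * x.th k) / 4)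
      := by
    have h1 : ∑ i, ∑ k ∈ Finset.univ.erase i, hamPair s x i k =
        ∑ i, ∑ k ∈ Finset.univ.erase i, (Rcoef s k i * x.Y k * x.q i
          + Rcoef s i k * (x.c k * x.c i - x.th k * x.th i) / 4)
        + ∑ i, ∑ k ∈ Finset.univ.erase i, (Scoef s i k * x.Y i * x.q k
          + Rcoef s i k * (x.c k * x.c i - x.th k * x.th i) / 4) := by
      simp only [← Finset.sum_add_distrib]
      refine Finset.sum_congr rfl fun i _ => Finset.sum_congr rfl fun k _ => ?_
      simp only [hamPair]
      ring
    rw [h1, hswap fun i k => Rcoef s k i * x.Y k * x.q i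
          + Rcoef s i k * (x.c k * x.c i - x.th k * x.th i) / 4]
    simp only [← Finset.sum_add_distrib]
    refine Finset.sum_congr rfl fun i _ => Finset.sum_congr rfl fun k hk => ?_
    have h1 := ht.sub_ne i k (Finset.ne_of_mem_erase hk).symm
    have h3 : s i - s k = -(s k - s i) := by ring
    simp only [Rcoef, Scoef, h3]
    field_simp
    ring
  have e1 : ∑ i, x.q i = x.a + 1 := by simp [Datum.a]
  have e2 : ∑ i, x.c i = x.B - (1 - x.k0 - x.k1) := by rw [x.B_eq]; ring
  have e3 : ∑ i, s i * x.Y i = x.u s + x.h := by simp [Datum.u]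
  -- These are the diagonal terms i = k of the double sum; they complete it to products of single
  -- sums.
  have e4 : ∀ i, x.q i * x.Y i = (x.c i * x.c i - x.th i * x.th i) / 4 := by
    intro i; rw [x.q_mul_Y, Datum.c]; ring
  have e5 : ∑ i, (s i - 1) * x.e i = ∑ i, s i * x.e i - x.qp := by
    simp only [sub_mul, one_mul, Finset.sum_sub_distrib, Datum.qp_eq]
  have e8 : ∑ i, x.th i = 1 - x.k0 - x.k1 - x.kinf - 2 * x.alpha := by
    rw [Datum.alpha]; ring
  have expand : ∑ i, hamNum s x i = (∑ i, x.q i) * x.h + ∑ i, s i * x.Y i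
      - ((∑ i, s i * x.Y i) * ∑ k, x.q k + ((∑ i, x.c i) * ∑ k, x.c k
        - (∑ i, x.th i) * ∑ k, x.th k) / 4)
      + x.k1 * ∑ i, s i * x.e i + (x.k0 - 1) * x.qp := by
    have hpair' : ∑ i, ∑ k ∈ Finset.univ.erase i, hamPair s x i k =
        ((∑ i, s i * x.Y i) * ∑ k, x.q k + ((∑ i, x.c i) * ∑ k, x.c k
          - (∑ i, x.th i) * ∑ k, x.th k) / 4) - ∑ i, (s i + 1) * (x.q i * x.Y i) := by
      rw [hpair]
      simp only [sum_erase_eq, Finset.sum_sub_distrib, Finset.sum_add_distrib,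
        ← Finset.sum_div, ← Finset.mul_sum, add_mul, one_mul, e4]
      have : ∀ i, s i * x.Y i * x.q i = s i * ((x.c i * x.c i - x.th i * x.th i) / 4) := by
        intro i; rw [← e4]; ring
      simp only [mul_sub, Finset.sum_sub_distrib, ← Finset.sum_mul, this]
      ring
    simp only [hamNum, Finset.sum_sub_distrib, Finset.sum_add_distrib, hpair', ← Finset.sum_mul,
      Datum.qp_eq, Finset.mul_sum]
    have : ∑ i, (x.k1 * s i + x.k0 - 1) * x.e i =
        ∑ i, x.k1 * (s i * x.e i) + ∑ i, (x.k0 - 1) * x.e i := by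
      rw [← Finset.sum_add_distrib]
      exact Finset.sum_congr rfl fun i _ => by ring
    rw [this]
    ring
  rw [expand, e1, e2, e3, e5, e8]
  simp only [Datum.B, Datum.h]
  ring

end
end Garnier

/-! ### The derivation ∑ (s_j - 1) ∂/∂s_j on the weighted sum of Hamiltonians. -/

namespace Garnier

noncomputable section

set_option linter.unusedSectionVars false

variable {N : ℕ} {F : Type} [Field F] [CharZero F]
variable {s : Fin N → F} {D : Fin N → Derivation ℤ F F} {x : Datum N F}

lemma Datum.sum_q_div (s : Fin N → F) (x : Datum N F) : ∑ i, x.q i / s i = x.b s + 1 := by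
  simp [Datum.b]

lemma Datum.sum_q (x : Datum N F) : ∑ i, x.q i = x.a + 1 := by simp [Datum.a]

lemma Datum.sum_c (x : Datum N F) : ∑ i, x.c i = x.B - (1 - x.k0 - x.k1) := by
  rw [x.B_eq]; ring

lemma Datum.sum_Y (x : Datum N F) : ∑ i, x.Y i = x.g + x.h := by simp [Datum.g]

lemma Datum.sum_s_mul_Y (s : Fin N → F) (x : Datum N F) : ∑ i, s i * x.Y i = x.u s + x.h := by
  simp [Datum.u]

namespace IsSolution

variable (ht : TimeVars s D) (hx : IsSolution s D x)
include ht hx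

lemma sum_D_a : ∑ j, (s j - 1) * D j x.a =
    x.a * (x.B * x.b s + 1 - x.k0) - x.k1 * x.b s := by
  have h : ∀ j, (s j - 1) * D j x.a =
      x.a * (x.B * (x.q j / s j) - x.c j) + x.k1 * (x.q j - x.q j / s j) := by
    intro j
    have hj := ht.ne_zero j
    have hj1 := ht.sub_one_ne j
    rw [hx.D_a ht]
    field_simp
  simp only [h, Finset.sum_add_distrib, Finset.sum_sub_distrib, ← Finset.mul_sum,
    Datum.sum_q_div, Datum.sum_q, Datum.sum_c]
  ring

lemma sum_D_u (hq : ∀ i, x.q i ≠ 0) : ∑ j, (s j - 1) * D j (x.u s) =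
    x.k0 * x.u s - (1 - x.k1) * x.g - x.u s * x.b s * x.B := by
  have h : ∀ j, (s j - 1) * D j (x.u s) =
      x.u s * (x.c j - x.B * (x.q j / s j)) + (1 - x.k1) * (s j * x.Y j - x.Y j) := by
    intro j
    have hj := ht.ne_zero j
    have hj1 := ht.sub_one_ne j
    rw [hx.D_u ht hq]
    field_simp
  simp only [h, Finset.sum_add_distrib, Finset.sum_sub_distrib, ← Finset.mul_sum,
    Datum.sum_q_div, Datum.sum_s_mul_Y, Datum.sum_c, Datum.sum_Y]
  ring

lemma sum_sum_D_e : ∑ j, ∑ i, (s j - 1) * ((s i - 1) * D j (x.e i)) =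
    x.a * x.g - x.u s * x.b s := by
  have h : ∀ j, ∑ i, (s j - 1) * ((s i - 1) * D j (x.e i)) =
      x.u s * (x.q j - x.q j / s j) - x.a * (s j * x.Y j - x.Y j) := by
    intro j
    have hj := ht.ne_zero j
    have hj1 := ht.sub_one_ne j
    -- Writing s_i - 1 = (s_j - 1) - (s_j - s_i) makes `D_e_mul` applicable to the second part
    -- without denominators, while the first part sums to the derivative of ∑ e_i.
    have h1 : ∀ i, (s j - 1) * ((s i - 1) * D j (x.e i)) = (s j - 1) ^ 2 * D j (x.e i)
        - (s j - 1) / s j * (x.q i * (s j * x.Y j) - s i * x.Y i * x.q j) := by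
      intro i
      have := hx.D_e_mul j i
      field_simp
      linear_combination -this
    have e3 : ∑ i, D j (x.e i) = D j x.qp := by simp [Datum.qp_eq]
    simp only [h1, Finset.sum_sub_distrib, ← Finset.mul_sum, ← Finset.sum_mul, e3,
      Datum.sum_s_mul_Y, Datum.sum_q, hx.D_qp ht]
    field_simp
    ring
  simp only [h, Finset.sum_sub_distrib, ← Finset.mul_sum, Datum.sum_q_div, Datum.sum_q,
    Datum.sum_s_mul_Y, Datum.sum_Y]
  ring

/-- This is the core of the Toda brace: the terms in u and b produced by differentiating a u cancel
against those from κ₁ ∑(s_i - 1)e_i, and a g survives. -/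
lemma sum_D_sum_hamNum (hq : ∀ i, x.q i ≠ 0) :
    ∑ j, (s j - 1) * D j (∑ i, hamNum s x i) - ∑ i, hamNum s x i =
      x.a * x.g - x.alpha * (x.alpha + x.kinf) := by
  have h1 : ∀ j, (s j - 1) * D j (∑ i, hamNum s x i) =
      -(x.u s * ((s j - 1) * D j x.a)) - x.a * ((s j - 1) * D j (x.u s))
        + x.k1 * ((s j - 1) * x.e j + ∑ i, (s j - 1) * ((s i - 1) * D j (x.e i))) := by
    intro j
    have h2 : D j (∑ i, (s i - 1) * x.e i) = x.e j + ∑ i, (s i - 1) * D j (x.e i) := by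
      have : ∀ i, D j ((s i - 1) * x.e i) =
          (if i = j then x.e j else 0) + (s i - 1) * D j (x.e i) := by
        intro i
        rw [Derivation.leibniz, map_sub, ht.D_s]
        split_ifs with h
        · subst h; simp; ring
        · simp
      simp [map_sum, this, Finset.sum_add_distrib]
    rw [sum_hamNum ht, map_add, map_add, map_neg, Derivation.leibniz, Derivation.leibniz,
      Derivation.leibniz, hx.D_k1, map_add, hx.D_alpha, hx.D_kinf, h2]
    simp only [smul_eq_mul, ← Finset.mul_sum]
    ring
  simp only [h1, Finset.sum_add_distrib, Finset.sum_sub_distrib, Finset.sum_neg_distrib,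
    ← Finset.mul_sum, hx.sum_D_a ht, hx.sum_D_u ht hq]
  simp only [Finset.mul_sum]
  rw [hx.sum_sum_D_e ht, sum_hamNum ht]
  ring

end IsSolution
end
end Garnier

/-! ### The maps ρ and ρ⁻¹, the values of `gam` along them, and commutation of the translations. -/

namespace Garnier

noncomputable section

set_option linter.unusedSectionVars false

variable {N : ℕ} {F : Type} [Field F]

/-- `ρ = R_τ ∘ R_{θ₁} ∘ ⋯ ∘ R_{θ_N} ∘ R_{κ_∞} ∘ R_{κ₀}`, so that `l = R_{κ₁} ∘ ρ` and
`l̃ = ρ ∘ R_{κ₁}`. -/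
def rho (s : Fin N → F) : PMap (Datum N F) := (Rtau s).comp (Rth.comp (Rkinf.comp (Rk0 s)))

/-- `ρ⁻¹`. -/
def rhoInv (s : Fin N → F) : PMap (Datum N F) := (Rk0 s).comp (Rkinf.comp (Rth.comp (Rtau s)))

lemma rho_map (s : Fin N → F) (x : Datum N F) :
    (rho s).map x = (Rtau s).map (signFlip.map ((Rk0 s).map x)) := rfl

lemma rhoInv_map (s : Fin N → F) (x : Datum N F) :
    (rhoInv s).map x = (Rk0 s).map (signFlip.map ((Rtau s).map x)) := rfl

lemma transLt_map (s : Fin N → F) (x : Datum N F) :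
    (transLt s).map x = (rho s).map (Rk1.map x) := Rk1_Rk1 _

lemma transLtInv_map (s : Fin N → F) (x : Datum N F) :
    (transLtInv s).map x = Rk1.map ((rhoInv s).map x) := by
  change Rk1.map ((rhoInv s).map (Rk1.map (Rk1.map x))) = _
  rw [Rk1_Rk1]

/-- `ρ` is defined at `x`. -/
structure RhoReg (s : Fin N → F) (x : Datum N F) : Prop where
  b_ne : x.b s ≠ 0
  q_ne : ∀ i, x.q i ≠ 0
  h_ne : ((Rk0 s).map x).h ≠ 0
  Y_ne : ∀ i, ((Rk0 s).map x).Y i ≠ 0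

/-- `ρ⁻¹` is defined at `x`, and the `q_i` do not vanish. -/
structure RhoInvReg (x : Datum N F) : Prop where
  q_ne : ∀ i, x.q i ≠ 0
  h_ne : x.h ≠ 0
  Y_ne : ∀ i, x.Y i ≠ 0
  g_ne : x.g ≠ 0

variable [CharZero F] {s : Fin N → F} {x : Datum N F}

lemma RhoReg.of_dom (hs : ∀ i, s i ≠ 0) (h : (rho s).dom x) : RhoReg s x := by
  obtain ⟨⟨⟨hb, -⟩, hq⟩, hR⟩ := h
  have hq' : ∀ i, ((Rk0 s).map x).q i ≠ 0 := hq
  obtain ⟨h1, h2⟩ := (Rtau_dom_iff hs).1 (show (Rtau s).dom (signFlip.map ((Rk0 s).map x)) from hR)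
  rw [signFlip_h hq'] at h1
  simp only [signFlip_Y hq'] at h2
  exact ⟨hb, hq, h1, h2⟩

lemma RhoInvReg.of_dom (hs : ∀ i, s i ≠ 0) (hq : ∀ i, x.q i ≠ 0) (h : (rhoInv s).dom x) :
    RhoInvReg x := by
  obtain ⟨⟨⟨hR, -⟩, -⟩, hb⟩ := h
  obtain ⟨h1, h2⟩ := (Rtau_dom_iff hs).1 hR
  have hb' : ((Rtau s).map x).b s ≠ 0 := hb
  rw [Rtau_b hs h1 h2] at hb'
  exact ⟨hq, h1, h2, (div_ne_zero_iff.1 hb').1⟩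

namespace RhoReg

variable (hs : ∀ i, s i ≠ 0) (hx : RhoReg s x)
include hx

lemma q_ne' (i : Fin N) : ((Rk0 s).map x).q i ≠ 0 := hx.q_ne i

lemma h_ne' : (signFlip.map ((Rk0 s).map x)).h ≠ 0 := by
  rw [signFlip_h hx.q_ne']; exact hx.h_ne

lemma Y_ne' (i : Fin N) : (signFlip.map ((Rk0 s).map x)).Y i ≠ 0 := by
  rw [signFlip_Y hx.q_ne']; exact hx.Y_ne i

include hs

lemma rhoInv_rho : (rhoInv s).map ((rho s).map x) = x := by
  rw [rho_map, rhoInv_map, Rtau_Rtau hs hx.h_ne' hx.Y_ne' hx.q_ne', signFlip_signFlip, Rk0_Rk0]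

lemma hamNum_rho {D : Fin N → Derivation ℤ F F} (ht : TimeVars s D) (i : Fin N) :
    hamNum s ((rho s).map x) i =
      hamNum s x i - (s i - 1) * x.e i + (s i - x.k1 * s i) * x.th i := by
  rw [rho_map, hamNum_Rtau ht hx.h_ne' hx.Y_ne', hamNum_signFlip hx.q_ne',
    hamNum_Rk0 ht hx.b_ne, signFlip_e hx.q_ne', Rk0_e]
  simp only [Rk0_k0, Rk0_k1, Rk0_th]
  ring

/-- After ρ the product a g is b times the value of u after `Rk0`, that is b u + κ₀(1 - κ₁); the
final `Rk1` removes exactly the constant. -/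
lemma gam_Rk1_rho (ha : ((rho s).map x).a ≠ 0) :
    (Rk1.map ((rho s).map x)).gam = 4 * (x.b s * x.u s) := by
  have hu := Rk0_u hx.b_ne hs
  have hb := hx.b_ne
  have hh := hx.h_ne
  have h1 : ((rho s).map x).a * ((rho s).map x).g =
      x.b s * x.u s + x.k0 * (1 - x.k1) := by
    rw [rho_map, Rtau_a hs hx.h_ne' hx.Y_ne', Rtau_g hs hx.h_ne' hx.Y_ne',
      signFlip_h hx.q_ne', signFlip_u hx.q_ne', signFlip_b, Rk0_b, hu]
    field_simp
  rw [Datum.gam, Rk1_a, Rk1_g ha, mul_add, h1]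
  have h2 : ((rho s).map x).k1 = 1 - x.k1 := rfl
  have h3 : ((rho s).map x).k0 = 1 - -x.k0 := rfl
  rw [h2, h3]
  field_simp
  ring

lemma isSolution_rho {D : Fin N → Derivation ℤ F F} (ht : TimeVars s D) (h : IsSolution s D x) :
    IsSolution s D ((rho s).map x) :=
  ((h.map_Rk0 ht hx.b_ne).map_signFlip hx.q_ne').map_Rtau ht hx.q_ne' hx.h_ne' hx.Y_ne'

end RhoReg

/-- The numerator of `b` after `ρ⁻²`. -/
def Datum.W (s : Fin N → F) (x : Datum N F) : F :=
  x.g ^ 2 * x.b s + (1 - x.k0) * x.g * (∑ i, x.c i / s i - x.B)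
    + (1 - x.k0) ^ 2 * (∑ i, x.Y i / s i - x.h)

/-- `W` equals ∑ U_i/s_i - V, for the invariant quadratic forms `U` and `V` introduced with
`reflTwo`. -/
lemma W_Rk1 (ha : x.a ≠ 0) : (Rk1.map x).W s = x.W s := by
  have h1 : ∑ i, (Rk1.map x).c i / s i =
      ∑ i, x.c i / s i - 2 * (x.k1 / x.a) * (x.b s + 1) := by
    simp only [Rk1_c, ← x.sum_q_div s, Finset.mul_sum, ← Finset.sum_sub_distrib]
    exact Finset.sum_congr rfl fun i _ => by ring
  have h2 : ∑ i, (Rk1.map x).Y i / s i = ∑ i, x.Y i / s i - x.k1 / x.a * ∑ i, x.c i / s i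
      + (x.k1 / x.a) ^ 2 * (x.b s + 1) := by
    simp only [Rk1_Y, ← x.sum_q_div s, Finset.mul_sum, ← Finset.sum_sub_distrib,
      ← Finset.sum_add_distrib]
    exact Finset.sum_congr rfl fun i _ => by ring
  simp only [Datum.W, h1, h2, Rk1_g ha, Rk1_b, Rk1_B ha, Rk1_h ha, Rk1_k0]
  ring

namespace RhoInvReg

variable (hs : ∀ i, s i ≠ 0) (hx : RhoInvReg x)
include hs hx

lemma q_ne' (i : Fin N) : ((Rtau s).map x).q i ≠ 0 := Rtau_q_ne hs hx.h_ne hx.Y_ne i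

lemma b_ne' : (signFlip.map ((Rtau s).map x)).b s ≠ 0 := by
  rw [signFlip_b, Rtau_b hs hx.h_ne hx.Y_ne]
  exact div_ne_zero hx.g_ne hx.h_ne

lemma rho_rhoInv : (rho s).map ((rhoInv s).map x) = x := by
  rw [rho_map, rhoInv_map, Rk0_Rk0, signFlip_signFlip, Rtau_Rtau hs hx.h_ne hx.Y_ne hx.q_ne]

lemma hamNum_rhoInv {D : Fin N → Derivation ℤ F F} (ht : TimeVars s D) (i : Fin N) :
    hamNum s ((rhoInv s).map x) i =
      hamNum s x i - (s i - 1) * (x.e i + (1 - x.k0) * x.Y i / x.g)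
        + ((1 - x.k1) * s i - 1) * x.th i := by
  have hi := hs i
  have hg := hx.g_ne
  have hh := hx.h_ne
  rw [rhoInv_map, hamNum_Rk0 ht (hx.b_ne' hs), hamNum_signFlip (hx.q_ne' hs),
    hamNum_Rtau ht hx.h_ne hx.Y_ne]
  simp only [signFlip_b, signFlip_k0, signFlip_q, signFlip_th, Rtau_th, Rtau_k0, Rtau_k1,
    Rtau_b hs hx.h_ne hx.Y_ne, Rtau_q]
  field_simp
  ring

lemma isSolution_rhoInv {D : Fin N → Derivation ℤ F F} (ht : TimeVars s D)
    (h : IsSolution s D x) : IsSolution s D ((rhoInv s).map x) :=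
  ((h.map_Rtau ht hx.q_ne hx.h_ne hx.Y_ne).map_signFlip (hx.q_ne' hs)).map_Rk0 ht (hx.b_ne' hs)

lemma gam_rhoInv : ((rhoInv s).map x).gam = 4 * (x.u s * x.W s / x.g ^ 2) := by
  have hg := hx.g_ne
  have hh := hx.h_ne
  set z := signFlip.map ((Rtau s).map x) with hz
  have hzb : z.b s = x.g / x.h := by
    rw [hz, signFlip_b, Rtau_b hs hx.h_ne hx.Y_ne]
  have hzh : z.h = x.h := by rw [hz, signFlip_h (hx.q_ne' hs), Rtau_h hs hx.h_ne hx.Y_ne]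
  have hzB : z.B = -x.B := by rw [hz, signFlip_B (hx.q_ne' hs), Rtau_B hs hx.h_ne hx.Y_ne]
  have hzk : z.k0 = 1 - x.k0 := rfl
  have hza : z.a = x.u s / x.h := Rtau_a hs hx.h_ne hx.Y_ne
  have hY : ∀ i, ((Rk0 s).map z).Y i = x.h * (x.q i / s i)
      + (1 - x.k0) * x.h / x.g * (x.c i / s i)
      + ((1 - x.k0) / x.g) ^ 2 * x.h * (x.Y i / s i) := by
    intro i
    have hi := hs i
    rw [Rk0_Y, hzb, hzk, hz, signFlip_Y (hx.q_ne' hs), signFlip_c (hx.q_ne' hs), signFlip_q,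
      Rtau_Y hs hx.h_ne hx.Y_ne, Rtau_c hs hx.h_ne hx.Y_ne, Rtau_q]
    field_simp
    ring
  rw [rhoInv_map, ← hz, Datum.gam, Rk0_a, Datum.g, Rk0_h (hx.b_ne' hs), hza, hzh, hzB, hzk, hzb,
    Datum.W]
  simp only [hY, Finset.sum_add_distrib, ← Finset.mul_sum, x.sum_q_div s]
  field_simp
  ring

end RhoInvReg

/-! ### The translations commute -/

/-- `R_τ ∘ R_{κ₀} ∘ R_τ`, the reflection `κ₀ ↦ 2 - κ₀`. -/
def reflTwo (s : Fin N → F) (x : Datum N F) : Datum N F :=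
  (Rtau s).map ((Rk0 s).map ((Rtau s).map x))

/-- The numerator of `q_i` after `reflTwo`. -/
def Datum.U (x : Datum N F) (i : Fin N) : F :=
  x.q i * x.g ^ 2 + (1 - x.k0) * x.c i * x.g + (1 - x.k0) ^ 2 * x.Y i

/-- The denominator of `q_i` after `reflTwo`. -/
def Datum.V (x : Datum N F) : F :=
  x.g ^ 2 + (1 - x.k0) * x.B * x.g + (1 - x.k0) ^ 2 * x.h

/-- `U` is the homogenized polynomial q_i X² + c_i X + Y_i at (g, 1 - κ₀). `Rk1` translates X by λ =
κ₁/a, and g moves by λ(1 - κ₀), which compensates. The same holds for `V` with X² + B X + h. -/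
lemma U_Rk1 (ha : x.a ≠ 0) (i : Fin N) : (Rk1.map x).U i = x.U i := by
  simp only [Datum.U, Rk1_g ha, Rk1_c, Rk1_Y, Rk1_q, Rk1_k0]; ring

lemma V_Rk1 (ha : x.a ≠ 0) : (Rk1.map x).V = x.V := by
  simp only [Datum.V, Rk1_g ha, Rk1_B ha, Rk1_h ha, Rk1_k0]; ring

/-- `reflTwo` is defined at `x`. -/
structure ReflReg (s : Fin N → F) (x : Datum N F) : Prop extends RhoInvReg x where
  h_ne₂ : ((Rk0 s).map ((Rtau s).map x)).h ≠ 0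
  Y_ne₂ : ∀ i, ((Rk0 s).map ((Rtau s).map x)).Y i ≠ 0

namespace ReflReg

variable (hs : ∀ i, s i ≠ 0) (hx : ReflReg s x)
include hs hx

lemma h_eq : ((Rk0 s).map ((Rtau s).map x)).h = x.h / x.g ^ 2 * x.V := by
  have hg := hx.g_ne
  have hh := hx.h_ne
  have hb : ((Rtau s).map x).b s ≠ 0 := hx.b_ne' hs
  rw [Rk0_h hb, Rtau_h hs hx.h_ne hx.Y_ne, Rtau_B hs hx.h_ne hx.Y_ne, Rtau_b hs hx.h_ne hx.Y_ne,
    Rtau_k0, Datum.V]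
  field_simp
  ring

lemma Y_eq (i : Fin N) :
    ((Rk0 s).map ((Rtau s).map x)).Y i = x.h / (s i * x.g ^ 2) * x.U i := by
  have hg := hx.g_ne
  have hh := hx.h_ne
  have hi := hs i
  rw [Rk0_Y, Rtau_Y hs hx.h_ne hx.Y_ne, Rtau_c hs hx.h_ne hx.Y_ne, Rtau_b hs hx.h_ne hx.Y_ne,
    Rtau_k0, Rtau_q, Datum.U]
  field_simp
  ring

lemma V_ne : x.V ≠ 0 := by
  have := hx.h_ne₂
  rw [hx.h_eq hs] at this
  exact (mul_ne_zero_iff.1 this).2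

lemma q_reflTwo (i : Fin N) : (reflTwo s x).q i = x.U i / x.V := by
  have hg := hx.g_ne
  have hh := hx.h_ne
  have hi := hs i
  have hV := hx.V_ne hs
  rw [reflTwo, Rtau_q, hx.h_eq hs, hx.Y_eq hs]
  field_simp

lemma q_reflTwo_ne (i : Fin N) : (reflTwo s x).q i ≠ 0 := Rtau_q_ne hs hx.h_ne₂ hx.Y_ne₂ i

lemma e_reflTwo (i : Fin N) : (reflTwo s x).e i = x.e i + (1 - x.k0) * x.Y i / x.g := by
  have hg := hx.g_ne
  have hh := hx.h_ne
  have hi := hs i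
  rw [reflTwo, Rtau_e hs hx.h_ne₂ hx.Y_ne₂, Rk0_e, Rtau_e hs hx.h_ne hx.Y_ne,
    Rtau_b hs hx.h_ne hx.Y_ne, Rtau_q, Rtau_k0]
  field_simp
  ring

/-- ∑ U_i - V factors as a · g · g', where g' is the value of g after `Rk1`. -/
lemma a_reflTwo (ha : x.a ≠ 0) :
    (reflTwo s x).a = x.a * x.g * (Rk1.map x).g / x.V := by
  have hV := hx.V_ne hs
  have h : ∑ i, x.U i = (x.a + 1) * x.g ^ 2 + (1 - x.k0) * (∑ i, x.c i) * x.g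
      + (1 - x.k0) ^ 2 * (x.g + x.h) := by
    simp only [Datum.U, Finset.sum_add_distrib, ← Finset.mul_sum, ← Finset.sum_mul, x.sum_q,
      x.sum_Y]
  rw [Datum.a]
  simp only [hx.q_reflTwo hs, ← Finset.sum_div, h, x.sum_c, Rk1_g ha]
  rw [div_sub_one hV]
  congr 1
  rw [Datum.V]
  field_simp
  ring

/-- The new q_i = U_i/V are invariant under `Rk1`. For the e_i, the shift by κ₁ q_i / a must be
compared on both sides, which is where the factorization in `a_reflTwo` enters. -/
lemma reflTwo_Rk1 (ha : x.a ≠ 0) (hx' : ReflReg s (Rk1.map x)) :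
    reflTwo s (Rk1.map x) = Rk1.map (reflTwo s x) := by
  have hg := hx.g_ne
  have hg' := hx'.g_ne
  have hV := hx.V_ne hs
  refine Datum.ext_of_e (hx'.q_reflTwo_ne hs) (fun i => ?_) (fun i => ?_) rfl ?_ rfl
    (fun i => rfl)
  · rw [Rk1_q, hx.q_reflTwo hs, hx'.q_reflTwo hs, U_Rk1 ha, V_Rk1 ha]
  · have hk : (reflTwo s x).k1 = x.k1 := by simp [reflTwo]
    rw [Rk1_e, hx.e_reflTwo hs, hx'.e_reflTwo hs, hx.a_reflTwo hs ha, hx.q_reflTwo hs, hk,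
      Rk1_e, Rk1_Y, Rk1_k0, Datum.U]
    have hg2 := Rk1_g ha
    have : x.g + x.k1 / x.a * (1 - x.k0) ≠ 0 := by rwa [← hg2]
    rw [hg2]
    rw [show x.g + x.k1 / x.a * (1 - x.k0) = (x.a * x.g + x.k1 * (1 - x.k0)) / x.a by
      field_simp] at this ⊢
    have h3 := (div_ne_zero_iff.1 this).1
    field_simp
    ring
  · simp [reflTwo]

end ReflReg

/-- `signFlip` commutes with `Rtau` and `Rk0`, so its two occurrences in ρ² cancel. Commutation of
ρ² with `Rk1` is thereby reduced to that of `reflTwo`; it is what makes l and l̃ commute, since l̃ l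
= ρ² and l l̃ = R_{κ₁} ρ² R_{κ₁}. -/
lemma rho_rho (hs : ∀ i, s i ≠ 0) (hx : RhoReg s x) :
    (rho s).map ((rho s).map x) = reflTwo s ((Rk0 s).map x) := by
  rw [rho_map, rho_map, ← signFlip_Rtau hx.q_ne' hs hx.h_ne hx.Y_ne, signFlip_Rk0,
    signFlip_signFlip, reflTwo]

lemma reflReg_of_rho_rho (hs : ∀ i, s i ≠ 0) (hx : RhoReg s x) (hx' : RhoReg s ((rho s).map x)) :
    ReflReg s ((Rk0 s).map x) := by
  have hq : ∀ i, ((Rk0 s).map ((Rtau s).map ((Rk0 s).map x))).q i ≠ 0 := fun i =>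
    Rtau_q_ne hs hx.h_ne hx.Y_ne i
  have e : (Rk0 s).map ((rho s).map x) =
      signFlip.map ((Rk0 s).map ((Rtau s).map ((Rk0 s).map x))) := by
    rw [rho_map, ← signFlip_Rtau hx.q_ne' hs hx.h_ne hx.Y_ne, signFlip_Rk0]
  have h1 := hx'.h_ne
  have h2 := hx'.Y_ne
  rw [e] at h1 h2
  rw [signFlip_h hq] at h1
  simp only [signFlip_Y hq] at h2
  have h3 : ((Rtau s).map ((Rk0 s).map x)).b s ≠ 0 := by
    have := hx'.b_ne
    rwa [rho_map, ← signFlip_Rtau hx.q_ne' hs hx.h_ne hx.Y_ne, signFlip_b] at this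
  rw [Rtau_b hs hx.h_ne hx.Y_ne] at h3
  exact ⟨⟨hx.q_ne', hx.h_ne, hx.Y_ne, (div_ne_zero_iff.1 h3).1⟩, h1, h2⟩

/-- `ρ²` commutes with `R_{κ₁}`. -/
lemma rho_rho_Rk1 (hs : ∀ i, s i ≠ 0) (ha : x.a ≠ 0) (hx : RhoReg s x)
    (hx₂ : RhoReg s ((rho s).map x)) (hx' : RhoReg s (Rk1.map x))
    (hx'₂ : RhoReg s ((rho s).map (Rk1.map x))) :
    (rho s).map ((rho s).map (Rk1.map x)) = Rk1.map ((rho s).map ((rho s).map x)) := by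
  have h1 := reflReg_of_rho_rho hs hx hx₂
  have h2 := reflReg_of_rho_rho hs hx' hx'₂
  rw [Rk0_Rk1] at h2
  rw [rho_rho hs hx, rho_rho hs hx', Rk0_Rk1, h1.reflTwo_Rk1 hs ha h2]

lemma rhoInv_rhoInv (hs : ∀ i, s i ≠ 0) (hx : ReflReg s x) :
    (rhoInv s).map ((rhoInv s).map x) = (Rk0 s).map (reflTwo s x) := by
  rw [rhoInv_map, rhoInv_map, ← signFlip_Rk0 ((Rtau s).map x),
    ← signFlip_Rtau (x := (Rk0 s).map ((Rtau s).map x)) (fun i => hx.q_ne' hs i) hs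
    hx.h_ne₂ hx.Y_ne₂, signFlip_signFlip, reflTwo]

lemma reflReg_of_rhoInv_rhoInv (hs : ∀ i, s i ≠ 0) (hx : RhoInvReg x)
    (hx' : RhoInvReg ((rhoInv s).map x)) : ReflReg s x := by
  have hq : ∀ i, ((Rk0 s).map ((Rtau s).map x)).q i ≠ 0 := hx.q_ne' hs
  have h1 := hx'.h_ne
  have h2 := hx'.Y_ne
  rw [rhoInv_map, ← signFlip_Rk0] at h1 h2
  rw [signFlip_h hq] at h1
  simp only [signFlip_Y hq] at h2
  exact ⟨hx, h1, h2⟩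

/-- `ρ⁻²` commutes with `R_{κ₁}`. -/
lemma rhoInv_rhoInv_Rk1 (hs : ∀ i, s i ≠ 0) (ha : x.a ≠ 0) (hx : RhoInvReg x)
    (hx₂ : RhoInvReg ((rhoInv s).map x)) (hx' : RhoInvReg (Rk1.map x))
    (hx'₂ : RhoInvReg ((rhoInv s).map (Rk1.map x))) :
    (rhoInv s).map ((rhoInv s).map (Rk1.map x)) =
      Rk1.map ((rhoInv s).map ((rhoInv s).map x)) := by
  have h1 := reflReg_of_rhoInv_rhoInv hs hx hx₂
  have h2 := reflReg_of_rhoInv_rhoInv hs hx' hx'₂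
  rw [rhoInv_rhoInv hs h1, rhoInv_rhoInv hs h2, h1.reflTwo_Rk1 hs ha h2, Rk0_Rk1]

end
end Garnier

/-! ### The variables t_i = √s_i, the seed solution and the brace. -/

namespace Garnier

noncomputable section

set_option linter.unusedSectionVars false

variable {N : ℕ} {F : Type} [Field F]

/-- `t_1, …, t_N` are independent variables with partial derivatives `δ_1, …, δ_N`, and
`t_i ≠ 0, ± 1`, `t_i ≠ ± t_j`. -/
structure RootVars (t : Fin N → F) (δ : Fin N → Derivation ℤ F F) : Prop where
  ne_zero : ∀ i, t i ≠ 0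
  add_one_ne : ∀ i, t i + 1 ≠ 0
  sub_one_ne : ∀ i, t i - 1 ≠ 0
  add_ne : ∀ i j, t i + t j ≠ 0
  sub_ne : ∀ i j, i ≠ j → t j - t i ≠ 0
  D_self : ∀ i, δ i (t i) = 1
  D_other : ∀ i j, i ≠ j → δ j (t i) = 0

/-- `s_i = t_i²`. -/
def sqVars (t : Fin N → F) (i : Fin N) : F := t i ^ 2

/-- `∂/∂s_i`. -/
def sqDer (t : Fin N → F) (δ : Fin N → Derivation ℤ F F) (i : Fin N) : Derivation ℤ F F :=
  (2 * t i)⁻¹ • δ i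

/-- The logarithmic derivative in `t_i` of the normalizing factor. -/
def normDlog (t : Fin N → F) (κ : F) (θ : Fin N → F) (m n : F) (i : Fin N) : F :=
  (θ i + m + n) * (θ i + m + n - 1) / 2 / t i
    + -(θ i * (∑ k, θ k + κ + 2 * m)) / 2 / (t i + 1)
    + -(θ i * (∑ k, θ k - κ + 2 * m)) / 2 / (t i - 1)
    + ∑ j ∈ Finset.univ.erase i, θ i * θ j / (t i + t j)

/-- `∑_i t_i (t_i² - 1) ∂/∂t_i log T`. -/
def innerSum (t : Fin N → F) (δ : Fin N → Derivation ℤ F F) (T : F) : F :=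
  ∑ i, t i * (t i ^ 2 - 1) * (δ i T / T)

/-- The brace of the Toda equations. -/
def brace (t : Fin N → F) (δ : Fin N → Derivation ℤ F F) (κ : F) (θ : Fin N → F) (T : F) : F :=
  (∑ i, (t i ^ 2 - 1) / t i * δ i (innerSum t δ T) - 2 * innerSum t δ T)
    + κ * ∑ i, θ i * ((t i ^ 2 + 1) / t i)
    - 1 / 2 * ∑ i, ∑ j, θ i * θ j * ((t i ^ 2 + t j ^ 2) / (t i * t j))
    - κ ^ 2

/-- The algebraic solution for `κ₀ = κ₁ = 1/2`. -/
def seedDatum (t : Fin N → F) (κ : F) (θ : Fin N → F) : Datum N F where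
  q i := θ i * t i / κ
  p i := κ / (2 * t i)
  k0 := 1 / 2
  k1 := 1 / 2
  kinf := κ
  th := θ

/-- `x` has the parameters of the solution with indices `m`, `n`. -/
structure HasParams (κ : F) (θ : Fin N → F) (m n : F) (x : Datum N F) : Prop where
  k0 : x.k0 = 1 / 2 + m + n
  k1 : x.k1 = 1 / 2 + m - n
  kinf : x.kinf = κ
  th : ∀ i, x.th i = θ i

variable [CharZero F] {t : Fin N → F} {δ : Fin N → Derivation ℤ F F} (ht : RootVars t δ)
variable {κ : F} {θ : Fin N → F}

lemma sqDer_apply (f : F) (i : Fin N) : sqDer t δ i f = δ i f / (2 * t i) := by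
  rw [sqDer, Derivation.smul_apply, smul_eq_mul]; ring

include ht

lemma RootVars.D_eq (f : F) (i : Fin N) : δ i f = 2 * t i * sqDer t δ i f := by
  have := ht.ne_zero i
  rw [sqDer_apply]; field_simp

lemma RootVars.D_t (i j : Fin N) : δ j (t i) = if i = j then 1 else 0 := by
  split_ifs with h
  · subst h; exact ht.D_self i
  · exact ht.D_other i j h

lemma RootVars.timeVars : TimeVars (sqVars t) (sqDer t δ) where
  ne_zero i := pow_ne_zero 2 (ht.ne_zero i)
  sub_one_ne i := by
    have : sqVars t i - 1 = (t i + 1) * (t i - 1) := by rw [sqVars]; ring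
    rw [this]
    exact mul_ne_zero (ht.add_one_ne i) (ht.sub_one_ne i)
  sub_ne i j h := by
    have : sqVars t j - sqVars t i = (t j + t i) * (t j - t i) := by simp only [sqVars]; ring
    rw [this]
    exact mul_ne_zero (ht.add_ne j i) (ht.sub_ne i j h)
  D_self i := by
    have := ht.ne_zero i
    rw [sqDer_apply, sqVars, sq, Derivation.leibniz, ht.D_self]
    simp only [smul_eq_mul]
    field_simp
    ring
  D_other i j h := by
    rw [sqDer_apply, sqVars, sq, Derivation.leibniz, ht.D_other i j h]
    simp

/-! ### The seed solution -/

section seed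

variable (hκ : κ ≠ 0) (hκD : ∀ j, δ j κ = 0) (hθD : ∀ j i, δ j (θ i) = 0)

include hκ

lemma seed_e (i : Fin N) : (seedDatum t κ θ).e i = θ i / 2 := by
  have := ht.ne_zero i
  simp only [Datum.e, seedDatum]; field_simp

lemma seed_c (i : Fin N) : (seedDatum t κ θ).c i = 0 := by
  rw [Datum.c, seed_e ht hκ]; simp only [seedDatum]; ring

lemma seed_Y (i : Fin N) : (seedDatum t κ θ).Y i = -(κ * θ i) / (4 * t i) := by
  have := ht.ne_zero i
  rw [Datum.Y, seed_e ht hκ]; simp only [seedDatum]; field_simp; ring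

lemma seed_A : (seedDatum t κ θ).alpha + (seedDatum t κ θ).qp = -κ / 2 := by
  simp only [Datum.qp_eq, seed_e ht hκ, Datum.alpha, ← Finset.sum_div]
  simp only [seedDatum]
  ring

lemma seed_B : (seedDatum t κ θ).B = 0 := by
  rw [Datum.B, seed_A ht hκ]; simp only [seedDatum]; ring

lemma seed_h : (seedDatum t κ θ).h = -κ ^ 2 / 4 := by
  rw [Datum.h, add_right_comm, seed_A ht hκ]; simp only [seedDatum]; ring

lemma D_half (j : Fin N) : δ j (1 / 2 : F) = 0 := by
  have h2 : δ j (2 : F) = 0 := by simpa using (δ j).map_natCast 2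
  rw [Derivation.leibniz_div, h2]; simp

lemma D_two (j : Fin N) : δ j (2 : F) = 0 := by simpa using (δ j).map_natCast 2

include hκD hθD

lemma D_seed_q (j i : Fin N) :
    δ j ((seedDatum t κ θ).q i) = if i = j then θ j / κ else 0 := by
  simp only [seedDatum, Derivation.leibniz_div, Derivation.leibniz, hκD, hθD, ht.D_t]
  split_ifs with h
  · subst h; simp; field_simp
  · simp

lemma D_seed_a (j : Fin N) : δ j (seedDatum t κ θ).a = θ j / κ := by
  simp [Datum.a, D_seed_q ht hκ hκD hθD]

lemma isSolution_seed : IsSolution (sqVars t) (sqDer t δ) (seedDatum t κ θ) where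
  D_k0 j := by simp only [sqDer_apply, seedDatum, D_half ht hκ, zero_div]
  D_k1 j := by simp only [sqDer_apply, seedDatum, D_half ht hκ, zero_div]
  D_kinf j := by simp only [sqDer_apply, seedDatum, hκD, zero_div]
  D_th j i := by simp only [sqDer_apply, seedDatum, hθD, zero_div]
  D_e_mul j i := by
    have hi := ht.ne_zero i
    have hj := ht.ne_zero j
    rw [seed_e ht hκ, sqDer_apply, Derivation.leibniz_div, hθD, D_two ht hκ, seed_Y ht hκ,
      seed_Y ht hκ]
    simp only [seedDatum, sqVars, smul_eq_mul]
    field_simp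
    ring
  D_qp_mul j := by
    have hj := ht.ne_zero j
    have : sqDer t δ j (seedDatum t κ θ).qp = 0 := by
      simp [Datum.qp_eq, seed_e ht hκ, sqDer_apply, Derivation.leibniz_div, hθD, D_two ht hκ]
    rw [this, seed_Y ht hκ, seed_h ht hκ]
    simp only [seedDatum, sqVars]
    field_simp
    ring
  D_q_mul j i := by
    rw [seed_B ht hκ, seed_c ht hκ, seed_c ht hκ, sqDer_apply, D_seed_q ht hκ hκD hθD]
    split_ifs with h
    · subst h; simp
    · simp
  D_a_mul j := by
    have hj := ht.ne_zero j
    rw [seed_B ht hκ, seed_c ht hκ, sqDer_apply, D_seed_a ht hκ hκD hθD]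
    simp only [seedDatum, sqVars]
    field_simp
    ring

omit hκD hθD

/-- The seed solution has the τ-function `1`, up to the normalizing factor. -/
lemma seed_ham (i : Fin N) :
    2 * t i * ham (sqVars t) (seedDatum t κ θ) i + normDlog t κ θ 0 0 i = 0 := by
  have hi := ht.ne_zero i
  have hi1 := ht.add_one_ne i
  have hi2 := ht.sub_one_ne i
  have key : ∀ k ∈ Finset.univ.erase i, hamPair (sqVars t) (seedDatum t κ θ) i k =
      -(t i ^ 2 * θ i / 2) * θ k + t i * (t i ^ 2 - 1) / 2 * (θ i * θ k / (t i + t k)) := by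
    intro k hk
    have hne := (Finset.ne_of_mem_erase hk)
    have hk := ht.ne_zero k
    have h1 := ht.sub_ne k i hne
    have h2 := ht.add_ne i k
    have e1 : t i ^ 2 - t k ^ 2 = (t i - t k) * (t i + t k) := by ring
    have e2 : t k ^ 2 - t i ^ 2 = -((t i - t k) * (t i + t k)) := by ring
    simp only [hamPair, Rcoef, Scoef, seed_Y ht hκ, seed_c ht hκ]
    simp only [seedDatum, sqVars]
    rw [e1, e2]
    field_simp
    ring
  have hs1 : sqVars t i - 1 = (t i + 1) * (t i - 1) := by rw [sqVars]; ring
  rw [ham_eq, hamNum, Finset.sum_congr rfl key, Finset.sum_add_distrib, ← Finset.mul_sum,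
    ← Finset.mul_sum, sum_erase_eq, normDlog, seed_e ht hκ, seed_h ht hκ, seed_Y ht hκ, hs1]
  simp only [seedDatum]
  generalize ∑ k ∈ Finset.univ.erase i, θ i * θ k / (t i + t k) = S
  generalize ∑ k, θ k = Θ
  simp only [sqVars]
  field_simp
  ring

end seed

/-! ### The brace of the Toda equations -/

section toda

variable {m n : F} {x : Datum N F} {T : F}
  (hκD : ∀ j, δ j κ = 0) (hθD : ∀ j i, δ j (θ i) = 0)
  (hm : ∀ j, δ j m = 0) (hn : ∀ j, δ j n = 0)
  (hx : IsSolution (sqVars t) (sqDer t δ) x) (hp : HasParams κ θ m n x) (hq : ∀ i, x.q i ≠ 0)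
  (hT : ∀ i, δ i T / T = 2 * t i * ham (sqVars t) x i + normDlog t κ θ m n i)

lemma sum_normDlog : ∑ i, t i * (t i ^ 2 - 1) * normDlog t κ θ m n i =
    ∑ i, (t i ^ 2 - 1) * ((θ i + m + n) * (θ i + m + n - 1) / 2 - θ i ^ 2 / 2)
      - 2 * m * ∑ i, θ i * t i ^ 2 + κ * ∑ i, θ i * t i - (∑ i, θ i * t i) ^ 2 / 2
      - (∑ i, θ i) ^ 2 / 2 := by
  have h1 : ∀ i, t i * (t i ^ 2 - 1) * normDlog t κ θ m n i =
      (t i ^ 2 - 1) * ((θ i + m + n) * (θ i + m + n - 1) / 2)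
      - (∑ k, θ k + 2 * m) * (θ i * t i ^ 2) + κ * (θ i * t i)
      + ∑ j ∈ Finset.univ.erase i, θ i * θ j * (t i * (t i ^ 2 - 1) / (t i + t j)) := by
    intro i
    have hi := ht.ne_zero i
    have hi1 := ht.add_one_ne i
    have hi2 := ht.sub_one_ne i
    have e : ∑ j ∈ Finset.univ.erase i, θ i * θ j * (t i * (t i ^ 2 - 1) / (t i + t j)) =
        t i * (t i ^ 2 - 1) * ∑ j ∈ Finset.univ.erase i, θ i * θ j / (t i + t j) := by
      rw [Finset.mul_sum]
      exact Finset.sum_congr rfl fun j _ => by ring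
    rw [e, normDlog]
    field_simp
    ring
  have hswap : ∀ f : Fin N → Fin N → F, ∑ i, ∑ k ∈ Finset.univ.erase i, f i k =
      ∑ i, ∑ k ∈ Finset.univ.erase i, f k i := by
    intro f
    refine Finset.sum_comm' fun i k => ?_
    simp [eq_comm]
  -- Averaging over the exchange of i and j removes the denominator, as t_i³ + t_j³ - t_i - t_j is
  -- divisible by t_i + t_j.
  have h2 : ∑ i, ∑ j ∈ Finset.univ.erase i, θ i * θ j * (t i * (t i ^ 2 - 1) / (t i + t j)) =
      ∑ i, ∑ j ∈ Finset.univ.erase i,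
        θ i * θ j * ((t i ^ 2 + t j ^ 2 - t i * t j - 1) / 2) := by
    have h3 : ∀ S S' R : F, S = S' → S + S' = 2 * R → S = R := by
      intro S S' R h h'
      have : 2 * S = 2 * R := by rw [← h', ← h]; ring
      exact mul_left_cancel₀ two_ne_zero this
    refine h3 _ _ _ (hswap _) ?_
    rw [Finset.mul_sum, ← Finset.sum_add_distrib]
    refine Finset.sum_congr rfl fun i _ => ?_
    rw [Finset.mul_sum, ← Finset.sum_add_distrib]
    refine Finset.sum_congr rfl fun j _ => ?_
    have e1 := ht.add_ne i j
    rw [add_comm (t j) (t i)]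
    field_simp
    ring
  have h4 : ∑ i, ∑ j ∈ Finset.univ.erase i,
        θ i * θ j * ((t i ^ 2 + t j ^ 2 - t i * t j - 1) / 2) =
      (∑ i, θ i) * (∑ i, θ i * t i ^ 2) - (∑ i, θ i * t i) ^ 2 / 2 - (∑ i, θ i) ^ 2 / 2
        - ∑ i, (t i ^ 2 - 1) * (θ i ^ 2 / 2) := by
    have h5 : ∀ i, ∑ j ∈ Finset.univ.erase i,
        θ i * θ j * ((t i ^ 2 + t j ^ 2 - t i * t j - 1) / 2) =
        θ i * t i ^ 2 / 2 * ∑ j, θ j + θ i / 2 * ∑ j, θ j * t j ^ 2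
          - θ i * t i / 2 * ∑ j, θ j * t j - θ i / 2 * ∑ j, θ j
          - (t i ^ 2 - 1) * (θ i ^ 2 / 2) := by
      intro i
      rw [sum_erase_eq]
      simp only [Finset.mul_sum, ← Finset.sum_sub_distrib, ← Finset.sum_add_distrib]
      congr 1
      · exact Finset.sum_congr rfl fun j _ => by ring
      · ring
    simp only [h5, Finset.sum_sub_distrib, Finset.sum_add_distrib, ← Finset.sum_mul,
      ← Finset.sum_div]
    ring
  have h6 : ∑ i, (t i ^ 2 - 1) * ((θ i + m + n) * (θ i + m + n - 1) / 2 - θ i ^ 2 / 2) =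
      ∑ i, (t i ^ 2 - 1) * ((θ i + m + n) * (θ i + m + n - 1) / 2)
        - ∑ i, (t i ^ 2 - 1) * (θ i ^ 2 / 2) := by
    rw [← Finset.sum_sub_distrib]
    exact Finset.sum_congr rfl fun i _ => by ring
  rw [Finset.sum_congr rfl fun i _ => h1 i, Finset.sum_add_distrib, Finset.sum_add_distrib,
    Finset.sum_sub_distrib, h2, h4, h6, ← Finset.mul_sum, ← Finset.mul_sum]
  ring

include hT in
lemma innerSum_eq : innerSum t δ T = 2 * ∑ i, hamNum (sqVars t) x i
    + (∑ i, (t i ^ 2 - 1) * ((θ i + m + n) * (θ i + m + n - 1) / 2 - θ i ^ 2 / 2)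
      - 2 * m * ∑ i, θ i * t i ^ 2 + κ * ∑ i, θ i * t i - (∑ i, θ i * t i) ^ 2 / 2
      - (∑ i, θ i) ^ 2 / 2) := by
  rw [innerSum, ← sum_normDlog ht, Finset.mul_sum, ← Finset.sum_add_distrib]
  refine Finset.sum_congr rfl fun i _ => ?_
  have hi := ht.ne_zero i
  have hi1 := ht.timeVars.sub_one_ne i
  rw [hT, ham_eq]
  simp only [sqVars] at *
  field_simp

include hκD hθD hm hn hx hp hq hT

/-- In the s-variables the outer operator is 2∑(s_j - 1)∂/∂s_j - 2, and the inner one gives 2∑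
s_i(s_i-1)H_i plus a polynomial. By `sum_D_sum_hamNum` the Hamiltonian part is 4 a g - 4α(α + κ_∞),
with 4α(α + κ_∞) = (2m + ∑θ_i)² - κ_∞². The polynomial part cancels the explicit terms of the brace.
-/
lemma brace_eq : brace t δ κ θ T + (2 * m) ^ 2 = x.gam := by
  set H := ∑ i, hamNum (sqVars t) x i with hH
  have hI := innerSum_eq ht hT
  have h2 : ∀ j, δ j (2 : F) = 0 := fun j => by simpa using (δ j).map_natCast 2
  have hD : ∀ j, (t j ^ 2 - 1) / t j * δ j (innerSum t δ T) =
      4 * ((sqVars t j - 1) * sqDer t δ j H)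
      + (2 * ((t j ^ 2 - 1) * ((θ j + m + n) * (θ j + m + n - 1) / 2 - θ j ^ 2 / 2))
        - 4 * m * (θ j * t j ^ 2) + 4 * m * θ j
        + (κ - ∑ i, θ i * t i) * (θ j * t j - θ j / t j)) := by
    intro j
    have hj := ht.ne_zero j
    have d1 : δ j (∑ i, (t i ^ 2 - 1) *
        ((θ i + m + n) * (θ i + m + n - 1) / 2 - θ i ^ 2 / 2)) =
        2 * t j * ((θ j + m + n) * (θ j + m + n - 1) / 2 - θ j ^ 2 / 2) := by
      have : ∀ i, δ j ((t i ^ 2 - 1) *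
          ((θ i + m + n) * (θ i + m + n - 1) / 2 - θ i ^ 2 / 2)) = if i = j then
          2 * t j * ((θ j + m + n) * (θ j + m + n - 1) / 2 - θ j ^ 2 / 2) else 0 := by
        intro i
        simp only [sq, Derivation.leibniz, Derivation.leibniz_div, map_sub, map_add, hθD, hm, hn,
          h2, ht.D_t]
        split_ifs with h
        · subst h; simp; ring
        · simp
      simp [map_sum, this]
    have d2 : δ j (∑ i, θ i * t i ^ 2) = 2 * t j * θ j := by
      have : ∀ i, δ j (θ i * t i ^ 2) = if i = j then 2 * t j * θ j else 0 := by
        intro i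
        simp only [sq, Derivation.leibniz, hθD, ht.D_t]
        split_ifs with h
        · subst h; simp; ring
        · simp
      simp [map_sum, this]
    have d3 : δ j (∑ i, θ i * t i) = θ j := by
      simp [map_sum, Derivation.leibniz, hθD, ht.D_t]
    have d4 : δ j (∑ i, θ i) = 0 := by simp [map_sum, hθD]
    rw [hI, ← hH]
    simp only [map_add, map_sub, sq (∑ i, θ i * t i), sq (∑ i, θ i), Derivation.leibniz_div,
      Derivation.leibniz, h2, hm, hκD, d1, d2, d3, d4, smul_eq_mul, sqDer_apply, sqVars]
    field_simp
    ring
  have hs := hx.sum_D_sum_hamNum ht.timeVars hq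
  rw [← hH] at hs
  have hPQ : ∑ i, ∑ j, θ i * θ j * ((t i ^ 2 + t j ^ 2) / (t i * t j)) =
      2 * ((∑ i, θ i * t i) * ∑ i, θ i / t i) := by
    have : ∀ i j, θ i * θ j * ((t i ^ 2 + t j ^ 2) / (t i * t j)) =
        θ i * t i * (θ j / t j) + θ i / t i * (θ j * t j) := by
      intro i j
      have hi := ht.ne_zero i
      have hj := ht.ne_zero j
      field_simp
    simp only [this, Finset.sum_add_distrib, ← Finset.mul_sum, ← Finset.sum_mul]
    ring
  have hP : ∑ i, θ i * ((t i ^ 2 + 1) / t i) = ∑ i, θ i * t i + ∑ i, θ i / t i := by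
    rw [← Finset.sum_add_distrib]
    refine Finset.sum_congr rfl fun i _ => ?_
    have hi := ht.ne_zero i
    field_simp
  have hα : x.alpha = -(2 * m + κ + ∑ i, θ i) / 2 := by
    rw [Datum.alpha, hp.k0, hp.k1, hp.kinf, Finset.sum_congr rfl fun i _ => hp.th i]; ring
  rw [brace, hPQ, hP, Finset.sum_congr rfl fun j _ => hD j, hI, ← hH, Datum.gam]
  simp only [Finset.sum_add_distrib, Finset.sum_sub_distrib, ← Finset.mul_sum]
  rw [hα, hp.kinf] at hs
  linear_combination 4 * hs

lemma brace_eq' (ha : x.a ≠ 0) :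
    brace t δ κ θ T + (2 * n - 1) ^ 2 = (Rk1.map x).gam := by
  have h := brace_eq ht hκD hθD hm hn hx hp hq hT
  -- The correction 4κ₁(1 - κ₀) equals (2n - 1)² - (2m)², the difference of the two constants in the
  -- braces.
  have e : (Rk1.map x).gam = x.gam + 4 * (x.k1 * (1 - x.k0)) := by
    rw [Datum.gam, Rk1_a, Rk1_g ha, Datum.gam]; field_simp
  rw [e, ← h, hp.k0, hp.k1]
  ring

end toda

end
end Garnier

/-! ### Second differences of logarithmic derivatives, and the four initial τ-functions. -/

namespace Garnier

noncomputable section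

set_option linter.unusedSectionVars false

variable {N : ℕ} {F : Type} [Field F]

/-! ### Logarithmic derivatives -/

section logder

variable (d : Derivation ℤ F F) {f g : F}

lemma logder_mul (hf : f ≠ 0) (hg : g ≠ 0) : d (f * g) / (f * g) = d f / f + d g / g := by
  rw [Derivation.leibniz]
  simp only [smul_eq_mul]
  field_simp
  ring

lemma logder_prod {ι : Type*} (S : Finset ι) (f : ι → F) (hf : ∀ i ∈ S, f i ≠ 0) :
    d (∏ i ∈ S, f i) / ∏ i ∈ S, f i = ∑ i ∈ S, d (f i) / f i := by
  classical
  induction S using Finset.induction_on with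
  | empty => simp
  | insert i S hi ih =>
    rw [Finset.prod_insert hi, Finset.sum_insert hi,
      logder_mul d (hf i (Finset.mem_insert_self i S))
        (Finset.prod_ne_zero_iff.2 fun j hj => hf j (Finset.mem_insert_of_mem hj)),
      ih fun j hj => hf j (Finset.mem_insert_of_mem hj)]

lemma logder_toda {T T₁ T₂ G : F} (hG : G ≠ 0) (hT : T ≠ 0) (hT₁ : T₁ ≠ 0) (hT₂ : T₂ ≠ 0)
    (h : T₂ * T₁ = G * T ^ 2) : d T₂ / T₂ + d T₁ / T₁ = d G / G + 2 * (d T / T) := by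
  rw [← logder_mul d hT₂ hT₁, h, logder_mul d hG (pow_ne_zero 2 hT), sq, logder_mul d hT hT]
  ring

end logder

variable [CharZero F]

/-! ### Second differences of the Hamiltonians -/

section shift

variable {s : Fin N → F} {D : Fin N → Derivation ℤ F F} (ht : TimeVars s D) {x : Datum N F}
include ht

/-- The terms q_j B in the derivatives of a and g cancel, and the rest is divisible by s_j - 1. The
simple outcome matches the changes of the Hamiltonians under ρ and ρ⁻¹. -/
lemma logder_gam (hx : IsSolution s D x) (ha : x.a ≠ 0) (hi : RhoInvReg x) (j : Fin N) :
    D j x.gam / x.gam =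
      -(x.c j - x.k1 / x.a * x.q j + (1 - x.k0) * x.Y j / x.g) / s j := by
  have hj := ht.ne_zero j
  have hj1 := ht.sub_one_ne j
  have hg := hi.g_ne
  have h4 : D j (4 : F) = 0 := by simpa using (D j).map_natCast 4
  rw [Datum.gam, logder_mul _ (by norm_num) (mul_ne_zero ha hg), logder_mul _ ha hg, h4,
    hx.D_a ht, hx.D_g ht hi.q_ne hi.h_ne hi.Y_ne]
  field_simp
  ring

lemma hamNum_transLt (ha : x.a ≠ 0) (hr : RhoReg s (Rk1.map x)) (i : Fin N) :
    hamNum s ((rho s).map (Rk1.map x)) i =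
      hamNum s x i - (s i - 1) * (x.e i - x.k1 / x.a * x.q i) + s i * x.th i := by
  rw [hr.hamNum_rho ht.ne_zero ht, hamNum_Rk1 ht ha, Rk1_e, Rk1_th, Rk1_k1]
  ring

lemma hamNum_transL (hr : RhoReg s x) (ha : ((rho s).map x).a ≠ 0) (i : Fin N) :
    hamNum s (Rk1.map ((rho s).map x)) i = hamNum s x i - (s i - 1) * x.e i := by
  have h1 : ((rho s).map x).k1 = 1 - x.k1 := rfl
  have h2 : ((rho s).map x).th i = x.th i := neg_neg _
  rw [hamNum_Rk1 ht ha, hr.hamNum_rho ht.ne_zero ht, h1, h2]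
  ring

lemma logder_gam_transLt (hx : IsSolution s D x) (ha : x.a ≠ 0) (hr : RhoReg s (Rk1.map x))
    (hi : RhoInvReg x) (ha' : ((rhoInv s).map x).a ≠ 0) (j : Fin N) :
    D j x.gam / x.gam = ham s ((rho s).map (Rk1.map x)) j
      + ham s (Rk1.map ((rhoInv s).map x)) j - 2 * ham s x j := by
  have hj := ht.ne_zero j
  have hj1 := ht.sub_one_ne j
  have hg := hi.g_ne
  have h1 : ((rhoInv s).map x).k1 = 1 - x.k1 := rfl
  have h2 : ((rhoInv s).map x).th j = x.th j := neg_neg _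
  rw [logder_gam ht hx ha hi, ham_eq, ham_eq, ham_eq, hamNum_transLt ht ha hr,
    hamNum_Rk1 ht ha', hi.hamNum_rhoInv ht.ne_zero ht, h1, h2, Datum.c]
  field_simp
  ring

lemma logder_gam_transL (hx : IsSolution s D x) (ha : x.a ≠ 0) (hr : RhoReg s x)
    (ha' : ((rho s).map x).a ≠ 0) (hi : RhoInvReg (Rk1.map x)) (j : Fin N) :
    D j (Rk1.map x).gam / (Rk1.map x).gam = ham s (Rk1.map ((rho s).map x)) j
      + ham s ((rhoInv s).map (Rk1.map x)) j - 2 * ham s x j := by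
  have hj := ht.ne_zero j
  have hj1 := ht.sub_one_ne j
  have hg := hi.g_ne
  rw [logder_gam ht (hx.map_Rk1 ht ha) ha hi, ham_eq, ham_eq, ham_eq,
    hamNum_transL ht hr ha', hi.hamNum_rhoInv ht.ne_zero ht, hamNum_Rk1 ht ha, Rk1_c, Rk1_e,
    Rk1_a, Rk1_th, Rk1_k1, Rk1_k0, Rk1_q, Datum.c]
  generalize (Rk1.map x).Y j = Y'
  generalize (Rk1.map x).g = g' at *
  field_simp
  ring

end shift

/-! ### Normalized τ-functions -/

/-- `∂/∂t_i log T = 2 t_i H_i + ∂/∂t_i log (normalizing factor)`. -/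
def IsTauDlog (t : Fin N → F) (δ : Fin N → Derivation ℤ F F) (κ : F) (θ : Fin N → F) (m n : F)
    (x : Datum N F) (T : F) : Prop :=
  ∀ i, δ i T / T = 2 * t i * ham (sqVars t) x i + normDlog t κ θ m n i

section base

variable {t : Fin N → F} {δ : Fin N → Derivation ℤ F F} (ht : RootVars t δ)
variable {κ : F} {θ : Fin N → F} (hκ : κ ≠ 0)
  (hκD : ∀ j, δ j κ = 0) (hθD : ∀ j i, δ j (θ i) = 0)
include ht

lemma logder_prod_t (i : Fin N) : δ i (∏ j, t j) / ∏ j, t j = 1 / t i := by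
  rw [logder_prod _ _ _ fun j _ => ht.ne_zero j]
  have : ∀ j, δ i (t j) / t j = if j = i then 1 / t i else 0 := by
    intro j
    rw [ht.D_t]
    split_ifs with h
    · rw [h]
    · simp
  simp [this]

omit ht in
-- Only the exponent of t_i is not linear in (m, n). It is a quadratic polynomial in m + n with
-- second difference 1, which is the origin of ∏ t_i in the Toda equations.
lemma normDlog_second_diff (m n m' n' : F) (h : m' + n' = 1) (i : Fin N) :
    normDlog t κ θ (m + m') (n + n') i + normDlog t κ θ (m - m') (n - n') i
      - 2 * normDlog t κ θ m n i = 1 / t i := by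
  obtain rfl : n' = 1 - m' := by rw [← h]; ring
  simp only [normDlog]
  ring

include hκ

lemma isTauDlog_seed : IsTauDlog t δ κ θ 0 0 (seedDatum t κ θ) 1 := by
  intro i
  rw [seed_ham ht hκ]
  simp

/-- Subtracting the identity for the seed removes all pair sums, so each initial case needs only the
change of `hamNum` relative to the seed. -/
lemma ham_add_normDlog (x : Datum N F) (m n : F) (i : Fin N) :
    2 * t i * ham (sqVars t) x i + normDlog t κ θ m n i =
      2 * (hamNum (sqVars t) x i - hamNum (sqVars t) (seedDatum t κ θ) i) /
        (t i * (t i ^ 2 - 1)) + (normDlog t κ θ m n i - normDlog t κ θ 0 0 i) := by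
  have h := seed_ham ht hκ (θ := θ) i
  have hi := ht.ne_zero i
  have hi1 : t i ^ 2 - 1 ≠ 0 := ht.timeVars.sub_one_ne i
  rw [ham_eq] at h ⊢
  simp only [sqVars] at h ⊢
  have e : ∀ A : F, 2 * A / (t i * (t i ^ 2 - 1)) = 2 * t i * (A / (t i ^ 2 * (t i ^ 2 - 1))) := by
    intro A; field_simp
  rw [e, sub_div]
  linear_combination h

lemma isTauDlog_transL_seed (hr : RhoReg (sqVars t) (seedDatum t κ θ))
    (ha : ((rho (sqVars t)).map (seedDatum t κ θ)).a ≠ 0) :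
    IsTauDlog t δ κ θ 0 1 (Rk1.map ((rho (sqVars t)).map (seedDatum t κ θ))) 1 := by
  intro i
  have hi := ht.ne_zero i
  have hi1 : t i ^ 2 - 1 ≠ 0 := ht.timeVars.sub_one_ne i
  have hL : normDlog t κ θ 0 1 i - normDlog t κ θ 0 0 i = θ i / t i := by
    simp only [normDlog]; ring
  rw [ham_add_normDlog ht hκ, hamNum_transL ht.timeVars hr ha, seed_e ht hκ, hL,
    Derivation.map_one_eq_zero]
  simp only [sqVars]
  field_simp
  ring

include hκD hθD

lemma isTauDlog_transLt_seed (ha : (seedDatum t κ θ).a ≠ 0)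
    (hr : RhoReg (sqVars t) (Rk1.map (seedDatum t κ θ))) :
    IsTauDlog t δ κ θ 1 0 ((rho (sqVars t)).map (Rk1.map (seedDatum t κ θ)))
      (κ * (seedDatum t κ θ).a) := by
  intro i
  have hi := ht.ne_zero i
  have hi1 : t i ^ 2 - 1 ≠ 0 := ht.timeVars.sub_one_ne i
  have hi2 := ht.add_one_ne i
  have hi3 := ht.sub_one_ne i
  have hL : normDlog t κ θ 1 0 i - normDlog t κ θ 0 0 i =
      θ i / t i - 2 * t i * θ i / (t i ^ 2 - 1) := by
    have : t i ^ 2 - 1 = (t i + 1) * (t i - 1) := by ring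
    rw [this]
    simp only [normDlog]
    generalize ∑ j ∈ Finset.univ.erase i, θ i * θ j / (t i + t j) = S
    field_simp
    ring
  rw [ham_add_normDlog ht hκ, hamNum_transLt ht.timeVars ha hr, seed_e ht hκ, hL,
    logder_mul _ hκ ha, hκD, D_seed_a ht hκ hκD hθD]
  have h1 : (seedDatum t κ θ).k1 = 1 / 2 := rfl
  have h2 : (seedDatum t κ θ).q i = θ i * t i / κ := rfl
  have h3 : (seedDatum t κ θ).th i = θ i := rfl
  rw [h1, h2, h3]
  simp only [sqVars]
  field_simp
  ring

lemma isTauDlog_transLt_transL_seed (hr : RhoReg (sqVars t) (seedDatum t κ θ))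
    (hr' : RhoReg (sqVars t) ((rho (sqVars t)).map (seedDatum t κ θ))) :
    IsTauDlog t δ κ θ 1 1 ((rho (sqVars t)).map ((rho (sqVars t)).map (seedDatum t κ θ)))
      ((∏ j, t j) * (-κ * (seedDatum t κ θ).b (sqVars t))) := by
  intro i
  have hi := ht.ne_zero i
  have hi1 : t i ^ 2 - 1 ≠ 0 := ht.timeVars.sub_one_ne i
  have hi2 := ht.add_one_ne i
  have hi3 := ht.sub_one_ne i
  have hb := hr.b_ne
  have hL : normDlog t κ θ 1 1 i - normDlog t κ θ 0 0 i =
      (2 * θ i + 1) / t i - 2 * t i * θ i / (t i ^ 2 - 1) := by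
    have : t i ^ 2 - 1 = (t i + 1) * (t i - 1) := by ring
    rw [this]
    simp only [normDlog]
    generalize ∑ j ∈ Finset.univ.erase i, θ i * θ j / (t i + t j) = S
    field_simp
    ring
  have hDb : δ i ((seedDatum t κ θ).b (sqVars t)) = -(θ i / (κ * t i ^ 2)) := by
    have h := (isSolution_seed ht hκ hκD hθD).D_b ht.timeVars i
    have h1 : (seedDatum t κ θ).k0 = 1 / 2 := rfl
    have h2 : (seedDatum t κ θ).q i = θ i * t i / κ := rfl
    rw [ht.D_eq, h, seed_B ht hκ, seed_c ht hκ, h1, h2]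
    simp only [sqVars]
    field_simp
    ring
  have he : ((rho (sqVars t)).map (seedDatum t κ θ)).e i =
      θ i / 2 + θ i / (2 * κ * t i * (seedDatum t κ θ).b (sqVars t)) := by
    have h1 : (seedDatum t κ θ).k0 = 1 / 2 := rfl
    have h2 : (seedDatum t κ θ).q i = θ i * t i / κ := rfl
    have h3 : (seedDatum t κ θ).th i = θ i := rfl
    rw [rho_map, Rtau_e ht.timeVars.ne_zero hr.h_ne' hr.Y_ne', signFlip_e hr.q_ne', Rk0_e,
      seed_e ht hκ, Rk0_th, h1, h2, h3]
    simp only [sqVars]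
    field_simp
    ring
  have hth : ((rho (sqVars t)).map (seedDatum t κ θ)).th i = θ i := neg_neg _
  have hk : ((rho (sqVars t)).map (seedDatum t κ θ)).k1 = 1 - 1 / 2 := rfl
  have hk' : (seedDatum t κ θ).k1 = 1 / 2 := rfl
  have hth' : (seedDatum t κ θ).th i = θ i := rfl
  rw [ham_add_normDlog ht hκ, hr'.hamNum_rho ht.timeVars.ne_zero ht.timeVars,
    hr.hamNum_rho ht.timeVars.ne_zero ht.timeVars, he, seed_e ht hκ, hL, hth, hk, hk', hth',
    logder_mul _ (Finset.prod_ne_zero_iff.2 fun j _ => ht.ne_zero j)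
      (mul_ne_zero (neg_ne_zero.2 hκ) hb), logder_prod_t ht,
    logder_mul _ (neg_ne_zero.2 hκ) hb, map_neg, hκD, hDb]
  simp only [sqVars] at *
  field_simp
  ring

end base

end
end Garnier

/-! ### Two-sided recursions, the orbit of the seed, existence and uniqueness of the array. -/

namespace Garnier

noncomputable section

set_option linter.unusedSectionVars false

/-! ### Two-sided recursions on the integers -/

lemma int_two_step_induction {Q : ℤ → Prop} (h0 : Q 0) (h1 : Q 1)
    (hup : ∀ n, Q (n - 1) → Q n → Q (n + 1)) (hdown : ∀ n, Q n → Q (n + 1) → Q (n - 1)) (n : ℤ) :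
    Q n := by
  suffices h : ∀ n, Q n ∧ Q (n + 1) from (h n).1
  intro n
  induction n using Int.induction_on with
  | zero => exact ⟨h0, h1⟩
  | succ k ih =>
    refine ⟨ih.2, hup _ ?_ ih.2⟩
    rw [add_sub_cancel_right]
    exact ih.1
  | pred k ih =>
    refine ⟨hdown _ ih.1 ih.2, ?_⟩
    rw [sub_add_cancel]
    exact ih.1

/-- The step `(n, u_n, u_{n+1}) ↦ (n + 1, u_{n+1}, u_{n+2})` of the recursion
`u_{n+1} u_{n-1} = f_n u_n²`. -/
def todaStep {G : Type*} [CommGroup G] (f : ℤ → G) : Equiv.Perm (ℤ × G × G) where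
  toFun v := (v.1 + 1, v.2.2, f (v.1 + 1) * v.2.2 ^ 2 / v.2.1)
  invFun v := (v.1 - 1, f v.1 * v.2.1 ^ 2 / v.2.2, v.2.1)
  left_inv v := by
    obtain ⟨n, a, b⟩ := v
    simp
  right_inv v := by
    obtain ⟨n, a, b⟩ := v
    simp

lemma exists_toda_sequence {G : Type*} [CommGroup G] (f : ℤ → G) (u₀ u₁ : G) :
    ∃ u : ℤ → G, u 0 = u₀ ∧ u 1 = u₁ ∧ ∀ n, u (n + 1) * u (n - 1) = f n * u n ^ 2 := by
  -- The index is part of the state, so the index-dependent recursion becomes the iteration of one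
  -- permutation, whose integer powers run in both directions.
  set v : ℤ → ℤ × G × G := fun n => (todaStep f ^ n) (0, u₀, u₁) with hv
  have hstep : ∀ n, v (n + 1) = ((v n).1 + 1, (v n).2.2, f ((v n).1 + 1) * (v n).2.2 ^ 2 / (v n).2.1)
      := by
    intro n
    simp only [hv]
    rw [add_comm n 1, zpow_add, zpow_one, Equiv.Perm.mul_apply]
    rfl
  have hfst : ∀ n, (v n).1 = n := by
    intro n
    induction n using Int.induction_on with
    | zero => simp [hv]
    | succ k ih => rw [hstep, ih]
    | pred k ih =>
      have := hstep (-k - 1)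
      rw [sub_add_cancel] at this
      rw [this] at ih
      simp only at ih
      linarith
  have hv0 : v 0 = (0, u₀, u₁) := by simp [hv]
  refine ⟨fun n => (v n).2.1, by simp [hv0], ?_, fun n => ?_⟩
  · have := hstep 0
    rw [zero_add] at this
    simp [this, hv0]
  · have h1 := hstep (n - 1)
    rw [sub_add_cancel] at h1
    have h2 : (v (n + 1)).2.1 = (v n).2.2 := by rw [hstep]
    rw [hfst, sub_add_cancel] at h1
    have h3 : (v n).2.1 = (v (n - 1)).2.2 := by rw [h1]
    have h4 : (v n).2.2 = f n * (v (n - 1)).2.2 ^ 2 / (v (n - 1)).2.1 := by rw [h1]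
    simp only [h2, h4, h3, div_mul_cancel]

/-- Only mutual inversion along the orbit is required, since birational maps are inverse to each
other only where they are defined. -/
lemma zpowMap_step {A : Type} {f g : A → A} {x : A}
    (hfg : ∀ n, f (g (zpowMap f g n x)) = zpowMap f g n x)
    (hgf : ∀ n, g (f (zpowMap f g n x)) = zpowMap f g n x) (n : ℤ) :
    f (zpowMap f g n x) = zpowMap f g (n + 1) x ∧ g (zpowMap f g n x) = zpowMap f g (n - 1) x := by
  have hf : ∀ n, f (zpowMap f g n x) = zpowMap f g (n + 1) x := by
    intro n
    match n with
    | Int.ofNat k =>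
      change f (f^[k] x) = f^[k + 1] x
      rw [Function.iterate_succ_apply']
    | Int.negSucc 0 => exact hfg 0
    | Int.negSucc (k + 1) =>
      change f (g^[k + 2] x) = g^[k + 1] x
      rw [Function.iterate_succ_apply']
      exact hfg (Int.negSucc k)
  refine ⟨hf n, ?_⟩
  have h := hf (n - 1)
  rw [sub_add_cancel] at h
  rw [← h]
  exact hgf (n - 1)

variable {N : ℕ} {F : Type} [Field F] [CharZero F]

/-! ### The orbit of a solution under the translations -/

/-- The translations and their inverses are defined at `x`. -/
structure OrbitReg (s : Fin N → F) (x : Datum N F) : Prop where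
  a_ne : x.a ≠ 0
  rho : RhoReg s x
  rho' : RhoReg s (Rk1.map x)
  inv : RhoInvReg x
  inv' : RhoInvReg (Rk1.map x)
  a_rho : ((Garnier.rho s).map x).a ≠ 0
  a_inv : ((rhoInv s).map x).a ≠ 0

lemma OrbitReg.of_dom {s : Fin N → F} (hs : ∀ i, s i ≠ 0) {x : Datum N F}
    (h : (transL s).dom x ∧ (transLInv s).dom x ∧ (transLt s).dom x ∧ (transLtInv s).dom x) :
    OrbitReg s x := by
  obtain ⟨⟨h1, h2⟩, h3, ⟨⟨h4, h5, -⟩, -⟩, ⟨⟨-, h6⟩, h7⟩⟩ := h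
  have r : RhoReg s x := RhoReg.of_dom hs h1
  have r' : RhoReg s (Rk1.map x) := RhoReg.of_dom hs h5
  obtain ⟨⟨⟨⟨-, a1⟩, a2⟩, a3⟩, a4⟩ := h3
  change (transLInv s).dom (Rk1.map x) at h6
  -- l̃⁻¹ begins with `Rk1`, and so does the l⁻¹ that follows; the two cancel and ρ⁻¹ acts at x
  -- itself.
  have h6' : (rhoInv s).dom (Rk1.map (Rk1.map x)) := by
    obtain ⟨⟨⟨⟨-, c1⟩, c2⟩, c3⟩, c4⟩ := h6
    exact ⟨⟨⟨c1, c2⟩, c3⟩, c4⟩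
  rw [Rk1_Rk1] at h6'
  -- The domain of ρ⁻¹ does not force q_i ≠ 0 at its argument; this comes from the domain of ρ, as
  -- `Rk1` leaves the q_i unchanged.
  have i' : RhoInvReg (Rk1.map x) := RhoInvReg.of_dom hs r.q_ne ⟨⟨⟨a1, a2⟩, a3⟩, a4⟩
  have i : RhoInvReg x := RhoInvReg.of_dom hs r.q_ne h6'
  have h8 : ((rhoInv s).map (Rk1.map (Rk1.map x))).a ≠ 0 := h7
  rw [Rk1_Rk1] at h8
  exact ⟨h4, r, r', i, i', h2, h8⟩

/-- `l̃ᵐ lⁿ x₀`. -/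
def orbit (s : Fin N → F) (x₀ : Datum N F) (m n : ℤ) : Datum N F :=
  zpowMap (transLt s).map (transLtInv s).map m
    (zpowMap (transL s).map (transLInv s).map n x₀)

section orbit

variable {s : Fin N → F} (hs : ∀ i, s i ≠ 0) {x₀ : Datum N F}
  (hr : ∀ m n, OrbitReg s (orbit s x₀ m n))
include hs hr

lemma orbit_step_fst (m n : ℤ) :
    (rho s).map (Rk1.map (orbit s x₀ m n)) = orbit s x₀ (m + 1) n ∧
      Rk1.map ((rhoInv s).map (orbit s x₀ m n)) = orbit s x₀ (m - 1) n := by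
  have h := zpowMap_step (f := (transLt s).map) (g := (transLtInv s).map)
    (x := zpowMap (transL s).map (transLInv s).map n x₀) (fun k => ?_) (fun k => ?_) m
  · rwa [transLt_map, transLtInv_map] at h
  · rw [transLt_map, transLtInv_map, Rk1_Rk1]
    exact (hr k n).inv.rho_rhoInv hs
  · rw [transLt_map, transLtInv_map]
    change Rk1.map ((rhoInv s).map ((rho s).map (Rk1.map (orbit s x₀ k n)))) = orbit s x₀ k n
    rw [(hr k n).rho'.rhoInv_rho hs, Rk1_Rk1]

lemma transLInv_transL (m n : ℤ) :
    (rhoInv s).map (Rk1.map (Rk1.map ((rho s).map (orbit s x₀ m n)))) = orbit s x₀ m n := by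
  rw [Rk1_Rk1, (hr m n).rho.rhoInv_rho hs]

lemma transL_transLInv (m n : ℤ) :
    Rk1.map ((rho s).map ((rhoInv s).map (Rk1.map (orbit s x₀ m n)))) = orbit s x₀ m n := by
  rw [(hr m n).inv'.rho_rhoInv hs, Rk1_Rk1]

/-- In l̃ᵐ lⁿ the powers of l act first, so an additional l on the outside has to be moved past l̃ᵐ.
Each move uses that ρ² or ρ⁻² commutes with `Rk1`. -/
lemma orbit_succ_snd (m n : ℤ) :
    Rk1.map ((rho s).map (orbit s x₀ m n)) = orbit s x₀ m (n + 1) := by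
  revert n
  induction m using Int.induction_on with
  | zero =>
    intro n
    exact (zpowMap_step (f := (transL s).map) (g := (transLInv s).map) (x := x₀)
      (fun k => transL_transLInv hs hr 0 k) (fun k => transLInv_transL hs hr 0 k) n).1
  | succ k ih =>
    intro n
    have h1 := (orbit_step_fst hs hr k n).1
    have h2 := (orbit_step_fst hs hr k (n + 1)).1
    have h3 := (hr k (n + 1)).rho'
    have h4 := (hr (k + 1) n).rho
    rw [← ih n, Rk1_Rk1] at h2 h3
    rw [← h1] at h4
    rw [← h1, ← h2, rho_rho_Rk1 hs (hr k n).a_ne (hr k n).rho h3 (hr k n).rho' h4, Rk1_Rk1]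
  | pred k ih =>
    intro n
    have h1 := (orbit_step_fst hs hr (-k) n).2
    have h2 := (orbit_step_fst hs hr (-k) (n + 1)).2
    set y := orbit s x₀ (-k) (n + 1) with hy
    have h3 : (rhoInv s).map (Rk1.map y) = orbit s x₀ (-k) n := by
      rw [hy, ← ih n]; exact transLInv_transL hs hr _ _
    have h4 := (hr (-k - 1) (n + 1)).inv'
    rw [← h2, Rk1_Rk1] at h4
    have h5 := (hr (-k) n).inv
    rw [← h3] at h5
    have h6 := rhoInv_rhoInv_Rk1 hs (hr (-k) (n + 1)).a_ne (hr (-k) (n + 1)).inv h4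
      (hr (-k) (n + 1)).inv' h5
    have h7 : (rhoInv s).map (Rk1.map (orbit s x₀ (-k - 1) (n + 1))) =
        orbit s x₀ (-k - 1) n := by
      rw [← h2, ← h1, Rk1_Rk1, ← h3, h6, Rk1_Rk1]
    rw [← h7, transL_transLInv hs hr]

lemma orbit_pred_snd (m n : ℤ) :
    (rhoInv s).map (Rk1.map (orbit s x₀ m n)) = orbit s x₀ m (n - 1) := by
  have h := orbit_succ_snd hs hr m (n - 1)
  rw [sub_add_cancel] at h
  rw [← h]
  exact transLInv_transL hs hr _ _

omit hs hr in
/-- Induction along the orbit. -/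
lemma orbit_induction {P : ℤ → ℤ → Prop} (h00 : P 0 0)
    (hL : ∀ n, P 0 n → P 0 (n + 1)) (hL' : ∀ n, P 0 n → P 0 (n - 1))
    (hLt : ∀ m n, P m n → P (m + 1) n) (hLt' : ∀ m n, P m n → P (m - 1) n) (m n : ℤ) : P m n := by
  have h0 : ∀ n, P 0 n := by
    intro n
    induction n using Int.induction_on with
    | zero => exact h00
    | succ k ih => exact hL _ ih
    | pred k ih => exact hL' _ ih
  induction m using Int.induction_on with
  | zero => exact h0 n
  | succ k ih => exact hLt _ _ ih
  | pred k ih => exact hLt' _ _ ih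

lemma orbit_isSolution {D : Fin N → Derivation ℤ F F} (ht : TimeVars s D)
    (h₀ : IsSolution s D x₀) (m n : ℤ) : IsSolution s D (orbit s x₀ m n) := by
  refine orbit_induction (P := fun m n => IsSolution s D (orbit s x₀ m n)) h₀
    (fun n h => ?_) (fun n h => ?_) (fun m n h => ?_) (fun m n h => ?_) m n
  · rw [← orbit_succ_snd hs hr]
    exact ((hr 0 n).rho.isSolution_rho hs ht h).map_Rk1 ht (hr 0 n).a_rho
  · rw [← orbit_pred_snd hs hr]
    exact (hr 0 n).inv'.isSolution_rhoInv hs ht (h.map_Rk1 ht (hr 0 n).a_ne)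
  · rw [← (orbit_step_fst hs hr m n).1]
    exact (hr m n).rho'.isSolution_rho hs ht (h.map_Rk1 ht (hr m n).a_ne)
  · rw [← (orbit_step_fst hs hr m n).2]
    exact ((hr m n).inv.isSolution_rhoInv hs ht h).map_Rk1 ht (hr m n).a_inv

lemma orbit_hasParams {κ : F} {θ : Fin N → F} (h₀ : HasParams κ θ 0 0 x₀) (m n : ℤ) :
    HasParams κ θ (m : F) (n : F) (orbit s x₀ m n) := by
  refine orbit_induction (P := fun m n => HasParams κ θ (m : F) (n : F) (orbit s x₀ m n))
    (by simpa using h₀ : HasParams κ θ ((0 : ℤ) : F) ((0 : ℤ) : F) x₀) (fun n h => ?_) (fun n h => ?_) (fun m n h => ?_) (fun m n h => ?_) m n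
  · rw [← orbit_succ_snd hs hr]
    refine ⟨?_, ?_, ?_, fun i => ?_⟩ <;>
      simp only [rho_map, Rk1_k0, Rk1_k1, Rk1_kinf, Rk1_th, Rtau_k0, Rtau_k1, Rtau_kinf, Rtau_th,
        signFlip_k0, signFlip_k1, signFlip_kinf, signFlip_th, Rk0_k0, Rk0_k1, Rk0_kinf, Rk0_th,
        h.k0, h.k1, h.kinf, h.th] <;> push_cast <;> ring
  · rw [← orbit_pred_snd hs hr]
    refine ⟨?_, ?_, ?_, fun i => ?_⟩ <;>
      simp only [rhoInv_map, Rk1_k0, Rk1_k1, Rk1_kinf, Rk1_th, Rtau_k0, Rtau_k1, Rtau_kinf, Rtau_th,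
        signFlip_k0, signFlip_k1, signFlip_kinf, signFlip_th, Rk0_k0, Rk0_k1, Rk0_kinf, Rk0_th,
        h.k0, h.k1, h.kinf, h.th] <;> push_cast <;> ring
  · rw [← (orbit_step_fst hs hr m n).1]
    refine ⟨?_, ?_, ?_, fun i => ?_⟩ <;>
      simp only [rho_map, Rk1_k0, Rk1_k1, Rk1_kinf, Rk1_th, Rtau_k0, Rtau_k1, Rtau_kinf, Rtau_th,
        signFlip_k0, signFlip_k1, signFlip_kinf, signFlip_th, Rk0_k0, Rk0_k1, Rk0_kinf, Rk0_th,
        h.k0, h.k1, h.kinf, h.th] <;> push_cast <;> ring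
  · rw [← (orbit_step_fst hs hr m n).2]
    refine ⟨?_, ?_, ?_, fun i => ?_⟩ <;>
      simp only [rhoInv_map, Rk1_k0, Rk1_k1, Rk1_kinf, Rk1_th, Rtau_k0, Rtau_k1, Rtau_kinf, Rtau_th,
        signFlip_k0, signFlip_k1, signFlip_kinf, signFlip_th, Rk0_k0, Rk0_k1, Rk0_kinf, Rk0_th,
        h.k0, h.k1, h.kinf, h.th] <;> push_cast <;> ring

lemma orbit_gam_ne (m n : ℤ) : (orbit s x₀ m n).gam ≠ 0 :=
  mul_ne_zero (by norm_num) (mul_ne_zero (hr m n).a_ne (hr m n).inv.g_ne)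

lemma orbit_gam_ne' (m n : ℤ) : (Rk1.map (orbit s x₀ m n)).gam ≠ 0 :=
  mul_ne_zero (by norm_num) (mul_ne_zero (hr m n).a_ne (hr m n).inv'.g_ne)

/-- The compatibility of the two Toda equations. -/
lemma orbit_gam_compat (m n : ℤ) :
    (orbit s x₀ m (n + 1)).gam * (orbit s x₀ m (n - 1)).gam * (Rk1.map (orbit s x₀ m n)).gam ^ 2 =
      (Rk1.map (orbit s x₀ (m + 1) n)).gam * (Rk1.map (orbit s x₀ (m - 1) n)).gam *
        (orbit s x₀ m n).gam ^ 2 := by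
  have h1 := (orbit_step_fst hs hr m n).1
  have h2 := (orbit_step_fst hs hr m n).2
  have h3 := (hr (m + 1) n).a_ne
  rw [← h1] at h3
  -- Both sides reduce to 256 a² b u u' W at the central solution, where u' is the value of u after
  -- `Rk1`; the powers of g and of its transform cancel.
  rw [← h1, ← h2, ← orbit_succ_snd hs hr, ← orbit_pred_snd hs hr, Rk1_Rk1,
    (hr m n).rho.gam_Rk1_rho hs (hr m n).a_rho, (hr m n).rho'.gam_Rk1_rho hs h3,
    (hr m n).inv.gam_rhoInv hs, (hr m n).inv'.gam_rhoInv hs, W_Rk1 (hr m n).a_ne, Rk1_b,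
    Datum.gam, Datum.gam, Rk1_a]
  have hg := (hr m n).inv.g_ne
  have hg' := (hr m n).inv'.g_ne
  field_simp

end orbit

/-! ### The normalized τ-functions -/

/-- Propagates the recursion in one direction from two adjacent lines (data without index and with
index 1) to the next (index 2), given the recursion in the other direction and compatibility of the
right-hand sides. -/
lemma toda_compat_step {A A₁ A₂ B B₁ B₂ Tm Tmp Tmm T₁ T₁p T₁m T₂ T₂p T₂m : F}
    (hT₁ : T₁ ≠ 0) (hA₁ : A₁ ≠ 0)
    (h : B₁ * B₂ * A ^ 2 = A₂ * A₁ * B ^ 2)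
    (hm : Tmp * Tmm = A * Tm ^ 2) (h1 : T₁p * T₁m = A₁ * T₁ ^ 2)
    (e : T₂ * T₁ = B * Tm ^ 2) (ep : T₂p * T₁p = B₁ * Tmp ^ 2) (em : T₂m * T₁m = B₂ * Tmm ^ 2) :
    T₂p * T₂m = A₂ * T₂ ^ 2 := by
  have key : (T₂p * T₂m) * (A₁ * T₁ ^ 2) = A₂ * T₂ ^ 2 * (A₁ * T₁ ^ 2) := by
    calc (T₂p * T₂m) * (A₁ * T₁ ^ 2) = (T₂p * T₁p) * (T₂m * T₁m) := by rw [← h1]; ring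
      _ = B₁ * B₂ * (Tmp * Tmm) ^ 2 := by rw [ep, em]; ring
      _ = (B₁ * B₂ * A ^ 2) * Tm ^ 4 := by rw [hm]; ring
      _ = A₂ * A₁ * (B * Tm ^ 2) ^ 2 := by rw [h]; ring
      _ = A₂ * T₂ ^ 2 * (A₁ * T₁ ^ 2) := by rw [← e]; ring
  exact mul_right_cancel₀ (mul_ne_zero hA₁ (pow_ne_zero 2 hT₁)) key

/-- A doubly infinite array that satisfies two compatible Toda equations with prescribed
right-hand sides `A`, `B`. -/
lemma exists_toda_array (A B : ℤ → ℤ → F) (hA : ∀ m n, A m n ≠ 0) (hB : ∀ m n, B m n ≠ 0)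
    (h : ∀ m n, B m (n + 1) * B m (n - 1) * A m n ^ 2 =
      A (m + 1) n * A (m - 1) n * B m n ^ 2)
    {c₀₀ c₀₁ c₁₀ c₁₁ : F} (h₀₀ : c₀₀ ≠ 0) (h₀₁ : c₀₁ ≠ 0) (h₁₀ : c₁₀ ≠ 0) (h₁₁ : c₁₁ ≠ 0) :
    ∃ T : ℤ → ℤ → F, (∀ m n, T m n ≠ 0) ∧ T 0 0 = c₀₀ ∧ T 0 1 = c₀₁ ∧ T 1 0 = c₁₀ ∧ T 1 1 = c₁₁ ∧
      (∀ m n, T (m + 1) n * T (m - 1) n = B m n * T m n ^ 2) ∧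
      (∀ m n, T m (n + 1) * T m (n - 1) = A m n * T m n ^ 2) := by
  obtain ⟨u, u0, u1, hu⟩ := exists_toda_sequence (fun n => Units.mk0 _ (hA 0 n))
    (Units.mk0 _ h₀₀) (Units.mk0 _ h₀₁)
  obtain ⟨v, v0, v1, hv⟩ := exists_toda_sequence (fun n => Units.mk0 _ (hA 1 n))
    (Units.mk0 _ h₁₀) (Units.mk0 _ h₁₁)
  -- The lines m = 0 and m = 1 are built first in direction n; then, for each n, they are continued
  -- in direction m. The recursion in direction n away from these lines is what remains to be shown.
  choose w w0 w1 hw using fun n => exists_toda_sequence (fun m => Units.mk0 _ (hB m n)) (u n) (v n)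
  have hfst : ∀ m n, (w n (m + 1) : F) * w n (m - 1) = B m n * (w n m : F) ^ 2 := fun m n => by
    simpa using congrArg Units.val (hw n m)
  refine ⟨fun m n => w n m, fun m n => (w n m).ne_zero, by simp [w0, u0], by simp [w0, u1],
    by simp [w1, v0], by simp [w1, v1], hfst, fun m => ?_⟩
  refine int_two_step_induction
    (Q := fun m => ∀ n, (w (n + 1) m : F) * w (n - 1) m = A m n * (w n m : F) ^ 2)
    (fun n => ?_) (fun n => ?_) (fun m h1 h2 n => ?_) (fun m h1 h2 n => ?_) m
  · simpa [w0] using congrArg Units.val (hu n)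
  · simpa [w1] using congrArg Units.val (hv n)
  · exact toda_compat_step (w n (m - 1)).ne_zero (hA (m - 1) n) (h m n) (h2 n) (h1 n) (hfst m n)
      (hfst m (n + 1)) (hfst m (n - 1))
  -- Downward the same step applies with the lines m + 1 and m - 1 exchanged, because the
  -- compatibility relation is symmetric in them.
  · refine toda_compat_step (B := B m n) (B₁ := B m (n + 1)) (B₂ := B m (n - 1))
      (w n (m + 1)).ne_zero (hA (m + 1) n) ((h m n).trans (by ring)) (h1 n) (h2 n) ?_ ?_ ?_
    · rw [mul_comm]; exact hfst m n
    · rw [mul_comm]; exact hfst m (n + 1)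
    · rw [mul_comm]; exact hfst m (n - 1)

section existence

variable {t : Fin N → F} {δ : Fin N → Derivation ℤ F F} (ht : RootVars t δ)
variable {κ : F} {θ : Fin N → F} (hκ : κ ≠ 0)
  (hκD : ∀ j, δ j κ = 0) (hθD : ∀ j i, δ j (θ i) = 0)
  (hr : ∀ m n, OrbitReg (sqVars t) (orbit (sqVars t) (seedDatum t κ θ) m n))
include ht hκ hκD hθD hr

lemma logder_gam_fst (m n : ℤ) (i : Fin N) :
    δ i (orbit (sqVars t) (seedDatum t κ θ) m n).gam /
        (orbit (sqVars t) (seedDatum t κ θ) m n).gam =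
      2 * t i * (ham (sqVars t) (orbit (sqVars t) (seedDatum t κ θ) (m + 1) n) i
        + ham (sqVars t) (orbit (sqVars t) (seedDatum t κ θ) (m - 1) n) i
        - 2 * ham (sqVars t) (orbit (sqVars t) (seedDatum t κ θ) m n) i) := by
  have hs := ht.timeVars.ne_zero
  have hsol := orbit_isSolution hs hr ht.timeVars (isSolution_seed ht hκ hκD hθD)
  rw [ht.D_eq, mul_div_assoc, logder_gam_transLt ht.timeVars (hsol m n) (hr m n).a_ne
    (hr m n).rho' (hr m n).inv (hr m n).a_inv, (orbit_step_fst hs hr m n).1,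
    (orbit_step_fst hs hr m n).2]

lemma logder_gam_snd (m n : ℤ) (i : Fin N) :
    δ i (Rk1.map (orbit (sqVars t) (seedDatum t κ θ) m n)).gam /
        (Rk1.map (orbit (sqVars t) (seedDatum t κ θ) m n)).gam =
      2 * t i * (ham (sqVars t) (orbit (sqVars t) (seedDatum t κ θ) m (n + 1)) i
        + ham (sqVars t) (orbit (sqVars t) (seedDatum t κ θ) m (n - 1)) i
        - 2 * ham (sqVars t) (orbit (sqVars t) (seedDatum t κ θ) m n) i) := by
  have hs := ht.timeVars.ne_zero
  have hsol := orbit_isSolution hs hr ht.timeVars (isSolution_seed ht hκ hκD hθD)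
  rw [ht.D_eq, mul_div_assoc, logder_gam_transL ht.timeVars (hsol m n) (hr m n).a_ne
    (hr m n).rho (hr m n).a_rho (hr m n).inv', orbit_succ_snd hs hr, orbit_pred_snd hs hr]

/-- The normalized τ-functions, and the Toda equations. -/
theorem exists_normalized_tau :
    ∃ T : ℤ → ℤ → F, (∀ m n, T m n ≠ 0) ∧
      (∀ m n : ℤ, IsTauDlog t δ κ θ m n (orbit (sqVars t) (seedDatum t κ θ) m n) (T m n)) ∧
      T 0 0 = 1 ∧ T 0 1 = 1 ∧ T 1 0 = ∑ i, θ i * t i - κ ∧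
      T 1 1 = (∏ i, t i) * (κ - ∑ j, θ j * (t j)⁻¹) ∧
      (∀ m n : ℤ, T (m + 1) n = (∏ i, t i) * (brace t δ κ θ (T m n) + (2 * (m : F)) ^ 2) *
        (T m n ^ 2 / T (m - 1) n)) ∧
      (∀ m n : ℤ, T m (n + 1) = (∏ i, t i) * (brace t δ κ θ (T m n) + (2 * (n : F) - 1) ^ 2) *
        (T m n ^ 2 / T m (n - 1))) := by
  have hs := ht.timeVars.ne_zero
  set x₀ := seedDatum t κ θ with hx₀
  set P := ∏ i, t i with hP
  have hP0 : P ≠ 0 := Finset.prod_ne_zero_iff.2 fun j _ => ht.ne_zero j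
  have hsol := orbit_isSolution hs hr ht.timeVars (isSolution_seed ht hκ hκD hθD)
  have hpar := orbit_hasParams hs hr (κ := κ) (θ := θ)
    (x₀ := x₀)
    ⟨by simp [hx₀, seedDatum], by simp [hx₀, seedDatum], rfl, fun _ => rfl⟩
  have hq : ∀ m n i, (orbit (sqVars t) x₀ m n).q i ≠ 0 := fun m n => (hr m n).rho.q_ne
  have r0 := hr 0 0
  have hx00 : orbit (sqVars t) x₀ 0 0 = x₀ := rfl
  rw [hx00] at r0
  have e10 : κ * x₀.a = ∑ i, θ i * t i - κ := by
    simp only [hx₀, Datum.a, seedDatum, ← Finset.sum_div]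
    field_simp
  have e11 : -κ * x₀.b (sqVars t) = κ - ∑ j, θ j * (t j)⁻¹ := by
    have : ∀ j, x₀.q j / sqVars t j = θ j * (t j)⁻¹ / κ := by
      intro j
      have := ht.ne_zero j
      simp only [hx₀, seedDatum, sqVars]
      field_simp
    simp only [Datum.b, this, ← Finset.sum_div]
    field_simp
    ring
  -- The right-hand sides are prescribed as ∏ t_i times values of `gam`, which do not involve T.
  -- They can be recognized as braces only after the logarithmic derivatives of T are known.
  obtain ⟨T, hT0, h00, h01, h10, h11, hfst, hsnd⟩ := exists_toda_array
    (fun m n => P * (Rk1.map (orbit (sqVars t) x₀ m n)).gam)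
    (fun m n => P * (orbit (sqVars t) x₀ m n).gam)
    (fun m n => mul_ne_zero hP0 (orbit_gam_ne' hs hr m n))
    (fun m n => mul_ne_zero hP0 (orbit_gam_ne hs hr m n))
    (fun m n => by linear_combination P ^ 4 * orbit_gam_compat hs hr m n)
    (c₀₀ := 1) (c₀₁ := 1) (c₁₀ := κ * x₀.a) (c₁₁ := P * (-κ * x₀.b (sqVars t)))
    one_ne_zero one_ne_zero (mul_ne_zero hκ r0.a_ne)
    (mul_ne_zero hP0 (mul_ne_zero (neg_ne_zero.2 hκ) r0.rho.b_ne))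
  have k00 : IsTauDlog t δ κ θ 0 0 (orbit (sqVars t) x₀ 0 0) (T 0 0) := by
    rw [h00]; exact isTauDlog_seed ht hκ
  have k01 : IsTauDlog t δ κ θ 0 1 (orbit (sqVars t) x₀ 0 1) (T 0 1) := by
    have := orbit_succ_snd hs hr 0 0
    rw [zero_add, hx00] at this
    rw [h01, ← this]
    exact isTauDlog_transL_seed ht hκ r0.rho r0.a_rho
  have k10 : IsTauDlog t δ κ θ 1 0 (orbit (sqVars t) x₀ 1 0) (T 1 0) := by
    have := (orbit_step_fst hs hr 0 0).1
    rw [zero_add, hx00] at this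
    rw [h10, ← this]
    exact isTauDlog_transLt_seed ht hκ hκD hθD r0.a_ne r0.rho'
  have k11 : IsTauDlog t δ κ θ 1 1 (orbit (sqVars t) x₀ 1 1) (T 1 1) := by
    have e1 := orbit_succ_snd hs hr 0 0
    have e2 := (orbit_step_fst hs hr 0 1).1
    have e3 := (hr 0 1).rho'
    rw [zero_add, hx00] at e1
    rw [zero_add, ← e1, Rk1_Rk1] at e2
    rw [← e1, Rk1_Rk1] at e3
    rw [h11, ← e2]
    exact isTauDlog_transLt_transL_seed ht hκ hκD hθD r0.rho e3
  have dfst : ∀ (m n : ℤ) (i : Fin N), δ i (T (m + 1) n) / T (m + 1) n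
      + δ i (T (m - 1) n) / T (m - 1) n - 2 * (δ i (T m n) / T m n) = 1 / t i +
      2 * t i * (ham (sqVars t) (orbit (sqVars t) x₀ (m + 1) n) i
        + ham (sqVars t) (orbit (sqVars t) x₀ (m - 1) n) i
        - 2 * ham (sqVars t) (orbit (sqVars t) x₀ m n) i) := by
    intro m n i
    rw [logder_toda (δ i) (mul_ne_zero hP0 (orbit_gam_ne hs hr m n)) (hT0 m n) (hT0 _ n)
      (hT0 _ n) (hfst m n), logder_mul _ hP0 (orbit_gam_ne hs hr m n), logder_prod_t ht,
      logder_gam_fst ht hκ hκD hθD hr]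
    ring
  have dsnd : ∀ (m n : ℤ) (i : Fin N), δ i (T m (n + 1)) / T m (n + 1)
      + δ i (T m (n - 1)) / T m (n - 1) - 2 * (δ i (T m n) / T m n) = 1 / t i +
      2 * t i * (ham (sqVars t) (orbit (sqVars t) x₀ m (n + 1)) i
        + ham (sqVars t) (orbit (sqVars t) x₀ m (n - 1)) i
        - 2 * ham (sqVars t) (orbit (sqVars t) x₀ m n) i) := by
    intro m n i
    rw [logder_toda (δ i) (mul_ne_zero hP0 (orbit_gam_ne' hs hr m n)) (hT0 m n) (hT0 m _)
      (hT0 m _) (hsnd m n), logder_mul _ hP0 (orbit_gam_ne' hs hr m n), logder_prod_t ht,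
      logder_gam_snd ht hκ hκD hθD hr]
    ring
  have nfst : ∀ (m n : ℤ) (i : Fin N), normDlog t κ θ ((m + 1 : ℤ) : F) n i
      + normDlog t κ θ ((m - 1 : ℤ) : F) n i - 2 * normDlog t κ θ m n i = 1 / t i := by
    intro m n i
    have := normDlog_second_diff (t := t) (κ := κ) (θ := θ) m n 1 0 (by ring) i
    simpa using this
  have nsnd : ∀ (m n : ℤ) (i : Fin N), normDlog t κ θ m ((n + 1 : ℤ) : F) i
      + normDlog t κ θ m ((n - 1 : ℤ) : F) i - 2 * normDlog t κ θ m n i = 1 / t i := by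
    intro m n i
    have := normDlog_second_diff (t := t) (κ := κ) (θ := θ) m n 0 1 (by ring) i
    simpa using this
  -- The logarithmic derivatives and the expected expressions have the same second differences, so
  -- agreement at two adjacent indices extends to all integers, here along n and below along m.
  have row : ∀ m : ℤ, IsTauDlog t δ κ θ m 0 (orbit (sqVars t) x₀ m 0) (T m 0) →
      IsTauDlog t δ κ θ m 1 (orbit (sqVars t) x₀ m 1) (T m 1) →
      ∀ n : ℤ, IsTauDlog t δ κ θ m n (orbit (sqVars t) x₀ m n) (T m n) := by
    intro m h0 h1
    refine int_two_step_induction (by simpa using h0) (by simpa using h1) (fun n h2 h3 i => ?_)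
      (fun n h2 h3 i => ?_)
    · linear_combination dsnd m n i - nsnd m n i - h2 i + 2 * h3 i
    · linear_combination dsnd m n i - nsnd m n i + 2 * h2 i - h3 i
  have hdlog : ∀ m n : ℤ, IsTauDlog t δ κ θ m n (orbit (sqVars t) x₀ m n) (T m n) := by
    intro m n
    refine int_two_step_induction
      (Q := fun m : ℤ => IsTauDlog t δ κ θ m n (orbit (sqVars t) x₀ m n) (T m n))
      (row 0 (by simpa using k00) (by simpa using k01) n)
      (row 1 (by simpa using k10) (by simpa using k11) n) (fun m h2 h3 i => ?_)
      (fun m h2 h3 i => ?_) m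
    · linear_combination dfst m n i - nfst m n i - h2 i + 2 * h3 i
    · linear_combination dfst m n i - nfst m n i + 2 * h2 i - h3 i
  have hZ : ∀ (k : ℤ) (j : Fin N), δ j (k : F) = 0 := fun k j => (δ j).map_intCast k
  refine ⟨T, hT0, hdlog, h00, h01, h10.trans e10, by rw [h11, e11], fun m n => ?_, fun m n => ?_⟩
  · rw [brace_eq ht hκD hθD (hZ m) (hZ n) (hsol m n) (hpar m n) (hq m n) (hdlog m n),
      ← mul_div_assoc, eq_div_iff (hT0 _ _), hfst]
  · rw [brace_eq' ht hκD hθD (hZ m) (hZ n) (hsol m n) (hpar m n) (hq m n) (hdlog m n)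
      (hr m n).a_ne, ← mul_div_assoc, eq_div_iff (hT0 _ _), hsnd]

end existence

/-- Uniqueness of an array that satisfies the Toda equations. -/
lemma toda_array_unique {T T' : ℤ → ℤ → F} {E : F → F} {P : F} {f g : ℤ → F}
    (hT : ∀ m n, T m n ≠ 0) (hT' : ∀ m n, T' m n ≠ 0)
    (h00 : T 0 0 = T' 0 0) (h01 : T 0 1 = T' 0 1) (h10 : T 1 0 = T' 1 0) (h11 : T 1 1 = T' 1 1)
    (h1 : ∀ m n, T (m + 1) n = P * (E (T m n) + f m) * (T m n ^ 2 / T (m - 1) n))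
    (h1' : ∀ m n, T' (m + 1) n = P * (E (T' m n) + f m) * (T' m n ^ 2 / T' (m - 1) n))
    (h2 : ∀ m n, T m (n + 1) = P * (E (T m n) + g n) * (T m n ^ 2 / T m (n - 1)))
    (h2' : ∀ m n, T' m (n + 1) = P * (E (T' m n) + g n) * (T' m n ^ 2 / T' m (n - 1))) :
    T = T' := by
  have line : ∀ (u u' : ℤ → F) (k : ℤ → F), (∀ n, u n ≠ 0) → (∀ n, u' n ≠ 0) → u 0 = u' 0 →
      u 1 = u' 1 → (∀ n, u (n + 1) = P * (E (u n) + k n) * (u n ^ 2 / u (n - 1))) →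
      (∀ n, u' (n + 1) = P * (E (u' n) + k n) * (u' n ^ 2 / u' (n - 1))) → ∀ n, u n = u' n := by
    intro u u' k hu hu' e0 e1 h h'
    refine int_two_step_induction e0 e1 (fun n a b => ?_) (fun n a b => ?_)
    · rw [h, h', a, b]
    -- Backwards, u_{n+1} u_{n-1} is the common value P(E(u_n) + k_n)u_n², and u_{n+1} ≠ 0 can be
    -- cancelled.
    · have p := h n
      have p' := h' n
      rw [← mul_div_assoc, eq_div_iff (hu _)] at p
      rw [← mul_div_assoc, eq_div_iff (hu' _), ← a, ← p, ← b] at p'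
      exact (mul_left_cancel₀ (hu _) p').symm
  funext m n
  exact line (fun m => T m n) (fun m => T' m n) f (fun m => hT m n) (fun m => hT' m n)
    (line (T 0) (T' 0) g (hT 0) (hT' 0) h00 h01 (h2 0) (h2' 0) n)
    (line (T 1) (T' 1) g (hT 1) (hT' 1) h10 h11 (h2 1) (h2' 1) n)
    (fun m => h1 m n) (fun m => h1' m n) m

end
end Garnier

/-! ### Partial derivatives as derivations of ℂ(t₁, …, t_N). -/

namespace Garnier

noncomputable section

set_option linter.unusedSectionVars false

variable {N : ℕ}

/-- The embedding of the polynomials into the rational functions. -/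
abbrev polyMap (N : ℕ) : MvPolynomial (Fin N) ℂ →+* RatFun N :=
  algebraMap (MvPolynomial (Fin N) ℂ) (RatFun N)

lemma polyMap_injective : Function.Injective (polyMap N) :=
  IsFractionRing.injective (MvPolynomial (Fin N) ℂ) (RatFun N)

lemma polyMap_ne_zero {b : MvPolynomial (Fin N) ℂ} (hb : b ≠ 0) : polyMap N b ≠ 0 :=
  (map_ne_zero_iff _ polyMap_injective).2 hb

instance : CharZero (RatFun N) :=
  charZero_of_injective_algebraMap (polyMap_injective (N := N))

lemma exists_eq_div (f : RatFun N) :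
    ∃ a b : MvPolynomial (Fin N) ℂ, b ≠ 0 ∧ f = polyMap N a / polyMap N b := by
  obtain ⟨a, b, hb, rfl⟩ := IsFractionRing.div_surjective (A := MvPolynomial (Fin N) ℂ) f
  exact ⟨a, b, nonZeroDivisors.ne_zero hb, rfl⟩

/-- Independence of the quotient rule from the chosen fraction: `h` equates two fractions by cross
multiplication, and `h'` is the derivative of that equation. -/
lemma quotient_rule_cross {R : Type*} [CommRing R] {a b c d a' b' c' d' : R} (h : a * d = c * b)
    (h' : a * d' + d * a' = c * b' + b * c') :
    (c' * d - c * d') * b ^ 2 = (a' * b - a * b') * d ^ 2 := by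
  linear_combination (-(b * d)) * h' + (b' * d + d' * b) * h

lemma quotient_rule_congr (i : Fin N) {a b c d : MvPolynomial (Fin N) ℂ} (hb : b ≠ 0)
    (hd : d ≠ 0) (h : polyMap N a / polyMap N b = polyMap N c / polyMap N d) :
    polyMap N (MvPolynomial.pderiv i c * d - c * MvPolynomial.pderiv i d) / polyMap N (d ^ 2) =
      polyMap N (MvPolynomial.pderiv i a * b - a * MvPolynomial.pderiv i b) /
        polyMap N (b ^ 2) := by
  have h1 : a * d = c * b := by
    apply polyMap_injective
    rw [div_eq_div_iff (polyMap_ne_zero hb) (polyMap_ne_zero hd)] at h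
    rw [map_mul, map_mul, h]
  have h2 := congrArg (MvPolynomial.pderiv i) h1
  rw [Derivation.leibniz, Derivation.leibniz] at h2
  simp only [smul_eq_mul] at h2
  rw [div_eq_div_iff (polyMap_ne_zero (pow_ne_zero 2 hd)) (polyMap_ne_zero (pow_ne_zero 2 hb)),
    ← map_mul, ← map_mul]
  exact congrArg (polyMap N) (quotient_rule_cross h1 h2)

/-- The quotient rule, for any representation as a quotient. -/
lemma pd_div (i : Fin N) (a b : MvPolynomial (Fin N) ℂ) (hb : b ≠ 0) :
    pd i (polyMap N a / polyMap N b) =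
      polyMap N (MvPolynomial.pderiv i a * b - a * MvPolynomial.pderiv i b) /
        polyMap N (b ^ 2) := by
  refine quotient_rule_congr i hb (nonZeroDivisors.ne_zero (IsFractionRing.den _ _).2) ?_
  exact (IsFractionRing.mk'_num_den' _ _).symm

/-- Derivations of a field. -/
abbrev FieldDer (F : Type) [Field F] : Type := Derivation ℤ F F

/-- A derivation of a field from its two rules. -/
def FieldDer.of {F : Type} [Field F] (f : F → F) (hadd : ∀ a b, f (a + b) = f a + f b)
    (hmul : ∀ a b, f (a * b) = a * f b + b * f a) : FieldDer F :=
  Derivation.mk' (AddMonoidHom.mk' f hadd).toIntLinearMap hmul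

lemma pd_add (i : Fin N) (f g : RatFun N) : pd i (f + g) = pd i f + pd i g := by
  obtain ⟨a, b, hb, rfl⟩ := exists_eq_div f
  obtain ⟨c, d, hd, rfl⟩ := exists_eq_div g
  have hB := polyMap_ne_zero hb
  have hD := polyMap_ne_zero hd
  have : polyMap N a / polyMap N b + polyMap N c / polyMap N d =
      polyMap N (a * d + b * c) / polyMap N (b * d) := by
    rw [div_add_div _ _ hB hD, map_add, map_mul, map_mul, map_mul]
  rw [this, pd_div i _ _ hb, pd_div i _ _ hd, pd_div i _ _ (mul_ne_zero hb hd)]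
  simp only [map_add, map_mul, map_sub, map_pow, Derivation.leibniz, smul_eq_mul]
  field_simp
  ring

lemma pd_mul (i : Fin N) (f g : RatFun N) : pd i (f * g) = f * pd i g + g * pd i f := by
  obtain ⟨a, b, hb, rfl⟩ := exists_eq_div f
  obtain ⟨c, d, hd, rfl⟩ := exists_eq_div g
  have hB := polyMap_ne_zero hb
  have hD := polyMap_ne_zero hd
  have : polyMap N a / polyMap N b * (polyMap N c / polyMap N d) =
      polyMap N (a * c) / polyMap N (b * d) := by
    rw [div_mul_div_comm, map_mul, map_mul]
  rw [this, pd_div i _ _ hb, pd_div i _ _ hd, pd_div i _ _ (mul_ne_zero hb hd)]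
  simp only [map_mul, map_sub, map_pow, Derivation.leibniz, smul_eq_mul, map_add]
  field_simp
  ring

/-- `∂/∂t_i` as a derivation. -/
def pdD (i : Fin N) : FieldDer (RatFun N) := FieldDer.of (pd i) (pd_add i) (pd_mul i)

lemma pd_eq (i : Fin N) (f : RatFun N) : pd i f = pdD i f := rfl

lemma pdD_polyMap (i : Fin N) (a : MvPolynomial (Fin N) ℂ) :
    pdD i (polyMap N a) = polyMap N (MvPolynomial.pderiv i a) := by
  have := pd_div i a 1 one_ne_zero
  simpa [pd_eq] using this

@[simp] lemma pdD_cst (i : Fin N) (c : ℂ) : pdD i (cst c) = 0 := by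
  rw [cst, pdD_polyMap]; simp

lemma pdD_tvar (i j : Fin N) : pdD i (tvar j) = if j = i then 1 else 0 := by
  rw [tvar, pdD_polyMap, MvPolynomial.pderiv_X, Pi.single_apply]
  by_cases h : j = i <;> simp [h]

lemma tvar_ne_zero (i : Fin N) : (tvar i : RatFun N) ≠ 0 :=
  polyMap_ne_zero (MvPolynomial.X_ne_zero i)

lemma polyMap_ne_zero_of_eval {b : MvPolynomial (Fin N) ℂ} (t : Fin N → ℂ)
    (hb : MvPolynomial.eval t b ≠ 0) : polyMap N b ≠ 0 :=
  polyMap_ne_zero (by rintro rfl; simp at hb)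

lemma tvar_add_one_ne (i : Fin N) : (tvar i + 1 : RatFun N) ≠ 0 := by
  have := polyMap_ne_zero_of_eval (b := MvPolynomial.X i + 1) (fun _ : Fin N => (0 : ℂ)) (by simp)
  simpa [tvar] using this

lemma tvar_sub_one_ne (i : Fin N) : (tvar i - 1 : RatFun N) ≠ 0 := by
  have := polyMap_ne_zero_of_eval (b := MvPolynomial.X i - 1) (fun _ : Fin N => (0 : ℂ)) (by simp)
  simpa [tvar] using this

lemma tvar_add_ne (i j : Fin N) : (tvar i + tvar j : RatFun N) ≠ 0 := by
  have := polyMap_ne_zero_of_eval (b := MvPolynomial.X i + MvPolynomial.X j)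
    (fun _ : Fin N => (1 : ℂ)) (by simp)
  simpa [tvar] using this

lemma tvar_sub_ne {i j : Fin N} (h : i ≠ j) : (tvar j - tvar i : RatFun N) ≠ 0 := by
  have := polyMap_ne_zero_of_eval (b := MvPolynomial.X j - MvPolynomial.X i)
    (Function.update (fun _ : Fin N => (1 : ℂ)) i 0) (by simp [Function.update_of_ne h.symm])
  simpa [tvar] using this

lemma rootVars_tvar : RootVars (N := N) tvar pdD where
  ne_zero := tvar_ne_zero
  add_one_ne := tvar_add_one_ne
  sub_one_ne := tvar_sub_one_ne
  add_ne := tvar_add_ne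
  sub_ne _ _ h := tvar_sub_ne h
  D_self i := by rw [pdD_tvar, if_pos rfl]
  D_other i j h := by rw [pdD_tvar, if_neg h]

lemma svar_eq : (svar : Fin N → RatFun N) = sqVars tvar := rfl

lemma orbitReg_of_orbitDefined {κ : ℂ} {θ : Fin N → ℂ} (h : OrbitDefined κ θ) (m n : ℤ) :
    OrbitReg (sqVars tvar) (orbit (sqVars tvar)
      (seedDatum tvar (cst κ) (fun i => cst (θ i))) m n) :=
  -- `sol` unfolds to the `orbit` of the seed, so the hypothesis applies as it stands.
  OrbitReg.of_dom (rootVars_tvar (N := N)).timeVars.ne_zero (h m n)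

end
end Garnier

/-! ### From rational functions to holomorphic τ-functions. -/

namespace Garnier

noncomputable section

set_option linter.unusedSectionVars false

variable {N : ℕ}

/-! ### Values of rational functions -/

namespace HasValueAt

variable {f g : RatFun N} {t : Fin N → ℂ} {v w : ℂ}

lemma unique (hf : HasValueAt f t v) (hg : HasValueAt f t w) : v = w := by
  obtain ⟨a, b, hb, e, rfl⟩ := hf
  obtain ⟨c, d, hd, e', rfl⟩ := hg
  have hB := polyMap_ne_zero_of_eval t hb
  have hD := polyMap_ne_zero_of_eval t hd
  rw [e, div_eq_div_iff hB hD, ← map_mul, ← map_mul] at e'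
  have := congrArg (MvPolynomial.eval t) (polyMap_injective e')
  rw [map_mul, map_mul] at this
  rw [div_eq_div_iff hb hd, this]

lemma poly (a : MvPolynomial (Fin N) ℂ) : HasValueAt (polyMap N a) t (MvPolynomial.eval t a) :=
  ⟨a, 1, by simp, by rw [map_one, div_one], by simp⟩

lemma cst (c : ℂ) : HasValueAt (Garnier.cst c : RatFun N) t c := by
  have := poly (t := t) (MvPolynomial.C c)
  rwa [MvPolynomial.eval_C] at this

lemma tvar (i : Fin N) : HasValueAt (Garnier.tvar i : RatFun N) t (t i) := by
  have := poly (t := t) (MvPolynomial.X i)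
  rwa [MvPolynomial.eval_X] at this

lemma add (hf : HasValueAt f t v) (hg : HasValueAt g t w) : HasValueAt (f + g) t (v + w) := by
  obtain ⟨a, b, hb, rfl, rfl⟩ := hf
  obtain ⟨c, d, hd, rfl, rfl⟩ := hg
  have hB := polyMap_ne_zero_of_eval t hb
  have hD := polyMap_ne_zero_of_eval t hd
  refine ⟨a * d + b * c, b * d, ?_, ?_, ?_⟩
  · rw [map_mul]; exact mul_ne_zero hb hd
  · rw [div_add_div _ _ hB hD, map_add, map_mul, map_mul, map_mul]
  · rw [div_add_div _ _ hb hd, map_add, map_mul, map_mul, map_mul]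

lemma mul (hf : HasValueAt f t v) (hg : HasValueAt g t w) : HasValueAt (f * g) t (v * w) := by
  obtain ⟨a, b, hb, rfl, rfl⟩ := hf
  obtain ⟨c, d, hd, rfl, rfl⟩ := hg
  refine ⟨a * c, b * d, ?_, ?_, ?_⟩
  · rw [map_mul]; exact mul_ne_zero hb hd
  · rw [div_mul_div_comm, map_mul, map_mul]
  · rw [div_mul_div_comm, map_mul, map_mul]

lemma inv (hf : HasValueAt f t v) (hv : v ≠ 0) : HasValueAt f⁻¹ t v⁻¹ := by
  obtain ⟨a, b, hb, rfl, rfl⟩ := hf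
  exact ⟨b, a, fun h => hv (by rw [h, zero_div]), inv_div _ _, inv_div _ _⟩

lemma div (hf : HasValueAt f t v) (hg : HasValueAt g t w) (hw : w ≠ 0) :
    HasValueAt (f / g) t (v / w) := by
  rw [div_eq_mul_inv, div_eq_mul_inv]
  exact hf.mul (hg.inv hw)

lemma one : HasValueAt (1 : RatFun N) t 1 := by
  have := cst (N := N) (t := t) 1
  rwa [Garnier.cst, map_one, map_one] at this

lemma neg (hf : HasValueAt f t v) : HasValueAt (-f) t (-v) := by
  have h1 : HasValueAt (-1 : RatFun N) t (-1) := by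
    have := cst (N := N) (t := t) (-1)
    rwa [Garnier.cst, map_neg, map_neg, map_one, map_one] at this
  have := h1.mul hf
  rwa [neg_one_mul, neg_one_mul] at this

lemma sub (hf : HasValueAt f t v) (hg : HasValueAt g t w) : HasValueAt (f - g) t (v - w) := by
  rw [sub_eq_add_neg, sub_eq_add_neg]
  exact hf.add hg.neg

lemma two : HasValueAt (2 : RatFun N) t 2 := by
  rw [← one_add_one_eq_two, ← one_add_one_eq_two]
  exact one.add one

lemma intCast (m : ℤ) : HasValueAt (m : RatFun N) t (m : ℂ) := by
  have := cst (N := N) (t := t) (m : ℂ)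
  rwa [Garnier.cst, map_intCast, map_intCast] at this

lemma sum {ι : Type*} (S : Finset ι) {f : ι → RatFun N} {v : ι → ℂ}
    (h : ∀ i ∈ S, HasValueAt (f i) t (v i)) : HasValueAt (∑ i ∈ S, f i) t (∑ i ∈ S, v i) := by
  classical
  induction S using Finset.induction_on with
  | empty =>
    have := cst (N := N) (t := t) 0
    rwa [Garnier.cst, map_zero, map_zero] at this
  | insert i S hi ih =>
    rw [Finset.sum_insert hi, Finset.sum_insert hi]
    exact (h i (Finset.mem_insert_self i S)).add
      (ih fun j hj => h j (Finset.mem_insert_of_mem hj))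

lemma normDlog {κ : ℂ} {θ : Fin N → ℂ} {m n : ℤ} {i : Fin N} (h0 : t i ≠ 0) (h1 : t i + 1 ≠ 0)
    (h2 : t i - 1 ≠ 0) (h3 : ∀ j, i ≠ j → t i + t j ≠ 0) :
    HasValueAt (Garnier.normDlog (N := N) Garnier.tvar (Garnier.cst κ) (fun i => Garnier.cst (θ i))
      (m : RatFun N) (n : RatFun N) i) t (Garnier.normDlog t κ θ (m : ℂ) (n : ℂ) i) := by
  have hθ : ∀ j, HasValueAt (Garnier.cst (θ j) : RatFun N) t (θ j) := fun j => cst _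
  have hS : HasValueAt (∑ k, Garnier.cst (θ k) : RatFun N) t (∑ k, θ k) :=
    sum _ fun j _ => hθ j
  have hA : HasValueAt (Garnier.cst (θ i) + (m : RatFun N) + (n : RatFun N)) t
      (θ i + (m : ℂ) + (n : ℂ)) := ((hθ i).add (intCast m)).add (intCast n)
  have h2m : HasValueAt (2 * (m : RatFun N)) t (2 * (m : ℂ)) := two.mul (intCast m)
  refine ((HasValueAt.add ?_ ?_).add ?_).add (sum _ fun j hj => ?_)
  · exact ((hA.mul (hA.sub one)).div two two_ne_zero).div (tvar i) h0
  · exact ((((hθ i).mul ((hS.add (cst κ)).add h2m)).neg).div two two_ne_zero).div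
      ((tvar i).add one) h1
  · exact ((((hθ i).mul ((hS.sub (cst κ)).add h2m)).neg).div two two_ne_zero).div
      ((tvar i).sub one) h2
  · exact ((hθ i).mul (hθ j)).div ((tvar i).add (tvar j))
      (h3 j (Finset.ne_of_mem_erase hj).symm)

end HasValueAt

lemma hasDerivAt_update_apply (t : Fin N → ℂ) (i j : Fin N) :
    HasDerivAt (fun z => Function.update t i z j) (if j = i then 1 else 0) (t i) := by
  by_cases h : j = i
  · subst h
    simpa using hasDerivAt_id' (t j)
  · simpa [Function.update_of_ne h, h] using hasDerivAt_const (t i) (t j)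

lemma hasDerivAt_eval (p : MvPolynomial (Fin N) ℂ) (t : Fin N → ℂ) (i : Fin N) :
    HasDerivAt (fun z => MvPolynomial.eval (Function.update t i z) p)
      (MvPolynomial.eval t (MvPolynomial.pderiv i p)) (t i) := by
  induction p using MvPolynomial.induction_on with
  | C c => simpa using hasDerivAt_const (t i) c
  | add p q hp hq => simpa using hp.fun_add hq
  | mul_X p j hp =>
    have h := hp.mul (hasDerivAt_update_apply t i j)
    have e : MvPolynomial.eval t (MvPolynomial.pderiv i (p * MvPolynomial.X j)) =
        MvPolynomial.eval t (MvPolynomial.pderiv i p) * Function.update t i (t i) j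
          + MvPolynomial.eval (Function.update t i (t i)) p * (if j = i then 1 else 0) := by
      rw [Derivation.leibniz, MvPolynomial.pderiv_X]
      simp only [smul_eq_mul, map_add, map_mul, MvPolynomial.eval_X, Function.update_eq_self,
        Pi.single_apply]
      split_ifs <;> simp <;> ring
    rw [e]
    refine h.congr_of_eventuallyEq (Filter.Eventually.of_forall fun z => ?_)
    simp

lemma differentiable_eval (p : MvPolynomial (Fin N) ℂ) :
    Differentiable ℂ fun t : Fin N → ℂ => MvPolynomial.eval t p := by
  induction p using MvPolynomial.induction_on with
  | C c => simp
  | add p q hp hq => simpa using hp.fun_add hq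
  | mul_X p j hp =>
    simp only [map_mul, MvPolynomial.eval_X]
    exact hp.mul (differentiable_apply j)

/-- The value of a rational function where it is regular, and `0` elsewhere. -/
def valueAt (f : RatFun N) (t : Fin N → ℂ) : ℂ :=
  open Classical in if h : ∃ v, HasValueAt f t v then h.choose else 0

lemma HasValueAt.valueAt_eq {f : RatFun N} {t : Fin N → ℂ} {v : ℂ} (h : HasValueAt f t v) :
    valueAt f t = v := by
  have h' : ∃ v, HasValueAt f t v := ⟨v, h⟩
  rw [valueAt, dif_pos h']
  exact h'.choose_spec.unique h

/-- `valueAt` is chosen point by point. Near a regular point one fraction represents all its values,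
which gives access to derivatives. -/
lemma eventually_valueAt_eq {t : Fin N → ℂ} {a b : MvPolynomial (Fin N) ℂ}
    (hb : MvPolynomial.eval t b ≠ 0) :
    ∀ᶠ t' in nhds t, valueAt (polyMap N a / polyMap N b) t' =
      MvPolynomial.eval t' a / MvPolynomial.eval t' b := by
  have hc : ContinuousAt (fun t' => MvPolynomial.eval t' b) t :=
    (differentiable_eval b).continuous.continuousAt
  filter_upwards [hc.eventually_ne hb] with t' ht'
  exact HasValueAt.valueAt_eq ⟨a, b, ht', rfl, rfl⟩

lemma HasValueAt.differentiableAt {f : RatFun N} {t : Fin N → ℂ} {v : ℂ} (h : HasValueAt f t v) :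
    DifferentiableAt ℂ (valueAt f) t := by
  obtain ⟨a, b, hb, rfl, -⟩ := h
  have ha : DifferentiableAt ℂ (fun t' => MvPolynomial.eval t' a) t := differentiable_eval a t
  have hb' : DifferentiableAt ℂ (fun t' => MvPolynomial.eval t' b) t := differentiable_eval b t
  refine DifferentiableAt.congr_of_eventuallyEq ?_ (eventually_valueAt_eq hb)
  simp only [div_eq_mul_inv]
  exact ha.fun_mul (hb'.fun_inv hb)

lemma tendsto_update (t : Fin N → ℂ) (i : Fin N) :
    Filter.Tendsto (fun z => Function.update t i z) (nhds (t i)) (nhds t) := by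
  have h : ContinuousAt (fun z => Function.update t i z) (t i) :=
    (hasDerivAt_update t i (t i)).continuousAt
  have h' := h.tendsto
  rwa [Function.update_eq_self] at h'

lemma HasValueAt.pd {f : RatFun N} {t : Fin N → ℂ} {v : ℂ} (h : HasValueAt f t v) (i : Fin N) :
    ∃ v', HasValueAt (pdD i f) t v' ∧
      HasDerivAt (fun z => valueAt f (Function.update t i z)) v' (t i) := by
  obtain ⟨a, b, hb, rfl, -⟩ := h
  have hb0 : b ≠ 0 := by rintro rfl; simp at hb
  refine ⟨_, ⟨_, b ^ 2, ?_, pd_div i a b hb0, rfl⟩, ?_⟩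
  · rw [map_pow]; exact pow_ne_zero 2 hb
  · have hb' : MvPolynomial.eval (Function.update t i (t i)) b ≠ 0 := by
      rwa [Function.update_eq_self]
    have hd := (hasDerivAt_eval a t i).fun_div (hasDerivAt_eval b t i) hb'
    rw [Function.update_eq_self] at hd
    rw [map_sub, map_mul, map_mul, map_pow]
    exact hd.congr_of_eventuallyEq ((tendsto_update t i).eventually (eventually_valueAt_eq hb))

/-! ### The normalizing factor -/

/-- The partial derivatives of a branch of a logarithm. -/
lemma hasDerivAt_log_branch {L φ : (Fin N → ℂ) → ℂ} {U : Set (Fin N → ℂ)} (hU : IsOpen U)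
    (hL : DifferentiableOn ℂ L U) (hφ : ∀ t ∈ U, Complex.exp (L t) = φ t) {t : Fin N → ℂ}
    (ht : t ∈ U) (i : Fin N) {φ' : ℂ}
    (hd : HasDerivAt (fun z => φ (Function.update t i z)) φ' (t i)) :
    HasDerivAt (fun z => L (Function.update t i z)) (φ' / φ t) (t i) := by
  have hLt : DifferentiableAt ℂ L t := hL.differentiableAt (hU.mem_nhds ht)
  have hLt' : DifferentiableAt ℂ L (Function.update t i (t i)) := by
    rwa [Function.update_eq_self]
  have h1 : DifferentiableAt ℂ (fun z => L (Function.update t i z)) (t i) :=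
    hLt'.comp (t i) (hasDerivAt_update t i (t i)).differentiableAt
  have h2 := h1.hasDerivAt
  have h3 := h2.cexp
  have h4 : HasDerivAt (fun z => Complex.exp (L (Function.update t i z))) φ' (t i) :=
    hd.congr_of_eventuallyEq
      ((tendsto_update t i).eventually ((hU.eventually_mem ht).mono fun t' h => hφ t' h))
  -- Two expressions for the derivative of exp L = φ; division by φ ≠ 0 gives that of L.
  have h5 := h3.unique h4
  rw [Function.update_eq_self, hφ t ht] at h5
  have h6 : φ t ≠ 0 := by rw [← hφ t ht]; exact Complex.exp_ne_zero _
  have h7 : φ' / φ t = deriv (fun z => L (Function.update t i z)) (t i) := by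
    rw [div_eq_iff h6, mul_comm, h5]
  rw [h7]
  exact h2

/-- A logarithm of the normalizing factor. -/
def normLog {U : Set (Fin N → ℂ)} (B : LogBranches U) (κ : ℂ) (θ : Fin N → ℂ) (m n : ℤ)
    (t : Fin N → ℂ) : ℂ :=
  ∑ i, ((θ i + m + n) * (θ i + m + n - 1) / 2 * B.log0 i t
      + -(θ i * (∑ k, θ k + κ + 2 * m)) / 2 * B.logPlus i t
      + -(θ i * (∑ k, θ k - κ + 2 * m)) / 2 * B.logMinus i t)
    + ∑ i, ∑ j ∈ Finset.univ.erase i, θ i * θ j / 2 * B.logSum i j t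

section normFactor

variable {U : Set (Fin N → ℂ)} (B : LogBranches U) (κ : ℂ) (θ : Fin N → ℂ) (m n : ℤ)

lemma normFactor_eq (t : Fin N → ℂ) :
    normFactor B κ θ m n t = Complex.exp (normLog B κ θ m n t) := by
  simp only [normFactor, normLog, Complex.exp_add, Complex.exp_sum]

lemma differentiableOn_normLog : DifferentiableOn ℂ (normLog B κ θ m n) U := by
  refine DifferentiableOn.add (DifferentiableOn.fun_sum fun i _ => ?_)
    (DifferentiableOn.fun_sum fun i _ => DifferentiableOn.fun_sum fun j hj => ?_)
  · exact (((B.holo0 i).const_mul _).add ((B.holoPlus i).const_mul _)).add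
      ((B.holoMinus i).const_mul _)
  · exact (B.holoSum i j (Finset.ne_of_mem_erase hj).symm).const_mul _

lemma hasDerivAt_normLog (hU : IsOpen U) {t : Fin N → ℂ} (ht : t ∈ U) (i : Fin N) :
    HasDerivAt (fun z => normLog B κ θ m n (Function.update t i z))
      (normDlog t κ θ (m : ℂ) (n : ℂ) i) (t i) := by
  have d0 : ∀ j, HasDerivAt (fun z => B.log0 j (Function.update t i z))
      ((if j = i then 1 else 0) / t j) (t i) := fun j =>
    hasDerivAt_log_branch (φ := fun t => t j) hU (B.holo0 j) (B.exp_log0 j) ht i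
      (hasDerivAt_update_apply t i j)
  have d1 : ∀ j, HasDerivAt (fun z => B.logPlus j (Function.update t i z))
      ((if j = i then 1 else 0) / (t j + 1)) (t i) := fun j =>
    hasDerivAt_log_branch (φ := fun t => t j + 1) hU (B.holoPlus j) (B.exp_logPlus j) ht i
      ((hasDerivAt_update_apply t i j).add_const 1)
  have d2 : ∀ j, HasDerivAt (fun z => B.logMinus j (Function.update t i z))
      ((if j = i then 1 else 0) / (t j - 1)) (t i) := fun j =>
    hasDerivAt_log_branch (φ := fun t => t j - 1) hU (B.holoMinus j) (B.exp_logMinus j) ht i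
      ((hasDerivAt_update_apply t i j).sub_const 1)
  have d3 : ∀ j k, j ≠ k → HasDerivAt (fun z => B.logSum j k (Function.update t i z))
      (((if j = i then 1 else 0) + (if k = i then 1 else 0)) / (t j + t k)) (t i) :=
    fun j k hjk => hasDerivAt_log_branch (φ := fun t => t j + t k) hU (B.holoSum j k hjk)
      (B.exp_logSum j k hjk) ht i
      ((hasDerivAt_update_apply t i j).add (hasDerivAt_update_apply t i k))
  have h := (HasDerivAt.fun_sum (u := Finset.univ) fun j _ =>
    (((d0 j).const_mul ((θ j + m + n) * (θ j + m + n - 1) / 2)).add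
      ((d1 j).const_mul (-(θ j * (∑ k, θ k + κ + 2 * m)) / 2))).add
      ((d2 j).const_mul (-(θ j * (∑ k, θ k - κ + 2 * m)) / 2))).add
    (HasDerivAt.fun_sum (u := Finset.univ) fun j _ =>
      HasDerivAt.fun_sum (u := Finset.univ.erase j) fun k hk =>
        (d3 j k (Finset.ne_of_mem_erase hk).symm).const_mul (θ j * θ k / 2))
  refine h.congr_deriv ?_
  have hpair : ∑ j, ∑ k ∈ Finset.univ.erase j,
      θ j * θ k / 2 * (((if j = i then 1 else 0) + (if k = i then 1 else 0)) / (t j + t k)) =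
      ∑ j ∈ Finset.univ.erase i, θ i * θ j / (t i + t j) := by
    -- The variable t_i can occur in either place of an ordered pair. Both contributions are equal,
    -- so the exponents θ_iθ_j/2 add up to θ_iθ_j.
    have hswap : ∑ j, ∑ k ∈ Finset.univ.erase j,
        θ j * θ k / 2 * ((if k = i then 1 else 0) / (t j + t k)) =
        ∑ j, ∑ k ∈ Finset.univ.erase j,
          θ j * θ k / 2 * ((if j = i then 1 else 0) / (t j + t k)) := by
      rw [Finset.sum_comm' (t' := Finset.univ) (s' := fun j => Finset.univ.erase j)
        (fun i k => by simp [eq_comm])]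
      refine Finset.sum_congr rfl fun j _ => Finset.sum_congr rfl fun k _ => ?_
      rw [mul_comm (θ k), add_comm (t k)]
    simp only [add_div, mul_add, Finset.sum_add_distrib]
    rw [hswap, ← Finset.sum_add_distrib, Finset.sum_eq_single i]
    · rw [← Finset.sum_add_distrib]
      refine Finset.sum_congr rfl fun k _ => ?_
      simp only [if_true]
      ring
    · intro j _ hj
      simp [hj]
    · simp
  rw [hpair, normDlog]
  congr 1
  rw [Finset.sum_eq_single i]
  · simp only [if_true]; ring
  · intro j _ hj
    simp [hj]
  · simp

end normFactor

/-- A rational function with the right logarithmic derivatives is a normalized τ-function. -/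
lemma isNormalizedTau_of_isTauDlog {κ : ℂ} {θ : Fin N → ℂ} {m n : ℤ} {T : RatFun N} (hT : T ≠ 0)
    (h : IsTauDlog tvar pdD (cst κ) (fun i => cst (θ i)) (m : RatFun N) (n : RatFun N)
      (sol κ θ m n) T) : IsNormalizedTau κ θ m n T := by
  refine ⟨hT, fun U hU B hv => ?_⟩
  have hval : ∀ t ∈ U, HasValueAt T t (valueAt T t) ∧ valueAt T t ≠ 0 := by
    intro t ht
    obtain ⟨v, hv0, hv⟩ := hv t ht
    rw [hv.valueAt_eq]
    exact ⟨hv, hv0⟩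
  -- τ is T divided by the normalizing factor, written as an exponential so that it is holomorphic
  -- on U and its derivative is that of `normLog`.
  refine ⟨fun t => valueAt T t * Complex.exp (-normLog B κ θ m n t), ⟨?_, fun t ht => ⟨?_, ?_⟩⟩,
    fun t ht => ?_⟩
  · refine DifferentiableOn.mul (fun t ht => ?_) ?_
    · exact (hval t ht).1.differentiableAt.differentiableWithinAt
    · exact (differentiableOn_normLog B κ θ m n).neg.cexp
  · exact mul_ne_zero (hval t ht).2 (Complex.exp_ne_zero _)
  · intro i
    obtain ⟨v', hv', hd⟩ := (hval t ht).1.pd i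
    have h0 : t i ≠ 0 := by rw [← B.exp_log0 i t ht]; exact Complex.exp_ne_zero _
    have h1 : t i + 1 ≠ 0 := by rw [← B.exp_logPlus i t ht]; exact Complex.exp_ne_zero _
    have h2 : t i - 1 ≠ 0 := by rw [← B.exp_logMinus i t ht]; exact Complex.exp_ne_zero _
    have h3 : ∀ j, i ≠ j → t i + t j ≠ 0 := fun j hij => by
      rw [← B.exp_logSum i j hij t ht]; exact Complex.exp_ne_zero _
    have hn := HasValueAt.normDlog (κ := κ) (θ := θ) (m := m) (n := n) h0 h1 h2 h3
    -- Regularity of H_i on U is not given. Solving the logarithmic derivative relation for H_i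
    -- yields it, since T and the denominators of `normDlog` do not vanish there.
    have hham : ham svar (sol κ θ m n) i = (pdD i T / T - Garnier.normDlog tvar (cst κ)
        (fun i => cst (θ i)) (m : RatFun N) (n : RatFun N) i) / (2 * tvar i) := by
      have := tvar_ne_zero i
      rw [eq_div_iff (mul_ne_zero two_ne_zero this), h i]
      rw [svar_eq]
      ring
    refine ⟨(v' / valueAt T t - normDlog t κ θ (m : ℂ) (n : ℂ) i) / (2 * t i), ?_, ?_⟩
    · rw [hham]
      exact ((hv'.div (hval t ht).1 (hval t ht).2).sub hn).div
        (HasValueAt.two.mul (HasValueAt.tvar i)) (mul_ne_zero two_ne_zero h0)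
    · have hd2 := hd.mul (hasDerivAt_normLog B κ θ m n hU ht i).neg.cexp
      refine hd2.congr_deriv ?_
      have hv0 := (hval t ht).2
      simp only [Pi.neg_apply, Function.update_eq_self]
      field_simp
      ring
  · have e : valueAt T t * Complex.exp (-normLog B κ θ m n t) * normFactor B κ θ m n t =
        valueAt T t := by
      rw [normFactor_eq, mul_assoc, ← Complex.exp_add, neg_add_cancel, Complex.exp_zero, mul_one]
    change HasValueAt T t
      (valueAt T t * Complex.exp (-normLog B κ θ m n t) * normFactor B κ θ m n t)
    rw [e]
    exact (hval t ht).1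

end
end Garnier

theorem proposition3p2 (N : ℕ) (hN : 1 ≤ N) (κ : ℂ) (θ : Fin N → ℂ) (hκ : κ ≠ 0)
    (hdef : Garnier.OrbitDefined κ θ) :
    ∃! T : ℤ → ℤ → Garnier.RatFun N,
      (∀ m n : ℤ, Garnier.IsNormalizedTau κ θ m n (T m n)) ∧
      T 0 0 = 1 ∧ T 0 1 = 1 ∧
      T 1 0 = ∑ i, Garnier.cst (θ i) * Garnier.tvar i - Garnier.cst κ ∧
      T 1 1 = (∏ i, Garnier.tvar i) *
        (Garnier.cst κ - ∑ j, Garnier.cst (θ j) * (Garnier.tvar j)⁻¹) ∧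
      (∀ m n : ℤ, T (m + 1) n =
        (∏ i, Garnier.tvar i) * (Garnier.todaBrace κ θ (T m n) + (2 * (m : Garnier.RatFun N)) ^ 2) *
          (T m n ^ 2 / T (m - 1) n)) ∧
      (∀ m n : ℤ, T m (n + 1) =
        (∏ i, Garnier.tvar i) *
          (Garnier.todaBrace κ θ (T m n) + (2 * (n : Garnier.RatFun N) - 1) ^ 2) *
          (T m n ^ 2 / T m (n - 1))) := by
  have hκ' : (Garnier.cst κ : Garnier.RatFun N) ≠ 0 :=
    Garnier.polyMap_ne_zero (MvPolynomial.C_ne_zero.2 hκ)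
  obtain ⟨T, hT0, hT, h00, h01, h10, h11, h1, h2⟩ := Garnier.exists_normalized_tau
    (Garnier.rootVars_tvar (N := N)) hκ' (fun j => Garnier.pdD_cst j κ)
    (fun j i => Garnier.pdD_cst j (θ i)) (Garnier.orbitReg_of_orbitDefined hdef)
  refine ⟨T, ⟨fun m n => Garnier.isNormalizedTau_of_isTauDlog (hT0 m n) (hT m n), h00, h01, h10,
    h11, h1, h2⟩, ?_⟩
  -- Of the τ-function property of T' only T' ≠ 0 is needed; the recursions and the four initial
  -- values determine the rest.
  rintro T' ⟨hT', h00', h01', h10', h11', h1', h2'⟩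
  exact Garnier.toda_array_unique (E := Garnier.todaBrace κ θ) (fun m n => (hT' m n).1) hT0
    (h00'.trans h00.symm) (h01'.trans h01.symm) (h10'.trans h10.symm) (h11'.trans h11.symm)
    h1' h1 h2' h2
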